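/- Let $G_0$ be a finite simple graph with at least one edge, with $v_{G_0}$ vertices, $e_{G_0}$ edges and $a_{G_0}$ automorphisms. Let $0<p<1$, $q:=1-p$, $n\in\mathbb N$, and let $G(n,p)$ be the Erdős–Rényi random graph on $n$ vertices, in which each of the $\binom n2$ possible edges is present with probability $p$, independently of the others. A subgraph of $G(n,p)$ is a copy of $G_0$ if it is isomorphic to $G_0$. Let $N$ be the number of copies of $G_0$ in $G(n,p)$, $\sigma^2:=\operatorname{Var}(N)$ and $W:=(N-\mathbb E[N])/\sigma$. Put $$\Psi_{\min}:=\min_{H\subset G_0,\ e_H\ge 1} n^{v_H}p^{e_H},$$ where the minimum is over the subgraphs $H$ of $G_0$ with at least one edge, and $v_H$, $e_H$ are the numbers of vertices and edges of $H$. Let $D$ be the number of subgraphs of the complete graph $K_n$ that are isomorphic to $G_0$ and share at least one edge with a given such subgraph $\Gamma$ ($\Gamma$ itself included; by symmetry this does not depend on $\Gamma$). Define, for $t\ge 0$, $$s(t):=\Big(1+\frac{t}{\min\{\sqrt{\Psi_{\min}},1\}}\Big)\frac{1}{\sqrt{q\Psi_{\min}}}\exp\Big(\frac{5Dt}{\sigma}\Big),$$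 $$c_{G_0}:=\frac{2^{\frac92+\frac{15}2e_{G_0}}\,(v_{G_0}!)^4\,e_{G_0}}{a_{G_0}^{3/2}},\qquad \hat c_{G_0}:=\sqrt2\cdot\frac{\sqrt{v_{G_0}!}\;v_{G_0}^2\,e_{G_0}}{\sqrt{a_{G_0}}}.$$ Let $c_1,c_2>0$ and assume that $$n\ge 4v_{G_0}^2,\qquad 0\le t\le c_1\cdot\frac{n^2p^{e_{G_0}}\sqrt q}{\sqrt{\Psi_{\min}}},\qquad t^2s(t)\le c_2 .$$ Then, with $\Phi$ the standard normal distribution function, $$\Big|\frac{\mathbb P(W>t)}{1-\Phi(t)}-1\Big|\le C_{c_1,c_2,G_0}\cdot\frac{1+t^3}{\sqrt{q\Psi_{\min}}},\qquad C_{c_1,c_2,G_0}:=100\,(1+c_1)\,c_{G_0}\,e^{5c_1\hat c_{G_0}+c_2c_{G_0}} .$$ -/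

import Mathlib

open MeasureTheory ProbabilityTheory

noncomputable section

namespace SubgraphCount

universe u

variable {V : Type u}

/-- The number of vertices `v_{G₀}`. -/
def numVertices [Fintype V] (_G₀ : SimpleGraph V) : ℕ := Fintype.card V

/-- The number of edges `e_{G₀}`. -/
def numEdges (G₀ : SimpleGraph V) : ℕ := G₀.edgeSet.ncard

/-- The number of automorphisms `a_{G₀}`. -/
def numAut (G₀ : SimpleGraph V) : ℕ := Nat.card (G₀ ≃g G₀)

/-- `Ψ_min`: the minimum of `n ^ v_H * p ^ e_H` over all subgraphs `H` of `G₀` with at least one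
edge. (The index set is finite, and non-empty when `G₀` has an edge, so that the infimum is a
minimum.) -/
def psiMin (G₀ : SimpleGraph V) (n : ℕ) (p : ℝ) : ℝ :=
  ⨅ H : {H : G₀.Subgraph // 1 ≤ H.edgeSet.ncard},
    (n : ℝ) ^ H.1.verts.ncard * p ^ H.1.edgeSet.ncard

/-- The number of copies of `G₀` in a graph `G` on `n` vertices, i.e. the number of subgraphs
of `G` that are isomorphic to `G₀`, as a real number. -/
def count (G₀ : SimpleGraph V) (n : ℕ) (G : SimpleGraph (Fin n)) : ℝ := (G.copyCount G₀ : ℝ)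

/-- The standard deviation `σ` of the number of copies of `G₀` in `G(n, p)`. -/
def sigma (G₀ : SimpleGraph V) (n : ℕ) (p : unitInterval) : ℝ :=
  √(variance (count G₀ n) (SimpleGraph.binomialRandom (Fin n) p))

/-- The standardized number `W` of copies of `G₀` in `G(n, p)`, a random variable on the space of
all graphs on `n` vertices with the law of `G(n, p)`. -/
def W (G₀ : SimpleGraph V) (n : ℕ) (p : unitInterval) (G : SimpleGraph (Fin n)) : ℝ :=
  (count G₀ n G - ∫ G', count G₀ n G' ∂(SimpleGraph.binomialRandom (Fin n) p)) / sigma G₀ n p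

/-- `Γ` is a possible copy of `G₀` in a graph on `n` vertices: a subgraph of the complete graph
that is isomorphic to `G₀`. -/
def IsPossibleCopy (G₀ : SimpleGraph V) {n : ℕ} (Γ : (⊤ : SimpleGraph (Fin n)).Subgraph) : Prop :=
  Nonempty (G₀ ≃g Γ.coe)

/-- The neighbourhood of `Γ`: all possible copies of `G₀` that share at least one edge with `Γ`
(including `Γ` itself, if it is a copy). -/
def neighborhood (G₀ : SimpleGraph V) {n : ℕ} (Γ : (⊤ : SimpleGraph (Fin n)).Subgraph) :
    Set (⊤ : SimpleGraph (Fin n)).Subgraph :=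
  {Γ' | IsPossibleCopy G₀ Γ' ∧ (Γ.edgeSet ∩ Γ'.edgeSet).Nonempty}

/-- `D`: the number of neighbours of a possible copy of `G₀`. It is written as a maximum over all
possible copies, but all of them have the same number of neighbours, see
`ncard_neighborhood_eq_degree`. -/
def degree (G₀ : SimpleGraph V) (n : ℕ) : ℕ :=
  ⨆ Γ : {Γ : (⊤ : SimpleGraph (Fin n)).Subgraph // IsPossibleCopy G₀ Γ},
    (neighborhood G₀ Γ.1).ncard

/-- Every possible copy of `G₀` can be moved to any other one by a permutation of the vertices. -/
theorem exists_perm_map_eq (G₀ : SimpleGraph V) {n : ℕ}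
    {Γ Γ' : (⊤ : SimpleGraph (Fin n)).Subgraph}
    (h : IsPossibleCopy G₀ Γ) (h' : IsPossibleCopy G₀ Γ') :
    ∃ f : (⊤ : SimpleGraph (Fin n)) ≃g (⊤ : SimpleGraph (Fin n)),
      Γ.map f.toHom = Γ' := by
  classical
  obtain ⟨e⟩ := h
  obtain ⟨e'⟩ := h'
  let g : Γ.coe ≃g Γ'.coe := e.symm.trans e'
  let π : Equiv.Perm (Fin n) :=
    Equiv.extendSubtype (p := (· ∈ Γ.verts)) (q := (· ∈ Γ'.verts)) g.toEquiv
  have hπ : ∀ x (hx : x ∈ Γ.verts), π x = g ⟨x, hx⟩ := fun x hx =>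
    Equiv.extendSubtype_apply_of_mem _ x hx
  refine ⟨SimpleGraph.Iso.completeGraph π, ?_⟩
  have hf : ∀ x, (SimpleGraph.Iso.completeGraph π).toHom x = π x := fun x => rfl
  ext x y
  · simp only [SimpleGraph.Subgraph.map_verts, Set.mem_image, hf]
    constructor
    · rintro ⟨z, hz, rfl⟩
      rw [hπ z hz]
      exact (g ⟨z, hz⟩).2
    · intro hx
      refine ⟨(g.symm ⟨x, hx⟩).1, (g.symm ⟨x, hx⟩).2, ?_⟩
      rw [hπ _ (g.symm ⟨x, hx⟩).2]
      simp
  · simp only [SimpleGraph.Subgraph.map_adj, Relation.Map, hf]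
    constructor
    · rintro ⟨a, b, hab, rfl, rfl⟩
      have ha := Γ.edge_vert hab
      have hb := Γ.edge_vert hab.symm
      rw [hπ a ha, hπ b hb]
      have : Γ.coe.Adj ⟨a, ha⟩ ⟨b, hb⟩ := hab
      exact g.map_rel_iff.2 this
    · intro hxy
      have hx := Γ'.edge_vert hxy
      have hy := Γ'.edge_vert hxy.symm
      have h2 : Γ'.coe.Adj ⟨x, hx⟩ ⟨y, hy⟩ := hxy
      have h3 : Γ.coe.Adj (g.symm ⟨x, hx⟩) (g.symm ⟨y, hy⟩) := g.symm.map_rel_iff.2 h2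
      refine ⟨(g.symm ⟨x, hx⟩).1, (g.symm ⟨y, hy⟩).1, h3, ?_, ?_⟩
      · rw [hπ _ (g.symm ⟨x, hx⟩).2]; simp
      · rw [hπ _ (g.symm ⟨y, hy⟩).2]; simp

theorem ncard_neighborhood_le (G₀ : SimpleGraph V) {n : ℕ}
    {Γ Γ' : (⊤ : SimpleGraph (Fin n)).Subgraph}
    (h : IsPossibleCopy G₀ Γ) (h' : IsPossibleCopy G₀ Γ') :
    (neighborhood G₀ Γ).ncard ≤ (neighborhood G₀ Γ').ncard := by
  obtain ⟨f, rfl⟩ := exists_perm_map_eq G₀ h h'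
  refine Set.ncard_le_ncard_of_injOn (fun Δ => Δ.map f.toHom) ?_ ?_ (Set.toFinite _)
  · rintro Δ ⟨⟨e⟩, a, ha, ha'⟩
    refine ⟨⟨e.trans (SimpleGraph.Copy.isoSubgraphMap f.toCopy Δ)⟩, Sym2.map f.toHom a, ?_, ?_⟩
    · rw [SimpleGraph.Subgraph.edgeSet_map]; exact ⟨a, ha, rfl⟩
    · rw [SimpleGraph.Subgraph.edgeSet_map]; exact ⟨a, ha', rfl⟩
  · intro Δ _ Δ' _ hΔ
    have key : ∀ X : (⊤ : SimpleGraph (Fin n)).Subgraph,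
        (X.map f.toHom).map f.symm.toHom = X := fun X => by
      rw [← SimpleGraph.Subgraph.map_comp]
      have : f.symm.toHom.comp f.toHom = SimpleGraph.Hom.id := by
        ext x
        simp
      rw [this, SimpleGraph.Subgraph.map_id]
    rw [← key Δ, ← key Δ']
    exact congrArg _ hΔ

/-- All possible copies of `G₀` have exactly `D` neighbours. -/
theorem ncard_neighborhood_eq_degree (G₀ : SimpleGraph V) {n : ℕ}
    {Γ : (⊤ : SimpleGraph (Fin n)).Subgraph} (h : IsPossibleCopy G₀ Γ) :
    (neighborhood G₀ Γ).ncard = degree G₀ n := by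
  have : Nonempty {Γ : (⊤ : SimpleGraph (Fin n)).Subgraph // IsPossibleCopy G₀ Γ} := ⟨⟨Γ, h⟩⟩
  apply le_antisymm
  · exact le_ciSup (f := fun Γ : {Γ : (⊤ : SimpleGraph (Fin n)).Subgraph // IsPossibleCopy G₀ Γ} =>
      (neighborhood G₀ Γ.1).ncard) (Set.finite_range _).bddAbove ⟨Γ, h⟩
  · exact ciSup_le fun Γ' => ncard_neighborhood_le G₀ Γ'.2 h

/-- The function `s(t)`, with `q = 1 - p`. -/
def s (G₀ : SimpleGraph V) (n : ℕ) (p : unitInterval) (t : ℝ) : ℝ :=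
  (1 + t / min (√(psiMin G₀ n p)) 1) * (1 / √((1 - (p : ℝ)) * psiMin G₀ n p)) *
    Real.exp (5 * (degree G₀ n : ℝ) * t / sigma G₀ n p)

/-- The constant `c_{G₀}`. -/
def cConst [Fintype V] (G₀ : SimpleGraph V) : ℝ :=
  (2 : ℝ) ^ ((9 / 2 : ℝ) + (15 / 2 : ℝ) * (numEdges G₀ : ℝ)) *
      ((numVertices G₀).factorial : ℝ) ^ 4 * (numEdges G₀ : ℝ) /
    (numAut G₀ : ℝ) ^ (3 / 2 : ℝ)

/-- The constant `ĉ_{G₀}`. -/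
def cHat [Fintype V] (G₀ : SimpleGraph V) : ℝ :=
  √2 * (√((numVertices G₀).factorial : ℝ) * (numVertices G₀ : ℝ) ^ 2 * (numEdges G₀ : ℝ) /
    √(numAut G₀ : ℝ))

/-- The constant `C_{c₁,c₂,G₀}`. -/
def bigC [Fintype V] (G₀ : SimpleGraph V) (c₁ c₂ : ℝ) : ℝ :=
  100 * (1 + c₁) * cConst G₀ * Real.exp (5 * c₁ * cHat G₀ + c₂ * cConst G₀)

/-- The standard normal distribution function `Φ`. -/
def Phi (t : ℝ) : ℝ := cdf (gaussianReal 0 1) t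

end SubgraphCount

end

/-! Every copy of `G₀` is the edge image of exactly `numAut G₀` injections of the vertices. Up to
this factor, which cancels in `W` and in `D / σ`, the count is `num S`, the number of members of a
symmetric family `S` of `e`-sets inside a random edge set. The probabilistic estimates are proved
for families with `IsRegular`; graphs enter through bounds of `wt`.

Stein's method rests on the size-bias identity `E_num_mul`: weighting by `num S` amounts to adding a
member `S c` to the random set. So `E[W f(W)]` is a sum of increments of `f`. If these are
controlled by a slope `f'` and by increments of a monotone `g`, then `E_std_mul_le` compares it with
`E[f'(W)]`, up to `E[T f'(W)]` and `E[Q g(W)]`. Here `T` is the centred number of members gained by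
the addition. `Q` arises because the density `p⁻¹ ^ e * ind (S c)` turns an increment of `g(W)` back
into a value of `g(W)`; monotonicity of `g` makes this work without smoothness of `f`. Both are sums
of centred local variables over intersecting pairs, dominated by `pairU`.

The core estimate, `E_abs_sum_mul_expNum_le`, bounds `E[|T| exp(θ W)]` and `E[|Q| exp(θ W)]` by `B *
(1 + θ) * E[exp(θ W)]` for `θ ≤ t`, with `B` of order `exp(3 D t / σ) / √(q Ψ_min)`. By
Cauchy–Schwarz it suffices to treat the tilted second moment. A local factor is decoupled from the
rest by deleting from the exponent the members that meet it. The first-order cost of the deletion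
brings back the first absolute moment, which leads to a quadratic inequality for it.

With `f = exp(θ ·)` this yields a differential inequality for the moment generating function, solved
in `E_exp_std_le`. With the Stein solution for a half-line, the test functions are at most `tail t *
weight t`, where `weight` combines finitely many `exp(θ x - θ² / 2)` with `θ ≤ t`; this produces the
relative error and the factor `1 + t³` (`abs_tail_div_sub_one_le`). The assumption on `t² s(t)`
bounds `B t² (1 + t)`, and the upper bound on `t` bounds `D t / σ`. For graphs, `wt` of a copy is
the number of embeddings divided by `Ψ_min`, up to constants (`wt_imgEdges_le`, `le_wt_imgEdges`).
If `q Ψ_min` is too small for these estimates, the crude `abs_div_tail_sub_one_le` suffices. -/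

noncomputable section

/-! ### Expectations over a random subset with independent elements -/

namespace RandomSubset

open Finset

variable {ι : Type*} [DecidableEq ι] {A B : Finset ι}

/-- The indicator that `A` is contained in the random set. -/
def ind (A ω : Finset ι) : ℝ := if A ⊆ ω then 1 else 0

theorem ind_nonneg (A ω : Finset ι) : 0 ≤ ind A ω := by unfold ind; split_ifs <;> norm_num

theorem ind_le_one (A ω : Finset ι) : ind A ω ≤ 1 := by unfold ind; split_ifs <;> norm_num

theorem ind_mul_ind (A B ω : Finset ι) : ind A ω * ind B ω = ind (A ∪ B) ω := by
  simp only [ind, union_subset_iff]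
  split_ifs <;> simp_all

theorem ind_anti (h : A ⊆ B) (ω : Finset ι) : ind B ω ≤ ind A ω := by
  unfold ind
  split_ifs with h1 h2
  · norm_num
  · exact absurd (h.trans h1) h2
  · norm_num
  · norm_num

theorem ind_union_right (A B ω : Finset ι) : ind A (ω ∪ B) = ind (A \ B) ω := by
  unfold ind
  congr 1
  exact propext ⟨fun h x hx => by grind, fun h x hx => by grind⟩

theorem ind_inter_of_subset (h : A ⊆ B) (ω : Finset ι) : ind A (ω ∩ B) = ind A ω := by
  unfold ind
  simp [subset_inter_iff, h]

theorem ind_sdiff_of_disjoint (h : Disjoint A B) (ω : Finset ι) : ind A (ω \ B) = ind A ω := by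
  unfold ind
  simp [subset_sdiff, h]

variable [Fintype ι]

/-- The expectation of `F ω`, where `ω` is a random subset of `ι` that contains each element with
probability `p`, independently of the others. -/
def E (p : ℝ) (F : Finset ι → ℝ) : ℝ := ∑ ω, p ^ #ω * (1 - p) ^ #ωᶜ * F ω

variable {p : ℝ} {F G : Finset ι → ℝ}

theorem E_add (p : ℝ) (F G : Finset ι → ℝ) :
    E p (fun ω => F ω + G ω) = E p F + E p G := by
  simp [E, mul_add, sum_add_distrib]

theorem E_sub (p : ℝ) (F G : Finset ι → ℝ) :
    E p (fun ω => F ω - G ω) = E p F - E p G := by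
  simp [E, mul_sub, sum_sub_distrib]

theorem E_const_mul (p c : ℝ) (F : Finset ι → ℝ) : E p (fun ω => c * F ω) = c * E p F := by
  simp only [E, mul_sum]
  exact sum_congr rfl fun _ _ => by ring

theorem E_mul_const (p c : ℝ) (F : Finset ι → ℝ) : E p (fun ω => F ω * c) = E p F * c := by
  simp only [E, sum_mul]
  exact sum_congr rfl fun _ _ => by ring

theorem E_sum {κ : Type*} (p : ℝ) (s : Finset κ) (F : κ → Finset ι → ℝ) :
    E p (fun ω => ∑ i ∈ s, F i ω) = ∑ i ∈ s, E p (F i) := by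
  simp only [E, mul_sum]
  exact sum_comm

theorem E_mono (h0 : 0 ≤ p) (h1 : p ≤ 1) (h : ∀ ω, F ω ≤ G ω) : E p F ≤ E p G :=
  sum_le_sum fun ω _ => mul_le_mul_of_nonneg_left (h ω)
    (mul_nonneg (pow_nonneg h0 _) (pow_nonneg (sub_nonneg.2 h1) _))

theorem E_nonneg (h0 : 0 ≤ p) (h1 : p ≤ 1) (h : ∀ ω, 0 ≤ F ω) : 0 ≤ E p F :=
  sum_nonneg fun ω _ =>
    mul_nonneg (mul_nonneg (pow_nonneg h0 _) (pow_nonneg (sub_nonneg.2 h1) _)) (h ω)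

/-- Conditioning on the presence of `a`; the inductions behind independence and the product formulas
rest on it. -/
theorem E_eq_insert_add_erase (p : ℝ) (F : Finset ι → ℝ) (a : ι) :
    E p F = p * E p (fun ω => F (insert a ω)) + (1 - p) * E p (fun ω => F (ω.erase a)) := by
  have key : ∀ H : Finset ι → ℝ, E p H = ∑ t ∈ (univ.erase a).powerset,
      p ^ #t * (1 - p) ^ (#(univ : Finset ι) - 1 - #t) * ((1 - p) * H t + p * H (insert a t)) := by
    intro H
    have hu : (univ : Finset (Finset ι)) = (insert a (univ.erase a)).powerset := by
      rw [insert_erase (mem_univ a), powerset_univ]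
    rw [E, hu, sum_powerset_insert (notMem_erase a univ), ← sum_add_distrib]
    refine sum_congr rfl fun t ht => ?_
    have hat : a ∉ t := fun h => notMem_erase a univ (mem_powerset.1 ht h)
    have hc : #t + 1 ≤ #(univ : Finset ι) := by
      rw [← card_insert_of_notMem hat]; exact card_le_card (subset_univ _)
    rw [card_compl, card_compl, card_insert_of_notMem hat]
    have e1 : Fintype.card ι - #t = (#(univ : Finset ι) - 1 - #t) + 1 := by
      rw [card_univ] at *; omega
    have e2 : Fintype.card ι - (#t + 1) = #(univ : Finset ι) - 1 - #t := by
      rw [card_univ] at *; omega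
    rw [e1, e2]
    ring
  rw [key F, key, key, mul_sum, mul_sum, ← sum_add_distrib]
  refine sum_congr rfl fun t ht => ?_
  have hat : a ∉ t := fun h => notMem_erase a univ (mem_powerset.1 ht h)
  simp only [insert_idem, erase_insert hat, erase_eq_of_notMem hat]
  ring

@[simp] theorem E_const (p c : ℝ) : E p (fun _ : Finset ι => c) = c := by
  have h : ∑ ω : Finset ι, p ^ #ω * (1 - p) ^ #ωᶜ = 1 := by
    have := (Finset.prod_add (fun _ : ι => p) (fun _ => 1 - p) univ).symm
    simpa [powerset_univ, ← compl_eq_univ_sdiff] using this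
  rw [E, ← sum_mul, h, one_mul]

/-- A function of `ω ∩ A` and a function of `ω \ A` are independent. -/
theorem E_mul_of_indep (p : ℝ) (A : Finset ι) : ∀ {F G : Finset ι → ℝ},
    (∀ ω, F (ω ∩ A) = F ω) → (∀ ω, G (ω \ A) = G ω) →
    E p (fun ω => F ω * G ω) = E p F * E p G := by
  induction A using Finset.induction_on with
  | empty =>
    intro F G hF _
    have : ∀ ω, F ω = F ∅ := fun ω => by rw [← hF ω, inter_empty]
    simp only [this, E_const_mul]
    rw [show F = fun _ => F ∅ from funext this, E_const]
  | insert a A ha ih =>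
    intro F G hF hG
    have hGi : ∀ ω, G (insert a ω) = G ω := fun ω => by
      rw [← hG (insert a ω), ← hG ω]; congr 1; ext x; simp
    have hGe : ∀ ω, G (ω.erase a) = G ω := fun ω => by
      rw [← hG (ω.erase a), ← hG ω]; congr 1; ext x; simp; tauto
    have hGA : ∀ ω, G (ω \ A) = G ω := fun ω => by
      rw [← hG (ω \ A), ← hG ω]; congr 1; ext x; simp; tauto
    have hF1 : ∀ ω, F (insert a (ω ∩ A)) = F (insert a ω) := fun ω => by
      rw [← hF (insert a (ω ∩ A)), ← hF (insert a ω)]; congr 1; ext x; simp; tauto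
    have hF2 : ∀ ω, F ((ω ∩ A).erase a) = F (ω.erase a) := fun ω => by
      rw [← hF ((ω ∩ A).erase a), ← hF (ω.erase a)]; congr 1; ext x; simp
    -- `G` ignores `a`, so conditioning splits only `F`, and both sections of `F` depend on `ω ∩ A`
    -- alone.
    rw [E_eq_insert_add_erase p (fun ω => F ω * G ω) a, E_eq_insert_add_erase p F a]
    simp only [hGi, hGe]
    rw [ih (F := fun ω => F (insert a ω)) hF1 hGA, ih (F := fun ω => F (ω.erase a)) hF2 hGA]
    ring

@[simp] theorem E_ind (p : ℝ) (A : Finset ι) : E p (ind A) = p ^ #A := by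
  induction A using Finset.induction_on with
  | empty =>
    rw [show ind (∅ : Finset ι) = fun _ => 1 from funext fun ω => by simp [ind], E_const]; simp
  | insert a A ha ih =>
    have h1 : (fun ω => ind (insert a A) (insert a ω)) = ind (ι := ι) A := by
      funext ω; unfold ind; congr 1
      exact propext ⟨fun h x hx => (mem_insert.1 (h (mem_insert_of_mem hx))).resolve_left
        (by rintro rfl; exact ha hx), insert_subset_insert a⟩
    have h2 : (fun ω : Finset ι => ind (insert a A) (ω.erase a)) = fun _ => 0 := by
      funext ω; unfold ind
      rw [if_neg fun h => notMem_erase a ω (h (mem_insert_self a A))]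
    rw [E_eq_insert_add_erase p _ a, h1, h2, ih, E_const, card_insert_of_notMem ha]
    ring

/-- The probability that the random set avoids `A`. -/
theorem E_disjoint (p : ℝ) (A : Finset ι) :
    E p (fun ω => if Disjoint A ω then 1 else 0) = (1 - p) ^ #A := by
  induction A using Finset.induction_on with
  | empty => simp
  | insert a A ha ih =>
    have h1 : (fun ω : Finset ι => if Disjoint (insert a A) (insert a ω) then (1 : ℝ) else 0) =
        fun _ => 0 := by
      funext ω; simp
    have h2 : (fun ω : Finset ι => if Disjoint (insert a A) (ω.erase a) then (1 : ℝ) else 0) =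
        fun ω => if Disjoint A ω then 1 else 0 := by
      funext ω
      congr 1
      refine propext ?_
      rw [disjoint_insert_left, ← disjoint_erase_comm, erase_eq_of_notMem ha]
      simp
    rw [E_eq_insert_add_erase p _ a, h1, h2, ih, E_const, card_insert_of_notMem ha]
    ring

/-- Conditioning on `A ⊆ ω` amounts to adding `A` to `ω`. -/
theorem E_ind_mul (p : ℝ) (A : Finset ι) (F : Finset ι → ℝ) :
    E p (fun ω => ind A ω * F ω) = p ^ #A * E p (fun ω => F (ω ∪ A)) := by
  rw [← E_ind, ← E_mul_of_indep p A (fun ω => ind_inter_of_subset (Subset.refl A) ω)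
    (fun ω => by simp)]
  congr 1
  funext ω
  by_cases h : A ⊆ ω
  · rw [union_eq_left.2 h]
  · simp [ind, h]

theorem abs_E_le (h0 : 0 ≤ p) (h1 : p ≤ 1) (F : Finset ι → ℝ) :
    |E p F| ≤ E p (fun ω => |F ω|) := by
  refine (abs_sum_le_sum_abs _ _).trans_eq (sum_congr rfl fun ω _ => ?_)
  rw [abs_mul, abs_of_nonneg (mul_nonneg (pow_nonneg h0 _) (pow_nonneg (sub_nonneg.2 h1) _))]

/-- The Cauchy–Schwarz inequality, with a weight. -/
theorem E_abs_mul_sq_le (h0 : 0 ≤ p) (h1 : p ≤ 1) (F : Finset ι → ℝ) {G : Finset ι → ℝ}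
    (hG : ∀ ω, 0 ≤ G ω) :
    E p (fun ω => |F ω| * G ω) ^ 2 ≤ E p (fun ω => F ω ^ 2 * G ω) * E p G := by
  have hw : ∀ ω : Finset ι, 0 ≤ p ^ #ω * (1 - p) ^ #ωᶜ := fun ω =>
    mul_nonneg (pow_nonneg h0 _) (pow_nonneg (sub_nonneg.2 h1) _)
  refine sum_sq_le_sum_mul_sum_of_sq_le_mul _ (fun ω _ => ?_) (fun ω _ => ?_) (fun ω _ => ?_)
  · exact mul_nonneg (hw ω) (mul_nonneg (sq_nonneg _) (hG ω))
  · exact mul_nonneg (hw ω) (hG ω)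
  · have : |F ω| ^ 2 = F ω ^ 2 := sq_abs _
    exact le_of_eq (by linear_combination (p ^ #ω * (1 - p) ^ #ωᶜ * G ω) ^ 2 * this)

end RandomSubset

end

/-! ### Regular families: weights and sums over intersecting pairs -/

noncomputable section

namespace RandomSubset

open Finset

variable {ι C : Type*} [DecidableEq ι] [Fintype C]

/-- The members of the family `S` that meet `A`. -/
def hits (S : C → Finset ι) (A : Finset ι) : Finset C := univ.filter fun c => ¬ Disjoint (S c) A

/-- The sum of `p ^ (-|S c ∩ A|)` over the members of the family that meet `A`. -/
def wt (S : C → Finset ι) (p : ℝ) (A : Finset ι) : ℝ := ∑ c ∈ hits S A, p⁻¹ ^ #(S c ∩ A)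

/-- The number of members of the family that are contained in `ω`. -/
def num (S : C → Finset ι) (ω : Finset ι) : ℝ := ∑ c, ind (S c) ω

/-- The pairs of members of the family that meet each other. -/
def pairs (S : C → Finset ι) : Finset (C × C) := univ.filter fun α => ¬ Disjoint (S α.2) (S α.1)

/-- The union of the two members of a pair. -/
def cov (S : C → Finset ι) (α : C × C) : Finset ι := S α.1 ∪ S α.2

/-- The pairs that meet `A`. -/
def linked (S : C → Finset ι) (A : Finset ι) : Finset (C × C) :=
  (pairs S).filter fun β => ¬ Disjoint (cov S β) A

/-- A family of sets of the same size `e`, such that `wt` is the same for all members of the family,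
and is under control for unions of up to three members, and no member meets more than `D`
members. -/
structure IsRegular (S : C → Finset ι) (p : ℝ) (e : ℕ) (D R κ : ℝ) : Prop where
  p_pos : 0 < p
  p_lt_one : p < 1
  card_eq : ∀ c, #(S c) = e
  e_pos : 1 ≤ e
  wt_eq : ∀ c, wt S p (S c) = R
  wt_le : ∀ a b c, wt S p (S a ∪ S b ∪ S c) ≤ κ * R
  hits_le : ∀ c, (#(hits S (S c)) : ℝ) ≤ D

theorem mem_hits {S : C → Finset ι} {A : Finset ι} {c : C} :
    c ∈ hits S A ↔ ¬ Disjoint (S c) A := by simp [hits]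

theorem mem_pairs {S : C → Finset ι} {α : C × C} :
    α ∈ pairs S ↔ ¬ Disjoint (S α.2) (S α.1) := by simp [pairs]

theorem mem_linked {S : C → Finset ι} {A : Finset ι} {β : C × C} :
    β ∈ linked S A ↔ β ∈ pairs S ∧ ¬ Disjoint (cov S β) A := by simp [linked]

theorem sum_pairs (S : C → Finset ι) (f : C × C → ℝ) :
    ∑ α ∈ pairs S, f α = ∑ c, ∑ c' ∈ hits S (S c), f (c, c') :=
  sum_finset_product _ _ _ fun α => by simp [mem_pairs, mem_hits]

theorem card_hits_union_le (S : C → Finset ι) (A B : Finset ι) :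
    (#(hits S (A ∪ B)) : ℝ) ≤ #(hits S A) + #(hits S B) := by
  classical
  have : hits S (A ∪ B) ⊆ hits S A ∪ hits S B := fun c hc => by
    simp only [mem_union, mem_hits, disjoint_union_right] at *; tauto
  exact_mod_cast (card_le_card this).trans (card_union_le _ _)

theorem pow_card_sdiff {p : ℝ} (hp : 0 < p) (A B : Finset ι) :
    p ^ #(B \ A) = p ^ #B * p⁻¹ ^ #(B ∩ A) := by
  rw [← card_sdiff_add_card_inter B A, pow_add, mul_assoc, ← mul_pow, mul_inv_cancel₀ hp.ne',
    one_pow, mul_one]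

/-- A linked pair meets `A` with its first or its second member; that member runs over `hits S A`,
the other one over the members meeting it. Double counting is harmless because `f` is nonnegative.
-/
theorem sum_linked_le_add (S : C → Finset ι) (A : Finset ι) {f : C × C → ℝ} (hf : ∀ β, 0 ≤ f β) :
    ∑ β ∈ linked S A, f β ≤ ∑ c ∈ hits S A, ∑ c' ∈ hits S (S c), f (c, c') +
      ∑ c ∈ hits S A, ∑ c' ∈ hits S (S c), f (c', c) := by
  classical
  have h1 : linked S A ⊆ (pairs S).filter (fun β => β.1 ∈ hits S A) ∪
      (pairs S).filter (fun β => β.2 ∈ hits S A) := fun β hβ => by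
    simp only [mem_linked, mem_union, mem_filter, mem_hits, cov, disjoint_union_left] at *; tauto
  refine (sum_le_sum_of_subset_of_nonneg h1 fun β _ _ => hf β).trans ?_
  have h2 : ∀ s t : Finset (C × C), ∑ β ∈ s ∪ t, f β ≤ ∑ β ∈ s, f β + ∑ β ∈ t, f β := fun s t => by
    rw [← sum_union_inter]
    exact le_add_of_nonneg_right (sum_nonneg fun β _ => hf β)
  refine (h2 _ _).trans_eq (congrArg₂ (· + ·) ?_ ?_)
  · exact sum_finset_product _ _ _ fun α => by
      simp only [mem_filter, mem_pairs, mem_hits]; tauto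
  · exact sum_finset_product_right _ _ _ fun α => by
      simp only [mem_filter, mem_pairs, mem_hits, disjoint_comm (a := S α.1) (b := S α.2)]; tauto

namespace IsRegular

variable {S : C → Finset ι} {p D R κ : ℝ} {e : ℕ} (h : IsRegular S p e D R κ)
include h

theorem one_le_inv : 1 ≤ p⁻¹ := (one_le_inv₀ h.p_pos).2 h.p_lt_one.le

theorem inv_pow_pos (n : ℕ) : 0 < p⁻¹ ^ n := pow_pos (inv_pos.2 h.p_pos) n

theorem card_hits_le_wt (A : Finset ι) : (#(hits S A) : ℝ) ≤ wt S p A := by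
  rw [card_eq_sum_ones, Nat.cast_sum]
  exact sum_le_sum fun c _ => by simpa using one_le_pow₀ h.one_le_inv

theorem wt_mono {A B : Finset ι} (hAB : A ⊆ B) : wt S p A ≤ wt S p B := by
  refine (sum_le_sum fun c _ => pow_le_pow_right₀ h.one_le_inv
    (card_le_card (inter_subset_inter_left hAB))).trans
    (sum_le_sum_of_subset_of_nonneg (fun c hc => ?_) fun c _ _ => (h.inv_pow_pos _).le)
  rw [mem_hits] at *
  exact fun hd => hc (hd.mono_right hAB)

theorem R_nonneg [Nonempty C] : 0 ≤ R := by
  obtain ⟨c⟩ := ‹Nonempty C›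
  rw [← h.wt_eq c]
  exact sum_nonneg fun c _ => (h.inv_pow_pos _).le

theorem one_le_R [Nonempty C] : 1 ≤ R := by
  obtain ⟨c⟩ := ‹Nonempty C›
  rw [← h.wt_eq c]
  have hc : c ∈ hits S (S c) := by
    rw [mem_hits, disjoint_self, bot_eq_empty, ← card_eq_zero, h.card_eq]
    have := h.e_pos; omega
  exact (one_le_pow₀ h.one_le_inv).trans
    (single_le_sum (f := fun c' => p⁻¹ ^ #(S c' ∩ S c)) (fun c _ => (h.inv_pow_pos _).le) hc)

theorem one_le_kappa [Nonempty C] : 1 ≤ κ := by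
  obtain ⟨c⟩ := ‹Nonempty C›
  have h1 := h.wt_le c c c
  simp only [union_self, h.wt_eq] at h1
  have : Nonempty C := ⟨c⟩
  have := h.one_le_R
  by_contra! hk
  nlinarith

theorem sum_pairs_inv_pow :
    ∑ α ∈ pairs S, p⁻¹ ^ #(S α.1 ∩ S α.2) = Fintype.card C * R := by
  rw [sum_pairs]
  have : ∀ c, ∑ c' ∈ hits S (S c), p⁻¹ ^ #(S c ∩ S c') = R := fun c => by
    rw [← h.wt_eq c, wt]
    exact sum_congr rfl fun c' _ => by rw [inter_comm]
  simp only [this, sum_const, nsmul_eq_mul, card_univ]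

/-- By inclusion–exclusion `|S c ∩ S c'| + |A ∩ (S c ∪ S c')| = |S c ∩ A| + |S c' ∩ (A ∪ S c)|`, so
the sum can be iterated: over `c'` it is at most `wt` of `A ∪ S c`, then over `c` it is `wt` of `A`.
Since `A` may be the union of a pair, regularity has to control unions of three members. -/
theorem sum_linked_le {A : Finset ι} (hA : ∀ c, wt S p (A ∪ S c) ≤ κ * R) :
    ∑ β ∈ linked S A, p⁻¹ ^ #(S β.1 ∩ S β.2) * p⁻¹ ^ #(A ∩ cov S β) ≤
      2 * wt S p A * (κ * R) := by
  have key : ∀ c c', p⁻¹ ^ #(S c ∩ S c') * p⁻¹ ^ #(A ∩ (S c ∪ S c')) =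
      p⁻¹ ^ #(S c ∩ A) * p⁻¹ ^ #(S c' ∩ (A ∪ S c)) := fun c c' => by
    rw [← pow_add, ← pow_add]
    congr 1
    have e1 := card_union_add_card_inter (A ∩ S c) (A ∩ S c')
    have e2 := card_union_add_card_inter (S c' ∩ A) (S c' ∩ S c)
    rw [← inter_union_distrib_left] at e1 e2
    have e3 : (A ∩ S c) ∩ (A ∩ S c') = (S c' ∩ A) ∩ (S c' ∩ S c) := by
      ext x; simp; tauto
    rw [e3] at e1
    rw [inter_comm (S c) (S c'), inter_comm (S c) A]
    rw [inter_comm (S c') A] at e2 e1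
    omega
  have bound : ∑ c ∈ hits S A, ∑ c' ∈ hits S (S c),
      p⁻¹ ^ #(S c ∩ S c') * p⁻¹ ^ #(A ∩ (S c ∪ S c')) ≤ wt S p A * (κ * R) := by
    rw [wt, sum_mul]
    refine sum_le_sum fun c _ => ?_
    simp only [key]
    rw [← mul_sum]
    refine mul_le_mul_of_nonneg_left (le_trans ?_ (hA c)) (h.inv_pow_pos _).le
    refine sum_le_sum_of_subset_of_nonneg (fun c' hc' => ?_) fun c _ _ => (h.inv_pow_pos _).le
    rw [mem_hits] at *
    exact fun hd => hc' (hd.mono_right subset_union_right)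
  refine (sum_linked_le_add S A fun β =>
    (mul_pos (h.inv_pow_pos _) (h.inv_pow_pos _)).le).trans ?_
  have : ∑ c ∈ hits S A, ∑ c' ∈ hits S (S c),
      p⁻¹ ^ #(S c' ∩ S c) * p⁻¹ ^ #(A ∩ (S c' ∪ S c)) ≤ wt S p A * (κ * R) := by
    simpa only [inter_comm (S _) (S _), union_comm (S _) (S _)] using bound
  simp only [cov]
  linarith

/-- Without the overlap factor for `A`, each inner sum is exactly `R`, and `wt S p A` bounds the
number of outer terms. -/
theorem sum_linked_inv_pow_le [Nonempty C] {A : Finset ι} (hA : wt S p A ≤ κ * R) :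
    ∑ β ∈ linked S A, p⁻¹ ^ #(S β.1 ∩ S β.2) ≤ 2 * κ * R ^ 2 := by
  refine (sum_linked_le_add S A fun β => (h.inv_pow_pos _).le).trans ?_
  have h1 : ∀ c, ∑ c' ∈ hits S (S c), p⁻¹ ^ #(S c' ∩ S c) = R := h.wt_eq
  have h2 : ∀ c, ∑ c' ∈ hits S (S c), p⁻¹ ^ #(S c ∩ S c') = R := fun c => by
    rw [← h1 c]; exact sum_congr rfl fun c' _ => by rw [inter_comm]
  simp only [h1, h2, sum_const, nsmul_eq_mul]
  have := mul_le_mul_of_nonneg_right ((h.card_hits_le_wt A).trans hA) h.R_nonneg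
  linarith

theorem wt_cov_union_le (α : C × C) (c : C) : wt S p (cov S α ∪ S c) ≤ κ * R := h.wt_le _ _ _

theorem wt_cov_le (α : C × C) : wt S p (cov S α) ≤ κ * R :=
  (h.wt_mono subset_union_left).trans (h.wt_le α.1 α.2 α.2)

theorem wt_union_le (c c' : C) : wt S p (S c ∪ S c') ≤ κ * R := h.wt_cov_le (c, c')

theorem card_hits_cov_le (α : C × C) : (#(hits S (cov S α)) : ℝ) ≤ 2 * D := by
  have := card_hits_union_le S (S α.1) (S α.2)
  have := h.hits_le α.1
  have := h.hits_le α.2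
  simp only [cov]
  linarith

end IsRegular

end RandomSubset

end

/-! ### Moments of the dominating variables `pairU` -/

noncomputable section

namespace RandomSubset

open Finset

variable {ι C : Type*} [DecidableEq ι] [Fintype C]

/-- The probability that a given member of a pair is present, divided by the probability of the
intersection. -/
def pairWt (S : C → Finset ι) (p : ℝ) (e : ℕ) (α : C × C) : ℝ := p ^ e * p⁻¹ ^ #(S α.1 ∩ S α.2)

/-- A common bound of the summands of `pairT` and `pairQ`. -/
def pairU (S : C → Finset ι) (p : ℝ) (e : ℕ) (α : C × C) (ω : Finset ι) : ℝ :=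
  ind (S α.2 \ S α.1) ω * (1 - ind (S α.1) ω) +
    (1 - p ^ e) * (p⁻¹ ^ e * ind (cov S α) ω) + (1 - p ^ e) * pairWt S p e α

namespace IsRegular

variable {S : C → Finset ι} {p D R κ : ℝ} {e : ℕ} (h : IsRegular S p e D R κ)
include h

theorem pow_nonneg' (n : ℕ) : 0 ≤ p ^ n := pow_nonneg h.p_pos.le n

theorem pow_le_one' (n : ℕ) : p ^ n ≤ 1 := pow_le_one₀ h.p_pos.le h.p_lt_one.le

theorem pow_mul_inv_pow (n : ℕ) : p ^ n * p⁻¹ ^ n = 1 := by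
  rw [← mul_pow, mul_inv_cancel₀ h.p_pos.ne', one_pow]

theorem one_sub_pow_nonneg : 0 ≤ 1 - p ^ e := sub_nonneg.2 (h.pow_le_one' e)

theorem one_sub_pow_le_one : 1 - p ^ e ≤ 1 := by linarith [h.pow_nonneg' e]

/-- Bernoulli's inequality. It turns the factor `1 - p ^ e` of the moment bounds into `q`, which
gives the right order of the error as `p` approaches one. -/
theorem one_sub_pow_le : 1 - p ^ e ≤ e * (1 - p) := by
  have := one_add_mul_le_pow (a := p - 1) (by linarith [h.p_pos]) e
  rw [show 1 + (p - 1) = p by ring] at this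
  linarith

theorem pairWt_nonneg (α : C × C) : 0 ≤ pairWt S p e α :=
  mul_nonneg (h.pow_nonneg' _) (h.inv_pow_pos _).le

theorem pairU_nonneg (α : C × C) (ω : Finset ι) : 0 ≤ pairU S p e α ω :=
  add_nonneg (add_nonneg (mul_nonneg (ind_nonneg _ _) (sub_nonneg.2 (ind_le_one _ _)))
    (mul_nonneg h.one_sub_pow_nonneg (mul_nonneg (h.inv_pow_pos _).le (ind_nonneg _ _))))
    (mul_nonneg h.one_sub_pow_nonneg (h.pairWt_nonneg α))

omit h in
theorem pairU_inter (α : C × C) (ω : Finset ι) :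
    pairU S p e α (ω ∩ cov S α) = pairU S p e α ω := by
  have h1 : S α.2 \ S α.1 ⊆ cov S α := sdiff_subset.trans subset_union_right
  have h2 : S α.1 ⊆ cov S α := subset_union_left
  simp only [pairU, ind_inter_of_subset h1, ind_inter_of_subset h2,
    ind_inter_of_subset (Subset.refl (cov S α))]

theorem pow_card_sdiff_eq (α : C × C) : p ^ #(S α.2 \ S α.1) = pairWt S p e α := by
  rw [pow_card_sdiff h.p_pos, h.card_eq, inter_comm, pairWt]

theorem pow_card_cov (α : C × C) : p⁻¹ ^ e * p ^ #(cov S α) = pairWt S p e α := by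
  rw [cov, ← union_sdiff_self_eq_union, card_union_of_disjoint disjoint_sdiff, pow_add,
    h.pow_card_sdiff_eq, h.card_eq, ← mul_assoc, mul_comm (p⁻¹ ^ e), h.pow_mul_inv_pow, one_mul]

theorem pow_card_union_le {A B A' : Finset ι} (hA : A ⊆ A') :
    p ^ #(A ∪ B) ≤ p ^ #A * (p ^ #B * p⁻¹ ^ #(B ∩ A')) := by
  rw [← union_sdiff_self_eq_union, card_union_of_disjoint disjoint_sdiff, pow_add,
    pow_card_sdiff h.p_pos]
  refine mul_le_mul_of_nonneg_left (mul_le_mul_of_nonneg_left ?_ (h.pow_nonneg' _)) (h.pow_nonneg' _)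
  exact pow_le_pow_right₀ h.one_le_inv (card_le_card (inter_subset_inter_left hA))

variable [Fintype ι]

omit h in
theorem E_pairU_mul_ind_eq (α : C × C) (B : Finset ι) :
    E p (fun ω => pairU S p e α ω * ind B ω) =
      (p ^ #(S α.2 \ S α.1 ∪ B) - p ^ #(S α.2 \ S α.1 ∪ B ∪ S α.1)) +
        (1 - p ^ e) * (p⁻¹ ^ e * p ^ #(cov S α ∪ B)) + (1 - p ^ e) * pairWt S p e α * p ^ #B := by
  have : (fun ω => pairU S p e α ω * ind B ω) = fun ω =>
      ((ind (S α.2 \ S α.1 ∪ B) ω - ind (S α.2 \ S α.1 ∪ B ∪ S α.1) ω) +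
        (1 - p ^ e) * (p⁻¹ ^ e * ind (cov S α ∪ B) ω)) + (1 - p ^ e) * pairWt S p e α * ind B ω := by
    funext ω
    simp only [← ind_mul_ind, pairU]
    ring
  rw [this, E_add, E_add, E_sub, E_const_mul, E_const_mul, E_const_mul]
  simp only [E_ind]

/-- All three summands of `pairU` keep a factor `1 - p ^ e`. In the first one, requiring `S α.1` as
well retains at least the fraction `p ^ e` of the probability, so its absence has at most the
fraction `1 - p ^ e`. -/
theorem E_pairU_mul_ind_le (α : C × C) (B : Finset ι) :
    E p (fun ω => pairU S p e α ω * ind B ω) ≤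
      3 * (1 - p ^ e) * pairWt S p e α * (p ^ #B * p⁻¹ ^ #(B ∩ cov S α)) := by
  rw [E_pairU_mul_ind_eq]
  have hw := h.pairWt_nonneg α
  have hε := h.one_sub_pow_nonneg
  have h1 : p ^ #(S α.2 \ S α.1 ∪ B) - p ^ #(S α.2 \ S α.1 ∪ B ∪ S α.1) ≤
      (1 - p ^ e) * (pairWt S p e α * (p ^ #B * p⁻¹ ^ #(B ∩ cov S α))) := by
    have a1 : p ^ #(S α.2 \ S α.1 ∪ B) * p ^ e ≤ p ^ #(S α.2 \ S α.1 ∪ B ∪ S α.1) := by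
      rw [← pow_add, ← h.card_eq α.1]
      exact pow_le_pow_of_le_one h.p_pos.le h.p_lt_one.le (card_union_le _ _)
    have a2 := h.pow_card_union_le (B := B) (show S α.2 \ S α.1 ⊆ cov S α from
      sdiff_subset.trans subset_union_right)
    rw [h.pow_card_sdiff_eq] at a2
    have := mul_le_mul_of_nonneg_left a2 hε
    linarith
  have h2 : p⁻¹ ^ e * p ^ #(cov S α ∪ B) ≤
      pairWt S p e α * (p ^ #B * p⁻¹ ^ #(B ∩ cov S α)) := by
    have := mul_le_mul_of_nonneg_left (h.pow_card_union_le (B := B) (Subset.refl (cov S α)))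
      (h.inv_pow_pos e).le
    rwa [← mul_assoc, h.pow_card_cov] at this
  have h3 : p ^ #B ≤ p ^ #B * p⁻¹ ^ #(B ∩ cov S α) :=
    le_mul_of_one_le_right (h.pow_nonneg' _) (one_le_pow₀ h.one_le_inv)
  have h2' := mul_le_mul_of_nonneg_left h2 hε
  have h3' := mul_le_mul_of_nonneg_left h3 (mul_nonneg hε hw)
  linarith

theorem E_pairU_le (α : C × C) :
    E p (pairU S p e α) ≤ 3 * (1 - p ^ e) * pairWt S p e α := by
  have := h.E_pairU_mul_ind_le α ∅
  simpa [ind] using this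

theorem E_pairU_mul_ind_subset_le (α : C × C) {B : Finset ι} (hB : B ⊆ cov S α) :
    E p (fun ω => pairU S p e α ω * ind B ω) ≤ 3 * (1 - p ^ e) * pairWt S p e α := by
  have := h.E_pairU_mul_ind_le α B
  rwa [inter_eq_left.2 hB, h.pow_mul_inv_pow, mul_one] at this

/-- The covers may overlap, so only the factor for `α` keeps its `1 - p ^ e`; for `β` it is bounded
by one. -/
theorem E_pairU_mul_pairU_le (α β : C × C) :
    E p (fun ω => pairU S p e α ω * pairU S p e β ω) ≤
      9 * (1 - p ^ e) * pairWt S p e α * pairWt S p e β * p⁻¹ ^ #(cov S α ∩ cov S β) := by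
  have hU := h.pairU_nonneg
  have hw := h.pairWt_nonneg
  have hε := h.one_sub_pow_nonneg
  have hε1 := h.one_sub_pow_le_one
  have hle : ∀ ω, pairU S p e α ω * pairU S p e β ω ≤
      (pairU S p e α ω * ind (S β.2 \ S β.1) ω + p⁻¹ ^ e * (pairU S p e α ω * ind (cov S β) ω)) +
        pairWt S p e β * pairU S p e α ω := fun ω => by
    have b1 : pairU S p e β ω ≤
        ind (S β.2 \ S β.1) ω + p⁻¹ ^ e * ind (cov S β) ω + pairWt S p e β := by
      refine add_le_add (add_le_add ?_ ?_) ?_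
      · exact mul_le_of_le_one_right (ind_nonneg _ _) (by linarith [ind_nonneg (S β.1) ω])
      · exact mul_le_of_le_one_left (mul_nonneg (h.inv_pow_pos _).le (ind_nonneg _ _)) hε1
      · exact mul_le_of_le_one_left (hw β) hε1
    have := mul_le_mul_of_nonneg_left b1 (hU α ω)
    linarith
  have hinv : 0 ≤ p⁻¹ := inv_nonneg.2 h.p_pos.le
  refine (E_mono h.p_pos.le h.p_lt_one.le hle).trans ?_
  rw [E_add, E_add, E_const_mul, E_const_mul]
  have e1 := h.E_pairU_mul_ind_le α (S β.2 \ S β.1)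
  have e2 := h.E_pairU_mul_ind_le α (cov S β)
  have e3 := h.E_pairU_le α
  have c1 : p⁻¹ ^ #(S β.2 \ S β.1 ∩ cov S α) ≤ p⁻¹ ^ #(cov S α ∩ cov S β) := by
    rw [inter_comm (cov S α)]
    exact pow_le_pow_right₀ h.one_le_inv (card_le_card (inter_subset_inter_right
      (sdiff_subset.trans subset_union_right)))
  rw [h.pow_card_sdiff_eq] at e1
  rw [inter_comm (cov S β)] at e2
  have e2' := mul_le_mul_of_nonneg_left e2 (h.inv_pow_pos e).le
  have e2'' : p⁻¹ ^ e * (3 * (1 - p ^ e) * pairWt S p e α *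
      (p ^ #(cov S β) * p⁻¹ ^ #(cov S α ∩ cov S β))) =
      3 * (1 - p ^ e) * pairWt S p e α * pairWt S p e β * p⁻¹ ^ #(cov S α ∩ cov S β) := by
    rw [← h.pow_card_cov β]; ring
  have k : 0 ≤ 3 * (1 - p ^ e) * pairWt S p e α * pairWt S p e β :=
    mul_nonneg (mul_nonneg (mul_nonneg (by norm_num) hε) (hw α)) (hw β)
  have c1' := mul_le_mul_of_nonneg_left c1 k
  have c3' := mul_le_mul_of_nonneg_left
    (one_le_pow₀ h.one_le_inv : 1 ≤ p⁻¹ ^ #(cov S α ∩ cov S β)) k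
  have e3' := mul_le_mul_of_nonneg_left e3 (hw β)
  linarith

/-- `S c` splits into its parts in the two disjoint covers and outside of them. The expectation
factorizes accordingly, and both pairs keep their factor `1 - p ^ e`. -/
theorem E_pairU_mul_pairU_mul_ind_le {α β : C × C} (hd : Disjoint (cov S α) (cov S β)) (c : C) :
    E p (fun ω => pairU S p e α ω * pairU S p e β ω * ind (S c) ω) ≤
      9 * (1 - p ^ e) ^ 2 * pairWt S p e α * pairWt S p e β *
        (p ^ e * p⁻¹ ^ #(S c ∩ cov S α) * p⁻¹ ^ #(S c ∩ cov S β)) := by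
  set A := cov S α
  set B := cov S β
  have hw := h.pairWt_nonneg
  have hε := h.one_sub_pow_nonneg
  have hsplit : S c ∩ A ∪ (S c ∩ B ∪ S c \ (A ∪ B)) = S c := by ext x; simp; tauto
  have hind : ∀ ω, ind (S c) ω = ind (S c ∩ A) ω * (ind (S c ∩ B) ω * ind (S c \ (A ∪ B)) ω) :=
    fun ω => by rw [ind_mul_ind, ind_mul_ind, hsplit]
  have e0 : (fun ω => pairU S p e α ω * pairU S p e β ω * ind (S c) ω) = fun ω =>
      (pairU S p e α ω * ind (S c ∩ A) ω) *
        ((pairU S p e β ω * ind (S c ∩ B) ω) * ind (S c \ (A ∪ B)) ω) := by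
    funext ω; rw [hind]; ring
  have hdi : ∀ {X Y : Finset ι} (ω), Disjoint X Y → (ω \ Y) ∩ X = ω ∩ X := fun ω hXY => by
    ext x; simp only [mem_inter, mem_sdiff]
    exact ⟨fun hx => ⟨hx.1.1, hx.2⟩, fun hx => ⟨⟨hx.1, disjoint_left.1 hXY hx.2⟩, hx.2⟩⟩
  have e1 : E p (fun ω => (pairU S p e α ω * ind (S c ∩ A) ω) *
      ((pairU S p e β ω * ind (S c ∩ B) ω) * ind (S c \ (A ∪ B)) ω)) =
      E p (fun ω => pairU S p e α ω * ind (S c ∩ A) ω) *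
      E p (fun ω => (pairU S p e β ω * ind (S c ∩ B) ω) * ind (S c \ (A ∪ B)) ω) := by
    refine E_mul_of_indep p A (fun ω => ?_) fun ω => ?_
    · rw [ind_inter_of_subset inter_subset_right, pairU_inter]
    · rw [ind_sdiff_of_disjoint (hd.symm.mono_left inter_subset_right),
        ind_sdiff_of_disjoint (sdiff_disjoint.mono_right subset_union_left),
        ← pairU_inter β (ω \ A), hdi ω hd.symm, pairU_inter]
  have e2 : E p (fun ω => (pairU S p e β ω * ind (S c ∩ B) ω) * ind (S c \ (A ∪ B)) ω) =
      E p (fun ω => pairU S p e β ω * ind (S c ∩ B) ω) * E p (ind (S c \ (A ∪ B))) := by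
    refine E_mul_of_indep p B (fun ω => ?_) fun ω => ?_
    · rw [ind_inter_of_subset inter_subset_right, pairU_inter]
    · rw [ind_sdiff_of_disjoint (sdiff_disjoint.mono_right subset_union_right)]
  have hcard : p ^ #(S c \ (A ∪ B)) = p ^ e * p⁻¹ ^ #(S c ∩ A) * p⁻¹ ^ #(S c ∩ B) := by
    rw [pow_card_sdiff h.p_pos, h.card_eq, inter_union_distrib_left, card_union_of_disjoint
      (hd.mono inter_subset_right inter_subset_right), pow_add, mul_assoc]
  rw [e0, e1, e2, E_ind, hcard]
  have e3 := h.E_pairU_mul_ind_subset_le α (B := S c ∩ A) inter_subset_right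
  have e4 := h.E_pairU_mul_ind_subset_le β (B := S c ∩ B) inter_subset_right
  have k : 0 ≤ p ^ e * p⁻¹ ^ #(S c ∩ A) * p⁻¹ ^ #(S c ∩ B) :=
    mul_nonneg (mul_nonneg (h.pow_nonneg' _) (h.inv_pow_pos _).le) (h.inv_pow_pos _).le
  have k2 : 0 ≤ E p (fun ω => pairU S p e β ω * ind (S c ∩ B) ω) :=
    E_nonneg h.p_pos.le h.p_lt_one.le fun ω => mul_nonneg (h.pairU_nonneg _ _) (ind_nonneg _ _)
  have e34 := mul_le_mul e3 e4 k2
    (mul_nonneg (mul_nonneg (by norm_num) hε) (hw α))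
  have := mul_le_mul_of_nonneg_right e34 k
  linarith

end IsRegular

end RandomSubset

end

/-! ### Exponential tilting and decoupling -/

noncomputable section

namespace RandomSubset

open Finset

variable {ι C : Type*} [DecidableEq ι] [Fintype C]

/-- The exponential of a multiple of the number of members of the family inside `ω`. -/
def expNum (S : C → Finset ι) (l : ℝ) (ω : Finset ι) : ℝ := Real.exp (l * num S ω)

/-- A family of centred random variables indexed by pairs, with `Y α` a function of `ω ∩ cov S α`
that is dominated by `pairU S p e α`. -/
structure IsCentredPairFamily [Fintype ι] (S : C → Finset ι) (p : ℝ) (e : ℕ)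
    (Y : C × C → Finset ι → ℝ) : Prop where
  abs_le : ∀ α ω, |Y α ω| ≤ pairU S p e α ω
  mean_eq : ∀ α, E p (Y α) = 0
  inter : ∀ α ω, Y α (ω ∩ cov S α) = Y α ω

theorem expNum_pos (S : C → Finset ι) (l : ℝ) (ω : Finset ι) : 0 < expNum S l ω := Real.exp_pos _

theorem num_mono (S : C → Finset ι) {ω ω' : Finset ι} (hω : ω ⊆ ω') : num S ω ≤ num S ω' := by
  refine sum_le_sum fun c _ => ?_
  unfold ind
  split_ifs with h1 h2
  · exact le_rfl
  · exact absurd (h1.trans hω) h2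
  · exact zero_le_one
  · exact le_rfl

theorem num_le_num_sdiff_add (S : C → Finset ι) (A ω : Finset ι) :
    num S ω ≤ num S (ω \ A) + ∑ c ∈ hits S A, ind (S c) ω := by
  rw [num, num, ← sum_filter_add_sum_filter_not univ (fun c => ¬ Disjoint (S c) A),
    add_comm]
  refine add_le_add ?_ le_rfl
  refine (sum_congr rfl fun c hc => ?_).trans_le
    (sum_le_sum_of_subset_of_nonneg (filter_subset _ _) fun c _ _ => ind_nonneg _ _)
  rw [ind_sdiff_of_disjoint (not_not.1 (mem_filter.1 hc).2)]

theorem num_le_num_sdiff_add_card (S : C → Finset ι) (A ω : Finset ι) :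
    num S ω ≤ num S (ω \ A) + #(hits S A) := by
  refine (num_le_num_sdiff_add S A ω).trans (add_le_add le_rfl ?_)
  rw [card_eq_sum_ones, Nat.cast_sum, Nat.cast_one]
  exact sum_le_sum fun c _ => ind_le_one _ _

theorem expNum_sdiff_le (S : C → Finset ι) {l : ℝ} (hl : 0 ≤ l) (A ω : Finset ι) :
    expNum S l (ω \ A) ≤ expNum S l ω :=
  Real.exp_le_exp.2 (mul_le_mul_of_nonneg_left (num_mono S sdiff_subset) hl)

/-- This is `1 - exp (-x) ≤ x`, where `x` is at most `l` times the number of members inside `ω` that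
meet `A`. -/
theorem expNum_sub_le (S : C → Finset ι) {l : ℝ} (hl : 0 ≤ l) (A ω : Finset ι) :
    expNum S l ω - expNum S l (ω \ A) ≤ l * (∑ c ∈ hits S A, ind (S c) ω) * expNum S l ω := by
  have h1 := mul_le_mul_of_nonneg_left (num_le_num_sdiff_add S A ω) hl
  have h2 := Real.add_one_le_exp (l * num S (ω \ A) - l * num S ω)
  rw [Real.exp_sub, le_div_iff₀ (Real.exp_pos _)] at h2
  have h3 : 0 ≤ (l * num S (ω \ A) + l * (∑ c ∈ hits S A, ind (S c) ω) - l * num S ω) *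
      Real.exp (l * num S ω) := mul_nonneg (by linarith) (Real.exp_pos _).le
  unfold expNum
  linarith

variable [Fintype ι]

/-- Decoupling: exponential tilting changes the expectation of a function of `ω ∩ A` only by a
bounded factor. -/
theorem E_mul_mul_expNum_le (S : C → Finset ι) {p l k : ℝ} (hp0 : 0 ≤ p) (hp1 : p ≤ 1)
    (hl : 0 ≤ l) {A : Finset ι} (hk : (#(hits S A) : ℝ) ≤ k) {Y G : Finset ι → ℝ}
    (hY : ∀ ω, 0 ≤ Y ω) (hG : ∀ ω, 0 ≤ G ω) (hYA : ∀ ω, Y (ω ∩ A) = Y ω)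
    (hGA : ∀ ω, G (ω \ A) = G ω) :
    E p (fun ω => Y ω * (G ω * expNum S l ω)) ≤
      Real.exp (l * k) * E p Y * E p (fun ω => G ω * expNum S l ω) := by
  -- Deleting `A` from the exponent loses at most `k` members, and what remains is independent of `ω
  -- ∩ A`.
  have h1 : ∀ ω, expNum S l ω ≤ Real.exp (l * k) * expNum S l (ω \ A) := fun ω => by
    rw [expNum, expNum, ← Real.exp_add, ← mul_add]
    refine Real.exp_le_exp.2 (mul_le_mul_of_nonneg_left ?_ hl)
    linarith [num_le_num_sdiff_add_card S A ω]
  have h2 : E p (fun ω => Y ω * (G ω * expNum S l ω)) ≤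
      E p (fun ω => Real.exp (l * k) * (Y ω * (G ω * expNum S l (ω \ A)))) :=
    E_mono hp0 hp1 fun ω => by
      have := mul_le_mul_of_nonneg_left (h1 ω) (mul_nonneg (hY ω) (hG ω))
      linarith
  refine h2.trans ?_
  rw [E_const_mul, E_mul_of_indep p A hYA (G := fun ω => G ω * expNum S l (ω \ A))
    (fun ω => by simp [hGA]), mul_assoc]
  refine mul_le_mul_of_nonneg_left (mul_le_mul_of_nonneg_left ?_ (E_nonneg hp0 hp1 hY))
    (Real.exp_pos _).le
  exact E_mono hp0 hp1 fun ω =>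
    mul_le_mul_of_nonneg_left (expNum_sdiff_le S hl A ω) (hG ω)

theorem E_mul_expNum_le (S : C → Finset ι) {p l k : ℝ} (hp0 : 0 ≤ p) (hp1 : p ≤ 1)
    (hl : 0 ≤ l) {A : Finset ι} (hk : (#(hits S A) : ℝ) ≤ k) {Y : Finset ι → ℝ}
    (hY : ∀ ω, 0 ≤ Y ω) (hYA : ∀ ω, Y (ω ∩ A) = Y ω) :
    E p (fun ω => Y ω * expNum S l ω) ≤ Real.exp (l * k) * E p Y * E p (expNum S l) := by
  have := E_mul_mul_expNum_le S hp0 hp1 hl hk hY (G := fun _ => 1) (fun _ => zero_le_one) hYA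
    fun _ => rfl
  simpa using this

namespace IsRegular

variable {S : C → Finset ι} {p D R κ : ℝ} {e : ℕ} (h : IsRegular S p e D R κ)

theorem _root_.RandomSubset.apply_inter_of_subset {X : Finset ι → ℝ} {A B : Finset ι}
    (hX : ∀ ω, X (ω ∩ A) = X ω) (hAB : A ⊆ B) (ω : Finset ι) : X (ω ∩ B) = X ω := by
  rw [← hX (ω ∩ B), ← hX ω, inter_assoc, inter_eq_right.2 hAB]

theorem _root_.RandomSubset.apply_sdiff_of_disjoint {X : Finset ι → ℝ} {A B : Finset ι}
    (hX : ∀ ω, X (ω ∩ A) = X ω) (hAB : Disjoint A B) (ω : Finset ι) : X (ω \ B) = X ω := by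
  rw [← hX (ω \ B), ← hX ω]
  congr 1
  ext x
  simp only [mem_inter, mem_sdiff]
  exact ⟨fun hx => ⟨hx.1.1, hx.2⟩, fun hx => ⟨⟨hx.1, disjoint_left.1 hAB hx.2⟩, hx.2⟩⟩

variable {Y : C × C → Finset ι → ℝ} (hY : IsCentredPairFamily S p e Y) {l : ℝ} (hl : 0 ≤ l)
include h hY hl

/-- Linked pairs are bounded termwise. The sum over the other pairs, times the exponential with `cov
S α` deleted, is independent of the centred `Y α` and contributes nothing. There remains the
difference of the two exponentials, which is of first order in `l`. -/
theorem E_pair_mul_sum_le (α : C × C) :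
    E p (fun ω => Y α ω * (∑ β ∈ pairs S, Y β ω) * expNum S l ω) ≤
      ∑ β ∈ linked S (cov S α), E p (fun ω => pairU S p e α ω * pairU S p e β ω * expNum S l ω) +
      l * ∑ c ∈ hits S (cov S α), E p (fun ω => pairU S p e α ω * ind (S c) ω *
        (|∑ β ∈ (pairs S).filter (fun β => Disjoint (cov S β) (cov S α)), Y β ω| *
          expNum S l ω)) := by
  have hp0 := h.p_pos.le
  have hp1 := h.p_lt_one.le
  set A := cov S α with hA
  set Fu : Finset ι → ℝ := fun ω => ∑ β ∈ (pairs S).filter (fun β => Disjoint (cov S β) A), Y β ω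
    with hFu
  have hFA : ∀ ω, Fu (ω \ A) = Fu ω := fun ω => sum_congr rfl fun β hβ =>
    apply_sdiff_of_disjoint (hY.inter β) (mem_filter.1 hβ).2 ω
  have hzero : E p (fun ω => Y α ω * (Fu ω * expNum S l (ω \ A))) = 0 := by
    rw [E_mul_of_indep p A (hY.inter α) (G := fun ω => Fu ω * expNum S l (ω \ A))
      (fun ω => by simp [hFA]), hY.mean_eq, zero_mul]
  have hsplit : ∀ ω, ∑ β ∈ pairs S, Y β ω = ∑ β ∈ linked S A, Y β ω + Fu ω := fun ω => by
    rw [linked, hFu, ← sum_filter_add_sum_filter_not (pairs S) (fun β => ¬ Disjoint (cov S β) A)]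
    simp only [not_not]
  have hpt : ∀ ω, Y α ω * (∑ β ∈ pairs S, Y β ω) * expNum S l ω -
      Y α ω * (Fu ω * expNum S l (ω \ A)) ≤
      ∑ β ∈ linked S A, pairU S p e α ω * pairU S p e β ω * expNum S l ω +
      l * ∑ c ∈ hits S A, pairU S p e α ω * ind (S c) ω * (|Fu ω| * expNum S l ω) := fun ω => by
    have hU := h.pairU_nonneg α ω
    have e1 : Y α ω * (∑ β ∈ linked S A, Y β ω) * expNum S l ω ≤
        ∑ β ∈ linked S A, pairU S p e α ω * pairU S p e β ω * expNum S l ω := by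
      rw [mul_sum, sum_mul]
      refine sum_le_sum fun β _ => mul_le_mul_of_nonneg_right ?_ (expNum_pos _ _ _).le
      refine (le_abs_self _).trans ?_
      rw [abs_mul]
      exact mul_le_mul (hY.abs_le _ _) (hY.abs_le _ _) (abs_nonneg _) hU
    have e2 : Y α ω * Fu ω * (expNum S l ω - expNum S l (ω \ A)) ≤
        l * ∑ c ∈ hits S A, pairU S p e α ω * ind (S c) ω * (|Fu ω| * expNum S l ω) := by
      have d0 : 0 ≤ expNum S l ω - expNum S l (ω \ A) := sub_nonneg.2 (expNum_sdiff_le S hl A ω)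
      have d1 : Y α ω * Fu ω ≤ pairU S p e α ω * |Fu ω| := by
        refine (le_abs_self _).trans ?_
        rw [abs_mul]
        exact mul_le_mul_of_nonneg_right (hY.abs_le _ _) (abs_nonneg _)
      refine (mul_le_mul d1 (expNum_sub_le S hl A ω) d0
        (mul_nonneg hU (abs_nonneg _))).trans_eq ?_
      simp only [mul_sum, sum_mul]
      exact sum_congr rfl fun c _ => by ring
    rw [hsplit ω]
    linarith
  have := E_mono hp0 hp1 hpt
  rw [E_sub, hzero, sub_zero, E_add, E_const_mul, E_sum, E_sum] at this
  exact this

/-- Pairs that touch `S c` are first split off into the last sum. The others do not depend on `cov S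
α ∪ S c`, so the local factor can be decoupled from them; at most `3 * D` members meet this set.
Completing them to the full sum costs `linked` terms and makes its first absolute moment reappear.
-/
theorem E_pairU_mul_ind_mul_abs_le (α : C × C) (c : C) :
    E p (fun ω => pairU S p e α ω * ind (S c) ω *
        (|∑ β ∈ (pairs S).filter (fun β => Disjoint (cov S β) (cov S α)), Y β ω| *
          expNum S l ω)) ≤
      Real.exp (l * (3 * D)) * E p (fun ω => pairU S p e α ω * ind (S c) ω) *
        (E p (fun ω => |∑ β ∈ pairs S, Y β ω| * expNum S l ω) +
          ∑ β ∈ linked S (cov S α ∪ S c), E p (fun ω => pairU S p e β ω * expNum S l ω)) +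
      ∑ β ∈ (linked S (S c)).filter (fun β => Disjoint (cov S β) (cov S α)),
        E p (fun ω => pairU S p e α ω * pairU S p e β ω * ind (S c) ω * expNum S l ω) := by
  have hp0 := h.p_pos.le
  have hp1 := h.p_lt_one.le
  set A := cov S α with hA
  set F3 : Finset ι → ℝ := fun ω =>
    ∑ β ∈ (pairs S).filter (fun β => Disjoint (cov S β) (A ∪ S c)), Y β ω with hF3
  have hFA : ∀ ω, F3 (ω \ (A ∪ S c)) = F3 ω := fun ω => sum_congr rfl fun β hβ =>
    apply_sdiff_of_disjoint (hY.inter β) (mem_filter.1 hβ).2 ω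
  have hYU : ∀ (s : Finset (C × C)) ω, |∑ β ∈ s, Y β ω| ≤ ∑ β ∈ s, pairU S p e β ω := fun s ω =>
    (abs_sum_le_sum_abs _ _).trans (sum_le_sum fun β _ => hY.abs_le β ω)
  have h1 : ∀ ω, |∑ β ∈ (pairs S).filter (fun β => Disjoint (cov S β) A), Y β ω| ≤
      |F3 ω| + ∑ β ∈ (linked S (S c)).filter (fun β => Disjoint (cov S β) A),
        pairU S p e β ω := fun ω => by
    have e1 : ∑ β ∈ (pairs S).filter (fun β => Disjoint (cov S β) A), Y β ω =
        F3 ω + ∑ β ∈ (linked S (S c)).filter (fun β => Disjoint (cov S β) A), Y β ω := by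
      rw [← sum_filter_add_sum_filter_not _ (fun β => Disjoint (cov S β) (S c)), hF3,
        linked, filter_filter, filter_filter, filter_filter]
      simp only [disjoint_union_right, and_comm]
    rw [e1]
    exact (abs_add_le _ _).trans (add_le_add le_rfl (hYU _ ω))
  have h2 : ∀ ω, |F3 ω| ≤ |∑ β ∈ pairs S, Y β ω| +
      ∑ β ∈ linked S (A ∪ S c), pairU S p e β ω := fun ω => by
    have e1 : ∑ β ∈ pairs S, Y β ω = F3 ω + ∑ β ∈ linked S (A ∪ S c), Y β ω := by
      rw [linked, hF3, ← sum_filter_add_sum_filter_not (pairs S)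
        (fun β => Disjoint (cov S β) (A ∪ S c))]
    rw [eq_sub_of_add_eq e1.symm]
    exact (abs_sub _ _).trans (add_le_add le_rfl (hYU _ ω))
  have hk : (#(hits S (A ∪ S c)) : ℝ) ≤ 3 * D := by
    have := card_hits_union_le S A (S c)
    have := h.card_hits_cov_le α
    have := h.hits_le c
    linarith
  have hU0 : ∀ ω, 0 ≤ pairU S p e α ω * ind (S c) ω := fun ω =>
    mul_nonneg (h.pairU_nonneg _ _) (ind_nonneg _ _)
  have h3 := E_mul_mul_expNum_le S hp0 hp1 hl hk (Y := fun ω => pairU S p e α ω * ind (S c) ω)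
    (G := fun ω => |F3 ω|) hU0 (fun ω => abs_nonneg _)
    (fun ω => by
      rw [apply_inter_of_subset (pairU_inter α) subset_union_left,
        ind_inter_of_subset subset_union_right]) (fun ω => by rw [hFA])
  have h4 : E p (fun ω => |F3 ω| * expNum S l ω) ≤
      E p (fun ω => |∑ β ∈ pairs S, Y β ω| * expNum S l ω) +
        ∑ β ∈ linked S (A ∪ S c), E p (fun ω => pairU S p e β ω * expNum S l ω) := by
    rw [← E_sum, ← E_add]
    refine E_mono hp0 hp1 fun ω => ?_
    rw [← sum_mul, ← add_mul]
    exact mul_le_mul_of_nonneg_right (h2 ω) (expNum_pos _ _ _).le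
  have h5 := mul_le_mul_of_nonneg_left h4 (mul_nonneg (Real.exp_pos (l * (3 * D))).le
    (E_nonneg hp0 hp1 hU0))
  refine le_trans ?_ (add_le_add (h3.trans h5) le_rfl)
  rw [← E_sum, ← E_add]
  refine E_mono hp0 hp1 fun ω => ?_
  have h6 := mul_le_mul_of_nonneg_right (mul_le_mul_of_nonneg_left (h1 ω) (hU0 ω))
    (expNum_pos S l ω).le
  rw [mul_add, add_mul, mul_sum, sum_mul] at h6
  rw [← mul_assoc, ← mul_assoc]
  refine h6.trans_eq (congrArg₂ (· + ·) rfl (sum_congr rfl fun β _ => by ring))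

end IsRegular

end RandomSubset

end

/-! ### From the tilted second moment to the first absolute moment -/

noncomputable section

namespace RandomSubset

open Finset

variable {ι C : Type*} [DecidableEq ι] [Fintype C] [Fintype ι]

/-- A larger `y` would make `y * (y - 3 * a * θ)` too large, as comparison of the coefficients of
the powers of `θ` shows. The constant `29 / 4` is not sharp. -/
theorem le_of_sq_le_quadratic {y a θ : ℝ} (ha : 0 ≤ a) (hθ : 0 ≤ θ)
    (h : y ^ 2 ≤ 18 * a ^ 2 * (1 + 2 * θ) + 3 * a * θ * y) : y ≤ 29 / 4 * a * (1 + θ) := by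
  by_contra! hy
  have h1 : 0 ≤ 29 / 4 * a * (1 + θ) := by positivity
  have h2 : 29 / 4 * a * (1 + θ) * (29 / 4 * a + 17 / 4 * a * θ) ≤ y * (y - 3 * a * θ) := by
    have : 29 / 4 * a + 17 / 4 * a * θ ≤ y - 3 * a * θ := by linarith
    exact mul_le_mul hy.le this (by positivity) (by linarith)
  have h3 : 0 ≤ a ^ 2 * θ := by positivity
  have h4 : 0 ≤ a ^ 2 * θ ^ 2 := by positivity
  have h5 : a ^ 2 ≤ 0 := by nlinarith
  have h6 : a = 0 := by nlinarith
  subst h6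
  simp only [mul_zero, zero_mul] at *
  nlinarith

/-- In dimensionless form: `y` is the normalized first moment, `v ≤ 1` and `u ≤ δ` by the variance
bound, and `r = ε / q ≤ d`. Cauchy–Schwarz then gives a quadratic inequality for `y` with `a = d * κ
* δ * g ^ 3` and `θ = l * s`. The powers `g ^ 4` and `g ^ 5` are rounded up to `g ^ 6`, to be
absorbed in `a ^ 2`. -/
theorem first_moment_le_of_second_moment_le {q P M R κ ε d g l s X X2 m δ : ℝ} (hq : 0 < q)
    (hq1 : q ≤ 1) (hM : 0 < M) (hR : 1 ≤ R) (hκ : 1 ≤ κ) (hP : 0 < P) (hd : 1 ≤ d) (hε0 : 0 ≤ ε)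
    (hεle : ε ≤ d * q) (hg : 1 ≤ g) (hl : 0 ≤ l) (hs : 0 < s)
    (hvar : q * P ^ 2 * M * R ≤ s ^ 2) (hδ0 : 0 ≤ δ) (hδ1 : δ ≤ 1) (hδ2 : δ ^ 2 * (q * M) = R)
    (hX0 : 0 ≤ X) (hm0 : 0 < m) (hCS : X ^ 2 ≤ X2 * m)
    (hX2 : X2 ≤ g ^ 4 * (18 * ε * κ ^ 2 * P ^ 2 * M * R ^ 3) * m +
      l * (g ^ 3 * (3 * ε * κ * P ^ 2 * M * R ^ 2) *
          (X + g ^ 2 * (6 * ε * κ * P * R ^ 2) * m) +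
        g ^ 5 * (18 * ε ^ 2 * κ ^ 2 * P ^ 3 * M * R ^ 4) * m)) :
    P / s ^ 2 * X ≤ 29 / 4 * (d * κ * δ * g ^ 3) * (1 + l * s) * m := by
  obtain ⟨u, hu⟩ : ∃ u, u = P * R / s := ⟨_, rfl⟩
  obtain ⟨v, hv⟩ : ∃ v, v = q * P ^ 2 * M * R / s ^ 2 := ⟨_, rfl⟩
  obtain ⟨r, hr⟩ : ∃ r, r = ε / q := ⟨_, rfl⟩
  obtain ⟨y, hy⟩ : ∃ y, y = P / s ^ 2 * X / m := ⟨_, rfl⟩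
  obtain ⟨a, ha⟩ : ∃ a, a = d * κ * δ * g ^ 3 := ⟨_, rfl⟩
  have hu0 : 0 ≤ u := by rw [hu]; positivity
  have hv0 : 0 ≤ v := by rw [hv]; positivity
  have hr0 : 0 ≤ r := by rw [hr]; positivity
  have hy0 : 0 ≤ y := by rw [hy]; positivity
  have ha0 : 0 ≤ a := by rw [ha]; positivity
  have hv1 : v ≤ 1 := by rw [hv]; exact (div_le_one (by positivity)).2 hvar
  have hrd : r ≤ d := by rw [hr]; exact (div_le_iff₀ hq).2 hεle
  have huδ : u ≤ δ := by
    refine le_of_sq_le_sq ?_ hδ0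
    have e1 : u ^ 2 = v * δ ^ 2 := by
      rw [hu, hv, ← hδ2]; field_simp
    rw [e1]
    exact mul_le_of_le_one_left (sq_nonneg _) hv1
  have hls : 0 ≤ l * s := by positivity
  have h1 : y ^ 2 ≤ g ^ 4 * 18 * κ ^ 2 * r * v * u ^ 2 +
      (l * s) * (g ^ 3 * 3 * κ * r * v * u * y) +
      (l * s) * (36 * g ^ 5 * κ ^ 2 * r ^ 2 * q * v * u ^ 3) := by
    have h2 := mul_le_mul_of_nonneg_left (hCS.trans (mul_le_mul_of_nonneg_right hX2 hm0.le))
      (by positivity : 0 ≤ (P / s ^ 2) ^ 2 / m ^ 2)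
    refine le_trans (le_of_eq ?_) (h2.trans_eq ?_)
    · rw [hy]; field_simp
    · rw [hy, hv, hu, hr]; field_simp; ring
  have hu3 : u ^ 3 ≤ δ ^ 2 := by
    calc u ^ 3 ≤ δ ^ 3 := by gcongr
      _ = δ ^ 2 * δ := by ring
      _ ≤ δ ^ 2 * 1 := by gcongr
      _ = δ ^ 2 := mul_one _
  have hg4 : g ^ 4 ≤ g ^ 6 := pow_le_pow_right₀ hg (by norm_num)
  have hg5 : g ^ 5 ≤ g ^ 6 := pow_le_pow_right₀ hg (by norm_num)
  have hrd2 : r ≤ d ^ 2 := hrd.trans (le_self_pow₀ hd (by norm_num))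
  have t1 : g ^ 4 * 18 * κ ^ 2 * r * v * u ^ 2 ≤ 18 * a ^ 2 := by
    calc g ^ 4 * 18 * κ ^ 2 * r * v * u ^ 2
        ≤ g ^ 6 * 18 * κ ^ 2 * d ^ 2 * 1 * δ ^ 2 := by gcongr
      _ = 18 * a ^ 2 := by rw [ha]; ring
  have t2 : g ^ 3 * 3 * κ * r * v * u * y ≤ 3 * a * y := by
    calc g ^ 3 * 3 * κ * r * v * u * y
        ≤ g ^ 3 * 3 * κ * d * 1 * δ * y := by gcongr
      _ = 3 * a * y := by rw [ha]; ring
  have t3 : 36 * g ^ 5 * κ ^ 2 * r ^ 2 * q * v * u ^ 3 ≤ 36 * a ^ 2 := by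
    calc 36 * g ^ 5 * κ ^ 2 * r ^ 2 * q * v * u ^ 3
        ≤ 36 * g ^ 6 * κ ^ 2 * d ^ 2 * 1 * 1 * δ ^ 2 := by gcongr
      _ = 36 * a ^ 2 := by rw [ha]; ring
  have t2' := mul_le_mul_of_nonneg_left t2 hls
  have t3' := mul_le_mul_of_nonneg_left t3 hls
  have := le_of_sq_le_quadratic ha0 hls (by linarith : y ^ 2 ≤ 18 * a ^ 2 * (1 + 2 * (l * s)) +
    3 * a * (l * s) * y)
  rw [hy, div_le_iff₀ hm0] at this
  rw [ha] at this
  linarith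

namespace IsRegular

variable {S : C → Finset ι} {p D R κ : ℝ} {e : ℕ} (h : IsRegular S p e D R κ)
  {l : ℝ} (hl : 0 ≤ l)
include h hl

theorem E_expNum_pos : 0 < E p (expNum S l) := by
  refine lt_of_lt_of_le zero_lt_one ?_
  rw [← E_const (ι := ι) p 1]
  exact E_mono h.p_pos.le h.p_lt_one.le fun ω =>
    Real.one_le_exp (mul_nonneg hl (sum_nonneg fun c _ => ind_nonneg _ _))

variable [Nonempty C]

/-- Decoupling costs `exp (l * (2 * D))` because the cover of a pair meets at most `2 * D` members.
The sums below pay `4 * D` for two pairs and `5 * D` for two pairs with a further member. -/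
theorem sum_E_pairU_le {A : Finset ι} (hA : wt S p A ≤ κ * R) :
    ∑ β ∈ linked S A, E p (fun ω => pairU S p e β ω * expNum S l ω) ≤
      Real.exp (l * (2 * D)) * (6 * (1 - p ^ e) * κ * p ^ e * R ^ 2) * E p (expNum S l) := by
  have hm := h.E_expNum_pos hl
  have h1 : ∀ β ∈ linked S A, E p (fun ω => pairU S p e β ω * expNum S l ω) ≤
      Real.exp (l * (2 * D)) * E p (expNum S l) * (3 * (1 - p ^ e) * p ^ e) *
        p⁻¹ ^ #(S β.1 ∩ S β.2) := fun β _ => by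
    have a1 := E_mul_expNum_le S h.p_pos.le h.p_lt_one.le hl (h.card_hits_cov_le β)
      (h.pairU_nonneg β) (pairU_inter (p := p) (e := e) β)
    have a2 := mul_le_mul_of_nonneg_left (h.E_pairU_le β)
      (mul_pos (Real.exp_pos (l * (2 * D))) hm).le
    rw [pairWt] at a2
    linarith
  refine (sum_le_sum h1).trans ?_
  rw [← mul_sum]
  refine (mul_le_mul_of_nonneg_left (h.sum_linked_inv_pow_le hA) (mul_nonneg
    (mul_pos (Real.exp_pos _) hm).le (mul_nonneg (mul_nonneg (by norm_num) h.one_sub_pow_nonneg)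
      (h.pow_nonneg' _)))).trans_eq (by ring)

theorem sum_E_pairU_mul_pairU_le :
    ∑ α ∈ pairs S, ∑ β ∈ linked S (cov S α),
      E p (fun ω => pairU S p e α ω * pairU S p e β ω * expNum S l ω) ≤
      Real.exp (l * (4 * D)) *
        (18 * (1 - p ^ e) * κ ^ 2 * (p ^ e) ^ 2 * Fintype.card C * R ^ 3) * E p (expNum S l) := by
  have hm := h.E_expNum_pos hl
  set K := Real.exp (l * (4 * D)) * E p (expNum S l) * (9 * (1 - p ^ e) * (p ^ e) ^ 2) with hK
  have hK0 : 0 ≤ K := mul_nonneg (mul_pos (Real.exp_pos _) hm).le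
    (mul_nonneg (mul_nonneg (by norm_num) h.one_sub_pow_nonneg) (sq_nonneg _))
  have h1 : ∀ α β : C × C, E p (fun ω => pairU S p e α ω * pairU S p e β ω * expNum S l ω) ≤
      K * p⁻¹ ^ #(S α.1 ∩ S α.2) *
        (p⁻¹ ^ #(S β.1 ∩ S β.2) * p⁻¹ ^ #(cov S α ∩ cov S β)) := fun α β => by
    have hk : (#(hits S (cov S α ∪ cov S β)) : ℝ) ≤ 4 * D := by
      have := card_hits_union_le S (cov S α) (cov S β)
      linarith [h.card_hits_cov_le α, h.card_hits_cov_le β]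
    have a1 := E_mul_expNum_le S h.p_pos.le h.p_lt_one.le hl hk
      (Y := fun ω => pairU S p e α ω * pairU S p e β ω)
      (fun ω => mul_nonneg (h.pairU_nonneg _ _) (h.pairU_nonneg _ _))
      (fun ω => by
        rw [apply_inter_of_subset (pairU_inter α) subset_union_left,
          apply_inter_of_subset (pairU_inter β) subset_union_right])
    have a2 := mul_le_mul_of_nonneg_left (h.E_pairU_mul_pairU_le α β)
      (mul_pos (Real.exp_pos (l * (4 * D))) hm).le
    rw [pairWt, pairWt] at a2
    rw [hK]
    linarith
  have h2 : ∀ α ∈ pairs S, ∑ β ∈ linked S (cov S α),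
      E p (fun ω => pairU S p e α ω * pairU S p e β ω * expNum S l ω) ≤
      K * (2 * (κ * R) * (κ * R)) * p⁻¹ ^ #(S α.1 ∩ S α.2) := fun α _ => by
    refine (sum_le_sum fun β _ => h1 α β).trans ?_
    rw [← mul_sum]
    have hκ : 0 ≤ κ * R := mul_nonneg (zero_le_one.trans h.one_le_kappa) h.R_nonneg
    have b1 := (h.sum_linked_le (h.wt_cov_union_le α)).trans
      (mul_le_mul_of_nonneg_right (mul_le_mul_of_nonneg_left (h.wt_cov_le α) zero_le_two) hκ)
    have := mul_le_mul_of_nonneg_left b1 (mul_nonneg hK0 (h.inv_pow_pos #(S α.1 ∩ S α.2)).le)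
    linarith
  refine (sum_le_sum h2).trans_eq ?_
  rw [← mul_sum, h.sum_pairs_inv_pow, hK]
  ring

theorem sum_E_pairU_mul_ind_le :
    ∑ α ∈ pairs S, ∑ c ∈ hits S (cov S α), E p (fun ω => pairU S p e α ω * ind (S c) ω) ≤
      3 * (1 - p ^ e) * κ * (p ^ e) ^ 2 * Fintype.card C * R ^ 2 := by
  have h2 : ∀ α ∈ pairs S, ∑ c ∈ hits S (cov S α),
      E p (fun ω => pairU S p e α ω * ind (S c) ω) ≤
      3 * (1 - p ^ e) * (p ^ e) ^ 2 * (κ * R) * p⁻¹ ^ #(S α.1 ∩ S α.2) := fun α _ => by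
    refine (sum_le_sum fun c _ => h.E_pairU_mul_ind_le α (S c)).trans ?_
    rw [← mul_sum, pairWt]
    simp only [h.card_eq]
    rw [← mul_sum]
    have b := mul_le_mul_of_nonneg_left (h.wt_cov_le α) (mul_nonneg (mul_nonneg
      (mul_nonneg zero_le_three h.one_sub_pow_nonneg) (sq_nonneg (p ^ e)))
      (h.inv_pow_pos #(S α.1 ∩ S α.2)).le)
    rw [wt] at b
    linarith
  refine (sum_le_sum h2).trans_eq ?_
  rw [← mul_sum, h.sum_pairs_inv_pow]
  ring

/-- Summing from the inside out, `β` contributes `2 * R * (κ * R)`, then `c` contributes `κ * R`,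
and the pairs `α` contribute `Fintype.card C * R`. -/
theorem sum_E_pairU_mul_pairU_mul_ind_le :
    ∑ α ∈ pairs S, ∑ c ∈ hits S (cov S α),
      ∑ β ∈ (linked S (S c)).filter (fun β => Disjoint (cov S β) (cov S α)),
        E p (fun ω => pairU S p e α ω * pairU S p e β ω * ind (S c) ω * expNum S l ω) ≤
      Real.exp (l * (5 * D)) *
        (18 * (1 - p ^ e) ^ 2 * κ ^ 2 * (p ^ e) ^ 3 * Fintype.card C * R ^ 4) *
        E p (expNum S l) := by
  have hm := h.E_expNum_pos hl
  set K := Real.exp (l * (5 * D)) * E p (expNum S l) * (9 * (1 - p ^ e) ^ 2 * (p ^ e) ^ 3) with hK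
  have hK0 : 0 ≤ K := mul_nonneg (mul_pos (Real.exp_pos _) hm).le
    (mul_nonneg (mul_nonneg (by norm_num) (sq_nonneg _)) (pow_nonneg (h.pow_nonneg' _) _))
  have hκ : 0 ≤ κ * R := mul_nonneg (zero_le_one.trans h.one_le_kappa) h.R_nonneg
  have h1 : ∀ (α : C × C) (c : C) (β : C × C), Disjoint (cov S β) (cov S α) →
      E p (fun ω => pairU S p e α ω * pairU S p e β ω * ind (S c) ω * expNum S l ω) ≤
      K * p⁻¹ ^ #(S α.1 ∩ S α.2) * p⁻¹ ^ #(S c ∩ cov S α) *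
        (p⁻¹ ^ #(S β.1 ∩ S β.2) * p⁻¹ ^ #(S c ∩ cov S β)) := fun α c β hd => by
    have hk : (#(hits S (cov S α ∪ cov S β ∪ S c)) : ℝ) ≤ 5 * D := by
      have := card_hits_union_le S (cov S α ∪ cov S β) (S c)
      have := card_hits_union_le S (cov S α) (cov S β)
      linarith [h.card_hits_cov_le α, h.card_hits_cov_le β, h.hits_le c]
    have a1 := E_mul_expNum_le S h.p_pos.le h.p_lt_one.le hl hk
      (Y := fun ω => pairU S p e α ω * pairU S p e β ω * ind (S c) ω)
      (fun ω => mul_nonneg (mul_nonneg (h.pairU_nonneg _ _) (h.pairU_nonneg _ _))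
        (ind_nonneg _ _))
      (fun ω => by
        rw [apply_inter_of_subset (pairU_inter α) (subset_union_left.trans subset_union_left),
          apply_inter_of_subset (pairU_inter β) (subset_union_right.trans subset_union_left),
          ind_inter_of_subset subset_union_right])
    have a2 := mul_le_mul_of_nonneg_left (h.E_pairU_mul_pairU_mul_ind_le hd.symm c)
      (mul_pos (Real.exp_pos (l * (5 * D))) hm).le
    rw [pairWt, pairWt] at a2
    rw [hK]
    linarith
  have h2 : ∀ (α : C × C) (c : C),
      ∑ β ∈ (linked S (S c)).filter (fun β => Disjoint (cov S β) (cov S α)),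
        E p (fun ω => pairU S p e α ω * pairU S p e β ω * ind (S c) ω * expNum S l ω) ≤
      K * (2 * R * (κ * R)) * p⁻¹ ^ #(S α.1 ∩ S α.2) * p⁻¹ ^ #(S c ∩ cov S α) := fun α c => by
    refine (sum_le_sum fun β hβ => h1 α c β (mem_filter.1 hβ).2).trans ?_
    rw [← mul_sum]
    have b0 := h.sum_linked_le (h.wt_union_le c)
    rw [h.wt_eq] at b0
    have b1 := (sum_le_sum_of_subset_of_nonneg (filter_subset
      (fun β => Disjoint (cov S β) (cov S α)) (linked S (S c))) fun β _ _ =>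
      (mul_pos (h.inv_pow_pos #(S β.1 ∩ S β.2)) (h.inv_pow_pos #(S c ∩ cov S β))).le).trans b0
    have := mul_le_mul_of_nonneg_left b1 (mul_nonneg (mul_nonneg hK0
      (h.inv_pow_pos #(S α.1 ∩ S α.2)).le) (h.inv_pow_pos #(S c ∩ cov S α)).le)
    linarith
  have h3 : ∀ α ∈ pairs S, ∑ c ∈ hits S (cov S α),
      ∑ β ∈ (linked S (S c)).filter (fun β => Disjoint (cov S β) (cov S α)),
        E p (fun ω => pairU S p e α ω * pairU S p e β ω * ind (S c) ω * expNum S l ω) ≤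
      K * (2 * R * (κ * R)) * (κ * R) * p⁻¹ ^ #(S α.1 ∩ S α.2) := fun α _ => by
    refine (sum_le_sum fun c _ => h2 α c).trans ?_
    rw [← mul_sum]
    have := mul_le_mul_of_nonneg_left (h.wt_cov_le α) (mul_nonneg (mul_nonneg hK0
      (mul_nonneg (mul_nonneg zero_le_two h.R_nonneg) hκ))
      (h.inv_pow_pos #(S α.1 ∩ S α.2)).le)
    rw [wt] at this
    linarith
  refine (sum_le_sum h3).trans_eq ?_
  rw [← mul_sum, h.sum_pairs_inv_pow, hK]
  ring

variable {Y : C × C → Finset ι → ℝ} (hY : IsCentredPairFamily S p e Y)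
include hY

/-- A bound of the second moment of `∑ α, Y α` under exponential tilting. -/
theorem E_sum_sq_mul_expNum_le :
    E p (fun ω => (∑ α ∈ pairs S, Y α ω) ^ 2 * expNum S l ω) ≤
      Real.exp (l * (4 * D)) *
        (18 * (1 - p ^ e) * κ ^ 2 * (p ^ e) ^ 2 * Fintype.card C * R ^ 3) * E p (expNum S l) +
      l * (Real.exp (l * (3 * D)) *
        (3 * (1 - p ^ e) * κ * (p ^ e) ^ 2 * Fintype.card C * R ^ 2) *
          (E p (fun ω => |∑ β ∈ pairs S, Y β ω| * expNum S l ω) +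
            Real.exp (l * (2 * D)) * (6 * (1 - p ^ e) * κ * p ^ e * R ^ 2) * E p (expNum S l)) +
        Real.exp (l * (5 * D)) *
          (18 * (1 - p ^ e) ^ 2 * κ ^ 2 * (p ^ e) ^ 3 * Fintype.card C * R ^ 4) *
          E p (expNum S l)) := by
  set m := E p (expNum S l)
  set X := E p (fun ω => |∑ β ∈ pairs S, Y β ω| * expNum S l ω) with hX
  set Λ := Real.exp (l * (2 * D)) * (6 * (1 - p ^ e) * κ * p ^ e * R ^ 2) * m with hΛ
  have hp0 := h.p_pos.le
  have hp1 := h.p_lt_one.le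
  have hX0 : 0 ≤ X := E_nonneg hp0 hp1 fun ω => mul_nonneg (abs_nonneg _) (expNum_pos _ _ _).le
  have hΛ0 : 0 ≤ Λ := mul_nonneg (mul_nonneg (Real.exp_pos _).le (mul_nonneg (mul_nonneg
    (mul_nonneg (mul_nonneg (by norm_num) h.one_sub_pow_nonneg) (zero_le_one.trans h.one_le_kappa))
    (h.pow_nonneg' _)) (sq_nonneg _))) (h.E_expNum_pos hl).le
  have e0 : E p (fun ω => (∑ α ∈ pairs S, Y α ω) ^ 2 * expNum S l ω) =
      ∑ α ∈ pairs S, E p (fun ω => Y α ω * (∑ β ∈ pairs S, Y β ω) * expNum S l ω) := by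
    rw [← E_sum]
    congr 1
    funext ω
    rw [sq, ← sum_mul, ← sum_mul]
  have e1 : ∀ α ∈ pairs S, E p (fun ω => Y α ω * (∑ β ∈ pairs S, Y β ω) * expNum S l ω) ≤
      ∑ β ∈ linked S (cov S α), E p (fun ω => pairU S p e α ω * pairU S p e β ω * expNum S l ω) +
      l * (Real.exp (l * (3 * D)) *
          (∑ c ∈ hits S (cov S α), E p (fun ω => pairU S p e α ω * ind (S c) ω)) * (X + Λ) +
        ∑ c ∈ hits S (cov S α),
          ∑ β ∈ (linked S (S c)).filter (fun β => Disjoint (cov S β) (cov S α)),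
            E p (fun ω => pairU S p e α ω * pairU S p e β ω * ind (S c) ω * expNum S l ω)) := by
    intro α _
    refine (h.E_pair_mul_sum_le hY hl α).trans (add_le_add le_rfl
      (mul_le_mul_of_nonneg_left ?_ hl))
    rw [mul_sum, sum_mul, ← sum_add_distrib]
    refine sum_le_sum fun c _ => (h.E_pairU_mul_ind_mul_abs_le hY hl α c).trans
      (add_le_add (mul_le_mul_of_nonneg_left ?_ ?_) le_rfl)
    · exact add_le_add le_rfl (h.sum_E_pairU_le hl (h.wt_cov_union_le α c))
    · exact mul_nonneg (Real.exp_pos _).le (E_nonneg hp0 hp1 fun ω =>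
        mul_nonneg (h.pairU_nonneg _ _) (ind_nonneg _ _))
  rw [e0]
  refine (sum_le_sum e1).trans ?_
  rw [sum_add_distrib, ← mul_sum, sum_add_distrib, ← sum_mul, ← mul_sum]
  have b1 := h.sum_E_pairU_mul_pairU_le hl
  have b2 := h.sum_E_pairU_mul_ind_le hl
  have b3 := h.sum_E_pairU_mul_pairU_mul_ind_le hl
  refine add_le_add b1 (mul_le_mul_of_nonneg_left (add_le_add ?_ b3) hl)
  exact mul_le_mul_of_nonneg_right (mul_le_mul_of_nonneg_left b2 (Real.exp_pos _).le)
    (add_nonneg hX0 hΛ0)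

/-- A bound of the first absolute moment of `∑ α, Y α` under exponential tilting, in terms of a
number `s` whose square is a bound of the variance. -/
theorem E_abs_sum_mul_expNum_le {s : ℝ} (hs : 0 < s)
    (hvar : (1 - p) * (p ^ e) ^ 2 * Fintype.card C * R ≤ s ^ 2)
    (hδ : √(R / ((1 - p) * Fintype.card C)) ≤ 1) :
    p ^ e / s ^ 2 * E p (fun ω => |∑ α ∈ pairs S, Y α ω| * expNum S l ω) ≤
      29 / 4 * (e * κ * √(R / ((1 - p) * Fintype.card C)) * Real.exp (3 * (l * D))) *
        (1 + l * s) * E p (expNum S l) := by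
  have hp0 := h.p_pos.le
  have hp1 := h.p_lt_one.le
  have hq : 0 < 1 - p := sub_pos.2 h.p_lt_one
  have hM0 : 0 < (Fintype.card C : ℝ) := by exact_mod_cast Fintype.card_pos
  have hR := h.one_le_R
  have hD : 0 ≤ D := by
    obtain ⟨c⟩ := ‹Nonempty C›
    exact (Nat.cast_nonneg _).trans (h.hits_le c)
  have hexp : ∀ n : ℕ, Real.exp (l * ((n : ℝ) * D)) = Real.exp (l * D) ^ n := fun n => by
    rw [← Real.exp_nat_mul]; congr 1; ring
  have hmain := h.E_sum_sq_mul_expNum_le hl hY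
  have g2 := hexp 2
  have g3 := hexp 3
  have g4 := hexp 4
  have g5 := hexp 5
  push_cast at g2 g3 g4 g5
  rw [g2, g3, g4, g5] at hmain
  rw [show 3 * (l * D) = l * (3 * D) by ring, g3]
  refine first_moment_le_of_second_moment_le hq (by linarith [h.p_pos]) hM0 hR h.one_le_kappa
    (pow_pos h.p_pos e) (by exact_mod_cast h.e_pos) h.one_sub_pow_nonneg h.one_sub_pow_le
    (Real.one_le_exp (mul_nonneg hl hD)) hl hs hvar (Real.sqrt_nonneg _) hδ ?_
    (E_nonneg hp0 hp1 fun ω => mul_nonneg (abs_nonneg _) (expNum_pos _ _ _).le)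
    (h.E_expNum_pos hl) (E_abs_mul_sq_le hp0 hp1 _ fun ω => (expNum_pos _ _ _).le) hmain
  rw [Real.sq_sqrt (by positivity)]
  field_simp

end IsRegular

end RandomSubset

end

/-! ### Size bias and the basic Stein inequality -/

noncomputable section

namespace RandomSubset

open Finset

variable {ι C : Type*} [DecidableEq ι] [Fintype C]

/-- The centred number of members of the family that appear when the first member of a pair is added
to the random set, because the second member is completed. -/
def pairT (S : C → Finset ι) (p : ℝ) (e : ℕ) (α : C × C) (ω : Finset ι) : ℝ :=
  ind (S α.2 \ S α.1) ω - ind (S α.2) ω - (pairWt S p e α - p ^ e)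

/-- The summand of the random variable that controls the lack of smoothness. -/
def pairQ (S : C → Finset ι) (p : ℝ) (e : ℕ) (α : C × C) (ω : Finset ι) : ℝ :=
  ind (S α.2 \ S α.1) ω * (p⁻¹ ^ e * ind (S α.1) ω - 1)

/-- The expectation of `num S`. -/
def mean (C : Type*) [Fintype C] (p : ℝ) (e : ℕ) : ℝ := Fintype.card C * p ^ e

/-- The variance of `num S`. -/
def var (S : C → Finset ι) (p : ℝ) (e : ℕ) : ℝ := p ^ e * ∑ α ∈ pairs S, (pairWt S p e α - p ^ e)

/-- The standardization of `num S`. -/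
def std (S : C → Finset ι) (p : ℝ) (e : ℕ) (ω : Finset ι) : ℝ :=
  (num S ω - mean C p e) / √(var S p e)

def steinT (S : C → Finset ι) (p : ℝ) (e : ℕ) (ω : Finset ι) : ℝ :=
  p ^ e / var S p e * ∑ α ∈ pairs S, pairT S p e α ω

def steinQ (S : C → Finset ι) (p : ℝ) (e : ℕ) (ω : Finset ι) : ℝ :=
  p ^ e / var S p e * ∑ α ∈ pairs S, pairQ S p e α ω

theorem num_union_sub (S : C → Finset ι) (c : C) (ω : Finset ι) :
    num S (ω ∪ S c) - num S ω =
      ∑ c' ∈ hits S (S c), (ind (S c' \ S c) ω - ind (S c') ω) := by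
  rw [num, num, ← sum_sub_distrib, hits, sum_filter]
  refine sum_congr rfl fun c' _ => ?_
  rw [ind_union_right]
  split_ifs with hd
  · rw [sdiff_eq_self_of_disjoint hd, sub_self]
  · rfl

/-- Tilting by the standardized variable is tilting by `num S` with `l = θ / √(var S p e)`, up to a
deterministic factor. -/
theorem exp_std (S : C → Finset ι) (p : ℝ) (e : ℕ) (θ : ℝ) (ω : Finset ι) :
    Real.exp (θ * std S p e ω) =
      Real.exp (-(θ / √(var S p e) * mean C p e)) * expNum S (θ / √(var S p e)) ω := by
  rw [expNum, ← Real.exp_add, std]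
  congr 1
  ring

namespace IsRegular

variable {S : C → Finset ι} {p D R κ : ℝ} {e : ℕ} (h : IsRegular S p e D R κ)
include h

theorem pairWt_le_one (α : C × C) : pairWt S p e α ≤ 1 := by
  rw [← h.pow_card_sdiff_eq]; exact h.pow_le_one' _

theorem pow_le_pairWt (α : C × C) : p ^ e ≤ pairWt S p e α :=
  le_mul_of_one_le_right (h.pow_nonneg' e) (one_le_pow₀ h.one_le_inv)

/-- Members that meet share at least one element, hence `p ^ e ≤ p * pairWt S p e α`. This makes
every covariance comparable with `q` times its leading part and underlies the lower bound of the
variance. -/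
theorem mul_pairWt_le {α : C × C} (hα : α ∈ pairs S) :
    (1 - p) * pairWt S p e α ≤ pairWt S p e α - p ^ e := by
  have h1 : p ^ e * 1 ≤ p * pairWt S p e α := by
    rw [pairWt, mul_left_comm]
    refine mul_le_mul_of_nonneg_left ?_ (h.pow_nonneg' e)
    obtain ⟨k, hk⟩ : ∃ k, #(S α.1 ∩ S α.2) = k + 1 := by
      refine Nat.exists_eq_succ_of_ne_zero fun h0 => mem_pairs.1 hα ?_
      rw [disjoint_comm, disjoint_iff_inter_eq_empty, ← card_eq_zero, h0]
    rw [hk, pow_succ, mul_left_comm, mul_inv_cancel₀ h.p_pos.ne', mul_one]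
    exact one_le_pow₀ h.one_le_inv
  linarith

theorem le_var : (1 - p) * (p ^ e) ^ 2 * Fintype.card C * R ≤ var S p e := by
  have h1 : ∑ α ∈ pairs S, (1 - p) * pairWt S p e α = (1 - p) * p ^ e * (Fintype.card C * R) := by
    rw [← h.sum_pairs_inv_pow, mul_sum]
    exact sum_congr rfl fun α _ => by rw [pairWt]; ring
  have h2 := sum_le_sum fun α (hα : α ∈ pairs S) => h.mul_pairWt_le hα
  rw [h1] at h2
  have := mul_le_mul_of_nonneg_left h2 (h.pow_nonneg' e)
  rw [var]
  linarith

theorem var_pos [Nonempty C] : 0 < var S p e := by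
  refine lt_of_lt_of_le ?_ h.le_var
  have h1 : 0 < 1 - p := sub_pos.2 h.p_lt_one
  have h2 : 0 < R := zero_lt_one.trans_le h.one_le_R
  have h3 : 0 < p ^ e := pow_pos h.p_pos e
  have h4 : 0 < (Fintype.card C : ℝ) := by exact_mod_cast Fintype.card_pos
  positivity

/-- If `S α.2 \ S α.1` and `S α.1` are both present, so is `S α.2`; thus the gain is at most the
first summand of `pairU`. The centring is at most the last summand because `pairWt ≤ 1`. -/
theorem abs_pairT_le (α : C × C) (ω : Finset ι) : |pairT S p e α ω| ≤ pairU S p e α ω := by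
  have h1 : ind (S α.2) ω ≤ ind (S α.2 \ S α.1) ω := ind_anti sdiff_subset ω
  have h2 : ind (S α.2 \ S α.1) ω * ind (S α.1) ω ≤ ind (S α.2) ω := by
    rw [ind_mul_ind]
    exact ind_anti (by rw [sdiff_union_self_eq_union]; exact subset_union_left) ω
  have h3 := h.pow_le_pairWt α
  have h4 : pairWt S p e α - p ^ e ≤ (1 - p ^ e) * pairWt S p e α := by
    have := mul_le_mul_of_nonneg_left (h.pairWt_le_one α) (h.pow_nonneg' e)
    linarith
  have h5 : 0 ≤ (1 - p ^ e) * (p⁻¹ ^ e * ind (cov S α) ω) :=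
    mul_nonneg h.one_sub_pow_nonneg (mul_nonneg (h.inv_pow_pos _).le (ind_nonneg _ _))
  have h6 : 0 ≤ ind (S α.2 \ S α.1) ω * (1 - ind (S α.1) ω) :=
    mul_nonneg (ind_nonneg _ _) (sub_nonneg.2 (ind_le_one _ _))
  rw [pairT, pairU, abs_le]
  constructor <;> linarith

/-- If `S α.1` is present, `p⁻¹ ^ e - 1 = (1 - p ^ e) * p⁻¹ ^ e` matches the second summand of
`pairU`; if it is absent, the first summand takes over. -/
theorem abs_pairQ_le (α : C × C) (ω : Finset ι) : |pairQ S p e α ω| ≤ pairU S p e α ω := by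
  have h0 : 0 ≤ (1 - p ^ e) * pairWt S p e α := mul_nonneg h.one_sub_pow_nonneg (h.pairWt_nonneg α)
  have hJ := ind_nonneg (S α.2 \ S α.1) ω
  have h1 : ind (cov S α) ω = ind (S α.2 \ S α.1) ω * ind (S α.1) ω := by
    rw [ind_mul_ind, sdiff_union_self_eq_union, union_comm, cov]
  rw [pairQ, pairU, h1, abs_mul, abs_of_nonneg hJ]
  by_cases hs : S α.1 ⊆ ω
  · have h2 : ind (S α.1) ω = 1 := if_pos hs
    have h3 : (1 - p ^ e) * p⁻¹ ^ e = p⁻¹ ^ e - 1 := by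
      rw [sub_mul, one_mul, h.pow_mul_inv_pow]
    have h4 : 1 ≤ p⁻¹ ^ e := one_le_pow₀ h.one_le_inv
    rw [h2, mul_one, mul_one, abs_of_nonneg (by linarith), ← mul_assoc, h3]
    linarith
  · have h2 : ind (S α.1) ω = 0 := if_neg hs
    rw [h2]
    simp only [mul_zero, zero_sub, abs_neg, abs_one, sub_zero, add_zero]
    linarith

variable [Fintype ι]

theorem isCentredPairFamily_pairT : IsCentredPairFamily S p e (pairT S p e) where
  abs_le := h.abs_pairT_le
  mean_eq α := by
    have : E p (pairT S p e α) = E p (ind (S α.2 \ S α.1)) - E p (ind (S α.2)) -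
        E p (fun _ : Finset ι => pairWt S p e α - p ^ e) := by
      rw [← E_sub, ← E_sub]; rfl
    rw [this, E_ind, E_ind, E_const, h.pow_card_sdiff_eq, h.card_eq, sub_self]
  inter α ω := by
    have h1 : S α.2 \ S α.1 ⊆ cov S α := sdiff_subset.trans subset_union_right
    have h2 : S α.2 ⊆ cov S α := subset_union_right
    rw [pairT, pairT, ind_inter_of_subset h1, ind_inter_of_subset h2]

theorem isCentredPairFamily_pairQ : IsCentredPairFamily S p e (pairQ S p e) where
  abs_le := h.abs_pairQ_le
  mean_eq α := by
    have h1 : pairQ S p e α = fun ω => p⁻¹ ^ e * ind (cov S α) ω - ind (S α.2 \ S α.1) ω := by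
      funext ω
      have h1 : ind (cov S α) ω = ind (S α.2 \ S α.1) ω * ind (S α.1) ω := by
        rw [ind_mul_ind, sdiff_union_self_eq_union, union_comm, cov]
      rw [h1, pairQ]; ring
    rw [h1, E_sub, E_const_mul, E_ind, E_ind, h.pow_card_cov, h.pow_card_sdiff_eq, sub_self]
  inter α ω := by
    have h1 : S α.2 \ S α.1 ⊆ cov S α := sdiff_subset.trans subset_union_right
    have h2 : S α.1 ⊆ cov S α := subset_union_left
    rw [pairQ, pairQ, ind_inter_of_subset h1, ind_inter_of_subset h2]

theorem E_num : E p (num S) = mean C p e := by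
  have : num S = fun ω => ∑ c, ind (S c) ω := rfl
  rw [this, E_sum, mean]
  simp only [E_ind, h.card_eq, sum_const, nsmul_eq_mul, card_univ]

/-- The size-bias identity. -/
theorem E_num_mul (F : Finset ι → ℝ) :
    E p (fun ω => num S ω * F ω) = p ^ e * ∑ c, E p (fun ω => F (ω ∪ S c)) := by
  simp only [num, sum_mul]
  rw [E_sum, mul_sum]
  exact sum_congr rfl fun c _ => by rw [E_ind_mul, h.card_eq]

theorem E_num_sub_mul (F : Finset ι → ℝ) :
    E p (fun ω => (num S ω - mean C p e) * F ω) =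
      p ^ e * ∑ c, E p (fun ω => F (ω ∪ S c) - F ω) := by
  simp only [sub_mul]
  rw [E_sub, h.E_num_mul, E_const_mul]
  simp only [E_sub, sum_sub_distrib, sum_const, nsmul_eq_mul, card_univ, mean]
  ring

-- Fluctuation and mean of the number of gained members, summed over `c`. Since `p ^ e` times the
-- mean is the variance, the leading coefficient in Stein's inequality becomes one.
omit h [Fintype ι] in
theorem sum_num_union_sub (ω : Finset ι) :
    ∑ c, (num S (ω ∪ S c) - num S ω) =
      ∑ α ∈ pairs S, pairT S p e α ω + ∑ α ∈ pairs S, (pairWt S p e α - p ^ e) := by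
  rw [← sum_add_distrib, sum_pairs]
  refine sum_congr rfl fun c _ => ?_
  rw [num_union_sub]
  exact sum_congr rfl fun c' _ => by rw [pairT]; ring

/-- `var` is the variance of `num`. -/
theorem E_num_sub_sq : E p (fun ω => (num S ω - mean C p e) ^ 2) = var S p e := by
  have h1 : (fun ω => (num S ω - mean C p e) ^ 2) =
      fun ω => (num S ω - mean C p e) * (num S ω - mean C p e) := by funext ω; ring
  rw [h1, h.E_num_sub_mul, var, ← E_sum]
  have h2 : (fun ω => ∑ c, ((num S (ω ∪ S c) - mean C p e) - (num S ω - mean C p e))) =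
      fun ω => ∑ α ∈ pairs S, pairT S p e α ω + ∑ α ∈ pairs S, (pairWt S p e α - p ^ e) := by
    funext ω
    rw [← sum_num_union_sub]
    exact sum_congr rfl fun c _ => by ring
  rw [h2, E_add, E_const, E_sum]
  simp only [h.isCentredPairFamily_pairT.mean_eq, sum_const_zero, zero_add]

/-- The second difference is dominated by `pairQ`. -/
theorem sum_E_mul_sub_le {H : Finset ι → ℝ} (hH : ∀ ω ω', ω ⊆ ω' → H ω ≤ H ω') :
    p ^ e * ∑ c, E p (fun ω => (num S (ω ∪ S c) - num S ω) * (H (ω ∪ S c) - H ω)) ≤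
      p ^ e * E p (fun ω => (∑ α ∈ pairs S, pairQ S p e α ω) * H ω) := by
  refine mul_le_mul_of_nonneg_left ?_ (h.pow_nonneg' e)
  have h0 : (fun ω => (∑ α ∈ pairs S, pairQ S p e α ω) * H ω) = fun ω =>
      ∑ c, (p⁻¹ ^ e * (ind (S c) ω * ((∑ c' ∈ hits S (S c), ind (S c' \ S c) ω) * H ω)) -
        (∑ c' ∈ hits S (S c), ind (S c' \ S c) ω) * H ω) := by
    funext ω
    rw [sum_pairs, sum_mul]
    refine sum_congr rfl fun c _ => ?_
    simp only [pairQ]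
    rw [← sum_mul]
    ring
  rw [h0, E_sum]
  refine sum_le_sum fun c _ => ?_
  -- The density `p⁻¹ ^ e * ind (S c)` moves the expectation to `ω ∪ S c`, so that `pairQ`
  -- reproduces the increment of `H`.
  rw [E_sub, E_const_mul, E_ind_mul, h.card_eq, ← mul_assoc, mul_comm (p⁻¹ ^ e), h.pow_mul_inv_pow,
    one_mul, ← E_sub]
  refine E_mono h.p_pos.le h.p_lt_one.le fun ω => ?_
  have h1 : ∑ c' ∈ hits S (S c), ind (S c' \ S c) (ω ∪ S c) =
      ∑ c' ∈ hits S (S c), ind (S c' \ S c) ω :=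
    sum_congr rfl fun c' _ => by rw [ind_union_right, Finset.sdiff_idem]
  -- Dropping the subtracted indicators is allowed because the increment of `H` is nonnegative.
  rw [h1, ← mul_sub, num_union_sub]
  refine mul_le_mul_of_nonneg_right ?_ (sub_nonneg.2 (hH _ _ subset_union_left))
  exact sum_le_sum fun c' _ => sub_le_self _ (ind_nonneg _ _)

variable [Nonempty C]

/-- The basic inequality for Stein's method. -/
theorem E_std_mul_le {f f' g : ℝ → ℝ} (hg : Monotone g)
    (hf : ∀ x d, 0 ≤ d → f (x + d) - f x ≤ d * f' x + d * (g (x + d) - g x)) :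
    E p (fun ω => std S p e ω * f (std S p e ω)) ≤
      E p (fun ω => f' (std S p e ω)) + E p (fun ω => steinT S p e ω * f' (std S p e ω)) +
        E p (fun ω => steinQ S p e ω * g (std S p e ω)) := by
  have hv := h.var_pos
  set s := √(var S p e) with hs
  have hs0 : 0 < s := Real.sqrt_pos.2 hv
  have hs2 : s ^ 2 = var S p e := Real.sq_sqrt hv.le
  have hstd : ∀ ω ω', std S p e ω' = std S p e ω + (num S ω' - num S ω) / s := fun ω ω' => by
    simp only [std, ← hs]; ring
  have hmono : ∀ ω ω', ω ⊆ ω' → g (std S p e ω) ≤ g (std S p e ω') := fun ω ω' hω => hg <| by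
    rw [hstd ω ω']
    exact le_add_of_nonneg_right (div_nonneg (sub_nonneg.2 (num_mono S hω)) hs0.le)
  have h1 : E p (fun ω => std S p e ω * f (std S p e ω)) =
      s⁻¹ * (p ^ e * ∑ c, E p (fun ω => f (std S p e (ω ∪ S c)) - f (std S p e ω))) := by
    rw [← h.E_num_sub_mul (fun ω => f (std S p e ω)), ← E_const_mul]
    congr 1
    funext ω
    simp only [std, ← hs]
    ring
  have h2 : ∀ c ω, f (std S p e (ω ∪ S c)) - f (std S p e ω) ≤
      s⁻¹ * ((num S (ω ∪ S c) - num S ω) * f' (std S p e ω)) +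
        s⁻¹ * ((num S (ω ∪ S c) - num S ω) * (g (std S p e (ω ∪ S c)) - g (std S p e ω))) := by
    intro c ω
    have := hf (std S p e ω) ((num S (ω ∪ S c) - num S ω) / s)
      (div_nonneg (sub_nonneg.2 (num_mono S subset_union_left)) hs0.le)
    rw [← hstd] at this
    refine this.trans_eq (by ring)
  have h3 : ∑ c, E p (fun ω => f (std S p e (ω ∪ S c)) - f (std S p e ω)) ≤
      s⁻¹ * E p (fun ω => (∑ c, (num S (ω ∪ S c) - num S ω)) * f' (std S p e ω)) +
        s⁻¹ * ∑ c, E p (fun ω => (num S (ω ∪ S c) - num S ω) *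
          (g (std S p e (ω ∪ S c)) - g (std S p e ω))) := by
    simp only [sum_mul]
    rw [E_sum, mul_sum, mul_sum, ← sum_add_distrib]
    refine sum_le_sum fun c _ => ?_
    rw [← E_const_mul, ← E_const_mul, ← E_add]
    exact E_mono h.p_pos.le h.p_lt_one.le (h2 c)
  have h4 := h.sum_E_mul_sub_le hmono
  have h5 : s⁻¹ * (p ^ e * (s⁻¹ * E p (fun ω => (∑ c, (num S (ω ∪ S c) - num S ω)) *
      f' (std S p e ω)))) =
      E p (fun ω => f' (std S p e ω)) + E p (fun ω => steinT S p e ω * f' (std S p e ω)) := by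
    rw [← E_const_mul, ← E_const_mul, ← E_const_mul, ← E_add]
    congr 1
    funext ω
    have hne : p ^ e * ∑ α ∈ pairs S, (pairWt S p e α - p ^ e) = s ^ 2 := hs2.symm
    rw [sum_num_union_sub (p := p) (e := e), steinT, ← hs2]
    field_simp
    linear_combination f' (std S p e ω) * hne
  have h6 : E p (fun ω => steinQ S p e ω * g (std S p e ω)) =
      s⁻¹ * (s⁻¹ * (p ^ e * E p (fun ω => (∑ α ∈ pairs S, pairQ S p e α ω) *
        g (std S p e ω)))) := by
    rw [← E_const_mul, ← E_const_mul, ← E_const_mul]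
    congr 1
    funext ω
    rw [steinQ, ← hs2]
    field_simp
  rw [h1, ← h5, h6]
  have h7 := mul_le_mul_of_nonneg_left (mul_le_mul_of_nonneg_left h3 (h.pow_nonneg' e))
    (inv_pos.2 hs0).le
  have h8 := mul_le_mul_of_nonneg_left (mul_le_mul_of_nonneg_left h4
    (inv_pos.2 hs0).le) (inv_pos.2 hs0).le
  linarith

theorem E_abs_stein_mul_exp_le {Y : C × C → Finset ι → ℝ} (hY : IsCentredPairFamily S p e Y)
    (hδ : √(R / ((1 - p) * Fintype.card C)) ≤ 1) {θ : ℝ} (hθ : 0 ≤ θ) :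
    E p (fun ω => |p ^ e / var S p e * ∑ α ∈ pairs S, Y α ω| * Real.exp (θ * std S p e ω)) ≤
      29 / 4 * (e * κ * √(R / ((1 - p) * Fintype.card C))) *
        Real.exp (3 * (D * θ / √(var S p e))) * (1 + θ) *
        E p (fun ω => Real.exp (θ * std S p e ω)) := by
  have hv := h.var_pos
  set s := √(var S p e) with hs
  have hs0 : 0 < s := Real.sqrt_pos.2 hv
  have hs2 : s ^ 2 = var S p e := Real.sq_sqrt hv.le
  have key := h.E_abs_sum_mul_expNum_le (div_nonneg hθ hs0.le) hY hs0 (hs2 ▸ h.le_var) hδ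
  rw [div_mul_cancel₀ _ hs0.ne'] at key
  simp only [exp_std]
  rw [← hs, E_const_mul]
  have e1 : (fun ω => |p ^ e / var S p e * ∑ α ∈ pairs S, Y α ω| *
      (Real.exp (-(θ / s * mean C p e)) * expNum S (θ / s) ω)) = fun ω =>
      Real.exp (-(θ / s * mean C p e)) * (p ^ e / s ^ 2 *
        (|∑ α ∈ pairs S, Y α ω| * expNum S (θ / s) ω)) := by
    funext ω
    rw [abs_mul, abs_of_nonneg (div_nonneg (h.pow_nonneg' e) hv.le), hs2]
    ring
  rw [e1, E_const_mul, E_const_mul]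
  have := mul_le_mul_of_nonneg_left key (Real.exp_pos (-(θ / s * mean C p e))).le
  refine this.trans_eq ?_
  rw [show θ / s * D = D * θ / s by ring]
  ring

end IsRegular

end RandomSubset

end

/-! ### The moment generating function -/

noncomputable section

namespace RandomSubset

open Finset

variable {ι C : Type*} [DecidableEq ι] [Fintype C] [Fintype ι]

theorem hasDerivAt_E {p : ℝ} {F F' : ℝ → Finset ι → ℝ} {θ : ℝ}
    (hF : ∀ ω, HasDerivAt (fun x => F x ω) (F' θ ω) θ) :
    HasDerivAt (fun x => E p (F x)) (E p (F' θ)) θ :=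
  HasDerivAt.fun_sum fun ω _ => (hF ω).const_mul _

/-- A Gronwall type estimate. -/
theorem le_exp_of_deriv_le {m m' : ℝ → ℝ} {B t : ℝ} (hm : ∀ x, HasDerivAt m (m' x) x)
    (h0 : m 0 = 1) (hle : ∀ x ∈ Set.Icc 0 t, m' x ≤ x * (1 + 2 * B * (1 + x)) * m x)
    (hB : 0 ≤ B) {θ : ℝ} (hθ : 0 ≤ θ) (hθt : θ ≤ t) :
    m θ ≤ Real.exp (θ ^ 2 / 2 + B * θ ^ 2 * (1 + θ)) := by
  -- The exponent is minus an antiderivative of `x * (1 + 2 * B * (1 + x))`, which makes `G`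
  -- decreasing.
  set G : ℝ → ℝ := fun x => m x * Real.exp (-(x ^ 2 / 2 + B * (x ^ 2 + 2 / 3 * x ^ 3))) with hG
  have hder : ∀ x, HasDerivAt G (m' x * Real.exp (-(x ^ 2 / 2 + B * (x ^ 2 + 2 / 3 * x ^ 3))) +
      m x * (Real.exp (-(x ^ 2 / 2 + B * (x ^ 2 + 2 / 3 * x ^ 3))) *
        -(x * (1 + 2 * B * (1 + x))))) x := fun x => by
    refine (hm x).mul (HasDerivAt.exp ?_)
    have h2 := hasDerivAt_pow 2 x
    have h3 := hasDerivAt_pow 3 x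
    have := ((h2.div_const 2).add ((h2.add (h3.const_mul (2 / 3))).const_mul B)).neg
    refine this.congr_deriv ?_
    norm_num
    ring
  have hanti : AntitoneOn G (Set.Icc 0 t) := by
    refine antitoneOn_of_deriv_nonpos (convex_Icc 0 t)
      (fun x _ => (hder x).continuousAt.continuousWithinAt)
      (fun x _ => (hder x).differentiableAt.differentiableWithinAt) fun x hx => ?_
    rw [(hder x).deriv]
    have := mul_le_mul_of_nonneg_right (hle x (interior_subset hx))
      (Real.exp_pos (-(x ^ 2 / 2 + B * (x ^ 2 + 2 / 3 * x ^ 3)))).le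
    linarith
  have h1 := hanti ⟨le_rfl, hθ.trans hθt⟩ ⟨hθ, hθt⟩ hθ
  have h2 : G 0 = 1 := by simp [hG, h0]
  rw [h2, hG] at h1
  simp only [Real.exp_neg] at h1
  rw [← div_eq_mul_inv, div_le_one (Real.exp_pos _)] at h1
  refine h1.trans (Real.exp_le_exp.2 ?_)
  have : 0 ≤ B * θ ^ 3 := by positivity
  linarith

namespace IsRegular

variable {S : C → Finset ι} {p D R κ : ℝ} {e : ℕ} (h : IsRegular S p e D R κ) [Nonempty C]
  (hδ : √(R / ((1 - p) * Fintype.card C)) ≤ 1) {t B : ℝ}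
  (hB : B = 29 / 4 * (e * κ * √(R / ((1 - p) * Fintype.card C))) *
    Real.exp (3 * (D * t / √(var S p e))))
include h hδ hB

theorem bound_nonneg : 0 ≤ B := by
  rw [hB]
  have := h.one_le_kappa
  positivity

theorem E_abs_stein_mul_exp_le_of_le {Y : C × C → Finset ι → ℝ}
    (hY : IsCentredPairFamily S p e Y) {θ : ℝ} (hθ : 0 ≤ θ) (hθt : θ ≤ t) :
    E p (fun ω => |p ^ e / var S p e * ∑ α ∈ pairs S, Y α ω| * Real.exp (θ * std S p e ω)) ≤
      B * (1 + θ) * E p (fun ω => Real.exp (θ * std S p e ω)) := by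
  refine (h.E_abs_stein_mul_exp_le hY hδ hθ).trans ?_
  have hD : 0 ≤ D := by
    obtain ⟨c⟩ := ‹Nonempty C›
    exact (Nat.cast_nonneg _).trans (h.hits_le c)
  have hκ := h.one_le_kappa
  have hm : 0 ≤ E p (fun ω => Real.exp (θ * std S p e ω)) :=
    E_nonneg h.p_pos.le h.p_lt_one.le fun ω => (Real.exp_pos _).le
  rw [hB]
  gcongr

/-- For an exponential test function, convexity permits `g = f'`. The main term gives the Gaussian
rate `x`. The remainders `steinT` and `steinQ` each add at most `x * B * (1 + x)`, hence the `2 * B`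
in the Gronwall estimate. -/
theorem E_exp_std_le {θ : ℝ} (hθ : 0 ≤ θ) (hθt : θ ≤ t) :
    E p (fun ω => Real.exp (θ * std S p e ω)) ≤ Real.exp (θ ^ 2 / 2 + B * θ ^ 2 * (1 + θ)) := by
  refine le_exp_of_deriv_le (m := fun x => E p (fun ω => Real.exp (x * std S p e ω)))
    (m' := fun x => E p (fun ω => std S p e ω * Real.exp (x * std S p e ω)))
    (fun x => hasDerivAt_E
      (F' := fun x ω => std S p e ω * Real.exp (x * std S p e ω)) fun ω => ?_) (by simp) ?_
    (h.bound_nonneg hδ hB) hθ hθt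
  · have := ((hasDerivAt_id x).mul_const (std S p e ω)).exp
    refine this.congr_deriv ?_
    simp only [id]
    ring
  · intro x hx
    have hx0 : 0 ≤ x := hx.1
    have h1 := h.E_std_mul_le (f := fun y => Real.exp (x * y)) (f' := fun y => x * Real.exp (x * y))
      (g := fun y => x * Real.exp (x * y))
      (fun a b hab => mul_le_mul_of_nonneg_left (Real.exp_le_exp.2
        (mul_le_mul_of_nonneg_left hab hx0)) hx0) (fun y d hd => by
        have e1 := Real.add_one_le_exp (x * y - x * (y + d))
        rw [Real.exp_sub, le_div_iff₀ (Real.exp_pos _)] at e1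
        linarith)
    have key : ∀ {Y : C × C → Finset ι → ℝ}, IsCentredPairFamily S p e Y →
        E p (fun ω => (p ^ e / var S p e * ∑ α ∈ pairs S, Y α ω) *
          (x * Real.exp (x * std S p e ω))) ≤
        x * (B * (1 + x) * E p (fun ω => Real.exp (x * std S p e ω))) := fun hY => by
      refine le_trans ?_ (mul_le_mul_of_nonneg_left
        (h.E_abs_stein_mul_exp_le_of_le hδ hB hY hx0 hx.2) hx0)
      rw [← E_const_mul]
      refine E_mono h.p_pos.le h.p_lt_one.le fun ω => ?_
      rw [mul_left_comm]
      exact mul_le_mul_of_nonneg_left (mul_le_mul_of_nonneg_right (le_abs_self _)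
        (Real.exp_pos _).le) hx0
    have kT := key h.isCentredPairFamily_pairT
    have kQ := key h.isCentredPairFamily_pairQ
    simp only [steinT, steinQ] at h1
    rw [E_const_mul] at h1
    linarith

/-- The main estimate for the remainder terms in Stein's method. -/
theorem E_abs_stein_mul_exp_le_exp {Y : C × C → Finset ι → ℝ}
    (hY : IsCentredPairFamily S p e Y) {θ : ℝ} (hθ : 0 ≤ θ) (hθt : θ ≤ t) :
    E p (fun ω => |p ^ e / var S p e * ∑ α ∈ pairs S, Y α ω| * Real.exp (θ * std S p e ω)) ≤
      B * Real.exp (B * t ^ 2 * (1 + t)) * ((1 + θ) * Real.exp (θ ^ 2 / 2)) := by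
  have hB0 := h.bound_nonneg hδ hB
  refine (h.E_abs_stein_mul_exp_le_of_le hδ hB hY hθ hθt).trans ?_
  have h1 : E p (fun ω => Real.exp (θ * std S p e ω)) ≤
      Real.exp (θ ^ 2 / 2) * Real.exp (B * t ^ 2 * (1 + t)) := by
    refine (h.E_exp_std_le hδ hB hθ hθt).trans ?_
    rw [Real.exp_add]
    gcongr
  have := mul_le_mul_of_nonneg_left h1 (mul_nonneg hB0 (by linarith : 0 ≤ 1 + θ))
  linarith

end IsRegular

end RandomSubset

end

/-! ### Mills' ratio and the solution of the Stein equation -/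

noncomputable section

namespace GaussianStein

open Filter Topology SubgraphCount

/-- The standard normal density. -/
def phi (x : ℝ) : ℝ := (√(2 * Real.pi))⁻¹ * Real.exp (-(x ^ 2 / 2))

/-- The tail of the standard normal distribution. -/
def tail (x : ℝ) : ℝ := 1 - Phi x

theorem phi_pos (x : ℝ) : 0 < phi x := mul_pos (by positivity) (Real.exp_pos _)

theorem phi_neg (x : ℝ) : phi (-x) = phi x := by simp [phi]

theorem hasDerivAt_phi (x : ℝ) : HasDerivAt phi (-x * phi x) x := by
  have h := (((hasDerivAt_pow 2 x).div_const 2).neg.exp).const_mul (√(2 * Real.pi))⁻¹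
  refine h.congr_deriv ?_
  simp only [phi, Pi.neg_apply]
  norm_num
  ring

theorem continuous_phi : Continuous phi := by unfold phi; fun_prop

theorem Phi_eq_integral (x : ℝ) : Phi x = ∫ y in Set.Iic x, phi y := by
  have h1 : gaussianPDFReal 0 1 = phi := by
    funext y; simp [gaussianPDFReal, phi, neg_div]
  rw [Phi, cdf_eq_real, measureReal_def, gaussianReal_apply_eq_integral 0 one_ne_zero,
    ENNReal.toReal_ofReal (integral_nonneg fun y => gaussianPDFReal_nonneg _ _ _), h1]

theorem integrable_phi : Integrable phi := by
  have h1 : gaussianPDFReal 0 1 = phi := by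
    funext y; simp [gaussianPDFReal, phi, neg_div]
  rw [← h1]
  exact integrable_gaussianPDFReal 0 1

theorem hasDerivAt_Phi (x : ℝ) : HasDerivAt Phi (phi x) x := by
  have h : Phi = fun y => Phi 0 + ∫ u in (0 : ℝ)..y, phi u := by
    funext y
    rw [Phi_eq_integral y, Phi_eq_integral 0, ← intervalIntegral.integral_Iic_sub_Iic
      integrable_phi.integrableOn integrable_phi.integrableOn]
    ring
  rw [h]
  exact ((intervalIntegral.integral_hasDerivAt_right (continuous_phi.intervalIntegrable _ _)
    (continuous_phi.stronglyMeasurableAtFilter _ _) continuous_phi.continuousAt)).const_add _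

theorem hasDerivAt_tail (x : ℝ) : HasDerivAt tail (-phi x) x := (hasDerivAt_Phi x).const_sub 1

theorem tendsto_tail : Tendsto tail atTop (𝓝 0) := by
  have := (tendsto_cdf_atTop (gaussianReal 0 1)).const_sub 1
  rwa [sub_self] at this

theorem Phi_nonneg (x : ℝ) : 0 ≤ Phi x := cdf_nonneg _ x

theorem Phi_le_one (x : ℝ) : Phi x ≤ 1 := cdf_le_one _ x

/-- The difference of the two sides has derivative zero and tends to zero at infinity. -/
theorem Phi_neg (x : ℝ) : Phi (-x) = tail x := by
  have hd : ∀ y, HasDerivAt (fun y => Phi (-y) - tail y) 0 y := fun y => by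
    have h1 := (hasDerivAt_Phi (-y)).comp y (hasDerivAt_neg y)
    refine (h1.sub (hasDerivAt_tail y)).congr_deriv ?_
    rw [phi_neg]; ring
  have hc : ∀ y, Phi (-y) - tail y = Phi (-x) - tail x := fun y =>
    is_const_of_deriv_eq_zero (f := fun y => Phi (-y) - tail y)
      (fun z => (hd z).differentiableAt) (fun z => (hd z).deriv) y x
  have hl : Tendsto (fun y => Phi (-y) - tail y) atTop (𝓝 (0 - 0)) :=
    ((tendsto_cdf_atBot (gaussianReal 0 1)).comp tendsto_neg_atTop_atBot).sub tendsto_tail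
  simp only [hc] at hl
  have := tendsto_nhds_unique hl tendsto_const_nhds
  linarith

theorem tail_neg (x : ℝ) : tail (-x) = Phi x := by rw [← Phi_neg, neg_neg]

/-- A function decreasing to zero is nonnegative. The bounds of Mills' ratio follow by applying this
to the difference of their sides. -/
theorem nonneg_of_deriv_nonpos {f f' : ℝ → ℝ} {a : ℝ} (hf : ∀ x, a ≤ x → HasDerivAt f (f' x) x)
    (hf' : ∀ x, a ≤ x → f' x ≤ 0) (hl : Tendsto f atTop (𝓝 0)) : 0 ≤ f a := by
  have hanti : AntitoneOn f (Set.Ici a) :=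
    antitoneOn_of_deriv_nonpos (convex_Ici a)
      (fun x hx => (hf x hx).continuousAt.continuousWithinAt)
      (fun x hx => (hf x (interior_subset hx)).differentiableAt.differentiableWithinAt)
      fun x hx => by rw [(hf x (interior_subset hx)).deriv]; exact hf' x (interior_subset hx)
  refine le_of_tendsto hl ?_
  filter_upwards [eventually_ge_atTop a] with y hy
  exact hanti (Set.mem_Ici.2 le_rfl) hy hy

theorem tendsto_phi : Tendsto phi atTop (𝓝 0) := by
  have h1 : Tendsto (fun x : ℝ => -(x ^ 2 / 2)) atTop atBot := by
    refine tendsto_neg_atTop_atBot.comp ?_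
    exact (tendsto_pow_atTop two_ne_zero).atTop_div_const two_pos
  have := (Real.tendsto_exp_atBot.comp h1).const_mul (√(2 * Real.pi))⁻¹
  rwa [mul_zero] at this

theorem tendsto_phi_mul {u : ℝ → ℝ} (hu : ∀ᶠ x in atTop, |u x| ≤ 1) :
    Tendsto (fun x => phi x * u x) atTop (𝓝 0) := by
  refine squeeze_zero_norm' ?_ tendsto_phi
  filter_upwards [hu] with x hx
  rw [Real.norm_eq_abs, abs_mul, abs_of_pos (phi_pos x)]
  exact mul_le_of_le_one_right (phi_pos x).le hx

/-- The upper bound of Mills' ratio. -/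
theorem mul_tail_le {x : ℝ} (hx : 0 ≤ x) : x * tail x ≤ phi x := by
  rcases hx.eq_or_lt with rfl | hx
  · rw [zero_mul]; exact (phi_pos 0).le
  have h := nonneg_of_deriv_nonpos (f := fun y => phi y * y⁻¹ - tail y)
    (f' := fun y => -(phi y * (y ^ 2)⁻¹)) (a := x) (fun y hy => ?_) (fun y hy => ?_) ?_
  · have := mul_le_mul_of_nonneg_left h hx.le
    rw [mul_zero, mul_sub, mul_left_comm, mul_inv_cancel₀ hx.ne'] at this
    linarith
  · have hy0 : y ≠ 0 := (hx.trans_le hy).ne'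
    refine (((hasDerivAt_phi y).mul (hasDerivAt_inv hy0)).sub (hasDerivAt_tail y)).congr_deriv ?_
    field_simp
    ring
  · have := phi_pos y
    exact neg_nonpos.2 (by positivity)
  · have h1 : Tendsto (fun y => phi y * y⁻¹) atTop (𝓝 0) := by
      refine tendsto_phi_mul ?_
      filter_upwards [eventually_ge_atTop 1] with y hy
      rw [abs_of_nonneg (by positivity)]
      exact inv_le_one_of_one_le₀ hy
    simpa using h1.sub tendsto_tail

/-- The lower bound of Mills' ratio. -/
theorem mul_phi_le (x : ℝ) : x * phi x ≤ (1 + x ^ 2) * tail x := by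
  have hpos : ∀ y : ℝ, 0 < 1 + y ^ 2 := fun y => by positivity
  have h := nonneg_of_deriv_nonpos (f := fun y => tail y - phi y * (y / (1 + y ^ 2)))
    (f' := fun y => -(2 * phi y / (1 + y ^ 2) ^ 2)) (a := x) (fun y hy => ?_) (fun y hy => ?_) ?_
  · have := mul_le_mul_of_nonneg_left h (hpos x).le
    have e : (1 + x ^ 2) * (tail x - phi x * (x / (1 + x ^ 2))) =
        (1 + x ^ 2) * tail x - x * phi x := by
      have := (hpos x).ne'
      field_simp
    rw [mul_zero, e] at this
    linarith
  · have h2 : HasDerivAt (fun y : ℝ => 1 + y ^ 2) (2 * y) y := by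
      simpa using (hasDerivAt_pow 2 y).const_add 1
    refine ((hasDerivAt_tail y).sub ((hasDerivAt_phi y).mul
      ((hasDerivAt_id y).div h2 (hpos y).ne'))).congr_deriv ?_
    have := (hpos y).ne'
    simp only [id, Pi.div_apply]
    field_simp
    ring
  · have := phi_pos y
    exact neg_nonpos.2 (by positivity)
  · have h1 : Tendsto (fun y => phi y * (y / (1 + y ^ 2))) atTop (𝓝 0) := by
      refine tendsto_phi_mul (Eventually.of_forall fun y => ?_)
      rw [abs_div, abs_of_pos (hpos y), div_le_one (hpos y), abs_le]
      constructor <;> nlinarith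
    simpa using tendsto_tail.sub h1

/-- In contrast to `mul_phi_le` this does not degenerate at zero; it gives positivity of the tail
and the bound of its inverse. -/
theorem phi_div_le_tail {x : ℝ} (hx : 0 ≤ x) : phi x / (1 + x) ≤ tail x := by
  have hpos : ∀ y, x ≤ y → 0 < 1 + y := fun y hy => by linarith
  have h := nonneg_of_deriv_nonpos (f := fun y => tail y - phi y * (1 + y)⁻¹)
    (f' := fun y => -(phi y * y / (1 + y) ^ 2)) (a := x) (fun y hy => ?_) (fun y hy => ?_) ?_
  · rw [div_eq_mul_inv]; linarith
  · have h2 : HasDerivAt (fun y : ℝ => 1 + y) 1 y := (hasDerivAt_id y).const_add 1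
    refine ((hasDerivAt_tail y).sub ((hasDerivAt_phi y).mul
      (h2.inv (hpos y hy).ne'))).congr_deriv ?_
    have := (hpos y hy).ne'
    simp only [Pi.inv_apply]
    field_simp
    ring
  · have := phi_pos y
    have := hpos y hy
    have : 0 ≤ y := hx.trans hy
    exact neg_nonpos.2 (by positivity)
  · have h1 : Tendsto (fun y => phi y * (1 + y)⁻¹) atTop (𝓝 0) := by
      refine tendsto_phi_mul ?_
      filter_upwards [eventually_ge_atTop 0] with y hy
      rw [abs_of_nonneg (by positivity)]
      exact inv_le_one_of_one_le₀ (by linarith)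
    simpa using tendsto_tail.sub h1

theorem tail_pos (x : ℝ) : 0 < tail x := by
  have h0 : ∀ y, 0 ≤ y → 0 < tail y := fun y hy =>
    (div_pos (phi_pos y) (by linarith)).trans_le (phi_div_le_tail hy)
  rcases le_total 0 x with hx | hx
  · exact h0 x hx
  · exact (h0 0 le_rfl).trans_le (sub_le_sub_left (monotone_cdf _ hx) 1)

theorem Phi_pos (x : ℝ) : 0 < Phi x := by rw [← tail_neg]; exact tail_pos _

/-- The increasing solution of `A' = 1 + x A`. -/
def millsLeft (x : ℝ) : ℝ := Phi x / phi x

/-- Mills' ratio, the decreasing solution of `B' = x B - 1`. -/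
def millsRight (x : ℝ) : ℝ := tail x / phi x

theorem millsLeft_pos (x : ℝ) : 0 < millsLeft x := div_pos (Phi_pos x) (phi_pos x)

theorem millsRight_pos (x : ℝ) : 0 < millsRight x := div_pos (tail_pos x) (phi_pos x)

theorem hasDerivAt_millsLeft (x : ℝ) : HasDerivAt millsLeft (x * millsLeft x + 1) x := by
  refine ((hasDerivAt_Phi x).div (hasDerivAt_phi x) (phi_pos x).ne').congr_deriv ?_
  have := (phi_pos x).ne'
  rw [millsLeft]
  field_simp
  ring

theorem hasDerivAt_millsRight (x : ℝ) : HasDerivAt millsRight (x * millsRight x - 1) x := by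
  refine ((hasDerivAt_tail x).div (hasDerivAt_phi x) (phi_pos x).ne').congr_deriv ?_
  have := (phi_pos x).ne'
  rw [millsRight]
  field_simp
  ring

/-- The sign of the derivative is the lower Mills bound at `-x`. -/
theorem monotone_mul_millsLeft : Monotone fun x => x * millsLeft x := by
  have hd : ∀ x, HasDerivAt (fun x => x * millsLeft x)
      (1 * millsLeft x + x * (x * millsLeft x + 1)) x := fun x =>
    (hasDerivAt_id x).mul (hasDerivAt_millsLeft x)
  refine monotone_of_deriv_nonneg (fun x => (hd x).differentiableAt) fun x => ?_
  rw [(hd x).deriv, millsLeft]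
  have h := mul_phi_le (-x)
  rw [phi_neg, tail_neg, neg_sq] at h
  have h2 := phi_pos x
  have e : 1 * (Phi x / phi x) + x * (x * (Phi x / phi x) + 1) =
      ((1 + x ^ 2) * Phi x + x * phi x) / phi x := by
    field_simp
    ring
  rw [e]
  exact div_nonneg (by linarith) h2.le

theorem monotone_mul_millsRight : Monotone fun x => x * millsRight x := by
  have hd : ∀ x, HasDerivAt (fun x => x * millsRight x)
      (1 * millsRight x + x * (x * millsRight x - 1)) x := fun x =>
    (hasDerivAt_id x).mul (hasDerivAt_millsRight x)
  refine monotone_of_deriv_nonneg (fun x => (hd x).differentiableAt) fun x => ?_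
  rw [(hd x).deriv, millsRight]
  have h := mul_phi_le x
  have h2 := phi_pos x
  have e : 1 * (tail x / phi x) + x * (x * (tail x / phi x) - 1) =
      ((1 + x ^ 2) * tail x - x * phi x) / phi x := by
    field_simp
    ring
  rw [e]
  exact div_nonneg (by linarith) h2.le

/-- The bounded solution of the Stein equation `f' x - x * f x = 1_{x ≤ t} - Φ t`. -/
def steinF (t x : ℝ) : ℝ := if x ≤ t then tail t * millsLeft x else Phi t * millsRight x

/-- The derivative of `steinF t`, with the value at `t` given by the Stein equation. -/
def steinF' (t x : ℝ) : ℝ := x * steinF t x + ((if x ≤ t then 1 else 0) - Phi t)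

theorem steinF_of_le {t x : ℝ} (h : x ≤ t) : steinF t x = tail t * millsLeft x := if_pos h

theorem steinF_of_ge {t x : ℝ} (h : t ≤ x) : steinF t x = Phi t * millsRight x := by
  rcases h.eq_or_lt with rfl | h
  · rw [steinF_of_le le_rfl, millsLeft, millsRight]; ring
  · exact if_neg (not_le.2 h)

/-- Both branches are monotone, and they agree at `t`. -/
theorem monotone_mul_steinF (t : ℝ) : Monotone fun x => x * steinF t x := by
  have h1 : ∀ x y, x ≤ y → y ≤ t → x * steinF t x ≤ y * steinF t y := fun x y hxy hy => by
    rw [steinF_of_le hy, steinF_of_le (hxy.trans hy), mul_left_comm, mul_left_comm y]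
    exact mul_le_mul_of_nonneg_left (monotone_mul_millsLeft hxy) (tail_pos t).le
  have h2 : ∀ x y, x ≤ y → t ≤ x → x * steinF t x ≤ y * steinF t y := fun x y hxy hx => by
    rw [steinF_of_ge hx, steinF_of_ge (hx.trans hxy), mul_left_comm, mul_left_comm y]
    exact mul_le_mul_of_nonneg_left (monotone_mul_millsRight hxy) (Phi_nonneg t)
  intro x y hxy
  rcases le_total y t with hy | hy
  · exact h1 x y hxy hy
  · rcases le_total x t with hx | hx
    · exact (h1 x t hx le_rfl).trans (h2 t y hy le_rfl)
    · exact h2 x y hxy hx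

/-- By the mean value theorem the slope is `c * steinF t c + tail t` at an intermediate `c`;
monotonicity of `x * steinF t x` replaces `c` by the endpoints. -/
theorem steinF_sub_left {t a b : ℝ} (hab : a ≤ b) (hb : b ≤ t) :
    (b - a) * (a * steinF t a + tail t) ≤ steinF t b - steinF t a ∧
      steinF t b - steinF t a ≤ (b - a) * (b * steinF t b + tail t) := by
  rcases hab.eq_or_lt with rfl | hab'
  · simp
  obtain ⟨c, hc, hceq⟩ := exists_hasDerivAt_eq_slope (fun x => tail t * millsLeft x)
    (fun x => tail t * (x * millsLeft x + 1)) hab'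
    (fun x _ => ((hasDerivAt_millsLeft x).const_mul _).continuousAt.continuousWithinAt)
    (fun x _ => (hasDerivAt_millsLeft x).const_mul _)
  have hba := sub_pos.2 hab'
  rw [eq_div_iff hba.ne'] at hceq
  rw [steinF_of_le hb, steinF_of_le (hab.trans hb), ← hceq]
  have h1 := mul_le_mul_of_nonneg_left (mul_le_mul_of_nonneg_left
    (monotone_mul_millsLeft hc.1.le) (tail_pos t).le) hba.le
  have h2 := mul_le_mul_of_nonneg_left (mul_le_mul_of_nonneg_left
    (monotone_mul_millsLeft hc.2.le) (tail_pos t).le) hba.le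
  constructor <;> linarith

theorem steinF_sub_right {t a b : ℝ} (hab : a ≤ b) (ha : t ≤ a) :
    (b - a) * (a * steinF t a - Phi t) ≤ steinF t b - steinF t a ∧
      steinF t b - steinF t a ≤ (b - a) * (b * steinF t b - Phi t) := by
  rcases hab.eq_or_lt with rfl | hab'
  · simp
  obtain ⟨c, hc, hceq⟩ := exists_hasDerivAt_eq_slope (fun x => Phi t * millsRight x)
    (fun x => Phi t * (x * millsRight x - 1)) hab'
    (fun x _ => ((hasDerivAt_millsRight x).const_mul _).continuousAt.continuousWithinAt)
    (fun x _ => (hasDerivAt_millsRight x).const_mul _)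
  have hba := sub_pos.2 hab'
  rw [eq_div_iff hba.ne'] at hceq
  rw [steinF_of_ge ha, steinF_of_ge (ha.trans hab), ← hceq]
  have h1 := mul_le_mul_of_nonneg_left (mul_le_mul_of_nonneg_left
    (monotone_mul_millsRight hc.1.le) (Phi_nonneg t)) hba.le
  have h2 := mul_le_mul_of_nonneg_left (mul_le_mul_of_nonneg_left
    (monotone_mul_millsRight hc.2.le) (Phi_nonneg t)) hba.le
  constructor <;> linarith

/-- The derivative is `x * steinF t x` plus a step function that drops by one at `t`. The drop only
helps here, so the correction involves the increasing part alone. -/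
theorem steinF_sub_le (t x : ℝ) {d : ℝ} (hd : 0 ≤ d) :
    steinF t (x + d) - steinF t x ≤
      d * steinF' t x + d * ((x + d) * steinF t (x + d) - x * steinF t x) := by
  have hx : x ≤ x + d := by linarith
  rcases le_total (x + d) t with h | h
  · have := (steinF_sub_left hx h).2
    rw [steinF', if_pos (hx.trans h)]
    rw [tail] at this
    linarith
  · rcases le_or_gt x t with h' | h'
    · have h1 := (steinF_sub_left h' le_rfl).2
      have h2 := (steinF_sub_right h le_rfl).2
      have h3 := mul_le_mul_of_nonneg_left (monotone_mul_steinF t h) (sub_nonneg.2 h')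
      rw [steinF', if_pos h']
      rw [tail] at h1
      simp only at h3
      linarith
    · have := (steinF_sub_right hx h'.le).2
      rw [steinF', if_neg (not_le.2 h')]
      linarith

/-- Now the drop at `t` is unfavourable and is paid for by the indicators, while the increasing part
helps. Either correction is an increment of a monotone function, as `E_std_mul_le` requires. -/
theorem le_steinF_sub (t x : ℝ) {d : ℝ} (hd : 0 ≤ d) :
    d * steinF' t x - d * ((if t < x + d then 1 else 0) - (if t < x then 1 else 0)) ≤
      steinF t (x + d) - steinF t x := by
  have hx : x ≤ x + d := by linarith
  rcases le_or_gt (x + d) t with h | h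
  · have := (steinF_sub_left hx h).1
    rw [steinF', if_pos (hx.trans h), if_neg (not_lt.2 h), if_neg (not_lt.2 (hx.trans h))]
    rw [tail] at this
    linarith
  · rcases le_or_gt x t with h' | h'
    · have h1 := (steinF_sub_left h' le_rfl).1
      have h2 := (steinF_sub_right h.le le_rfl).1
      have h3 := mul_le_mul_of_nonneg_left (monotone_mul_steinF t h') (sub_nonneg.2 h.le)
      rw [steinF', if_pos h', if_pos h, if_neg (not_lt.2 h')]
      rw [tail] at h1
      simp only at h3
      linarith
    · have := (steinF_sub_right hx h'.le).1
      rw [steinF', if_neg (not_le.2 h'), if_pos h, if_pos h']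
      linarith

end GaussianStein

end

/-! ### Exponential weights and the relative error of the tail -/

noncomputable section

namespace GaussianStein

open Finset SubgraphCount

/-- A weight that dominates the solution of the Stein equation, relative to the tail of the normal
distribution, by exponentials. -/
def weight (t x : ℝ) : ℝ :=
  1 + √(2 * Real.pi) * t * Real.exp (1 / 2) *
      ∑ j ∈ range (⌊t⌋₊ + 1), Real.exp (-((j : ℝ) ^ 2 / 2)) * Real.exp (j * x) +
    √(2 * Real.pi) * (1 + t) * (Real.exp (-(t ^ 2 / 2)) * Real.exp (t * x))

variable {t x : ℝ}

theorem inv_phi (x : ℝ) : (phi x)⁻¹ = √(2 * Real.pi) * Real.exp (x ^ 2 / 2) := by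
  rw [phi, mul_inv, inv_inv, ← Real.exp_neg, neg_neg]

theorem one_le_weight (ht : 0 ≤ t) : 1 ≤ weight t x := by
  unfold weight
  have h1 : 0 ≤ √(2 * Real.pi) * t * Real.exp (1 / 2) *
      ∑ j ∈ range (⌊t⌋₊ + 1), Real.exp (-((j : ℝ) ^ 2 / 2)) * Real.exp (j * x) :=
    mul_nonneg (by positivity) (sum_nonneg fun j _ => by positivity)
  have h2 : 0 ≤ √(2 * Real.pi) * (1 + t) * (Real.exp (-(t ^ 2 / 2)) * Real.exp (t * x)) := by
    positivity
  linarith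

/-- With `j = ⌊x⌋₊`, the inequality `(x - j) ^ 2 ≤ 1` gives `x ^ 2 / 2 ≤ 1 / 2 - j ^ 2 / 2 + j * x`.
Thus exponentials with parameters `j ≤ t` dominate the Gaussian growth on `[0, t]`. -/
theorem one_add_div_phi_le_weight (hx : 0 ≤ x) (hxt : x ≤ t) : 1 + x / phi x ≤ weight t x := by
  have ht := hx.trans hxt
  have h2 : 0 ≤ √(2 * Real.pi) * (1 + t) * (Real.exp (-(t ^ 2 / 2)) * Real.exp (t * x)) := by
    positivity
  have h1 : Real.exp (x ^ 2 / 2) ≤ Real.exp (1 / 2) *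
      ∑ j ∈ range (⌊t⌋₊ + 1), Real.exp (-((j : ℝ) ^ 2 / 2)) * Real.exp (j * x) := by
    have hmem : ⌊x⌋₊ ∈ range (⌊t⌋₊ + 1) :=
      mem_range.2 (Nat.lt_succ_of_le (Nat.floor_le_floor hxt))
    have := single_le_sum (f := fun j : ℕ => Real.exp (-((j : ℝ) ^ 2 / 2)) * Real.exp (j * x))
      (fun j _ => by positivity) hmem
    refine le_trans ?_ (mul_le_mul_of_nonneg_left this (Real.exp_pos _).le)
    rw [← Real.exp_add, ← Real.exp_add]
    refine Real.exp_le_exp.2 ?_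
    have a1 := Nat.floor_le hx
    have a2 := Nat.lt_floor_add_one x
    nlinarith
  have h3 : x / phi x ≤ √(2 * Real.pi) * t * Real.exp (1 / 2) *
      ∑ j ∈ range (⌊t⌋₊ + 1), Real.exp (-((j : ℝ) ^ 2 / 2)) * Real.exp (j * x) := by
    rw [div_eq_mul_inv, inv_phi]
    calc x * (√(2 * Real.pi) * Real.exp (x ^ 2 / 2))
        ≤ t * (√(2 * Real.pi) * (Real.exp (1 / 2) *
          ∑ j ∈ range (⌊t⌋₊ + 1), Real.exp (-((j : ℝ) ^ 2 / 2)) * Real.exp (j * x))) := by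
          gcongr
      _ = _ := by ring
  unfold weight
  linarith

theorem inv_tail_le (ht : 0 ≤ t) :
    (tail t)⁻¹ ≤ √(2 * Real.pi) * (1 + t) * Real.exp (t ^ 2 / 2) := by
  have h1 := phi_div_le_tail ht
  have h2 := phi_pos t
  refine (inv_anti₀ (by positivity) h1).trans_eq ?_
  rw [inv_div, div_eq_mul_inv, inv_phi]
  ring

/-- At `x = t` the last summand of `weight` is the bound of `inv_tail_le`, and it increases with
`x`. -/
theorem one_le_tail_mul_weight (ht : 0 ≤ t) (hx : t < x) : 1 ≤ tail t * weight t x := by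
  have h1 := inv_tail_le ht
  have hp := tail_pos t
  rw [← mul_inv_cancel₀ hp.ne']
  refine mul_le_mul_of_nonneg_left (h1.trans ?_) hp.le
  have h2 : 0 ≤ √(2 * Real.pi) * t * Real.exp (1 / 2) *
      ∑ j ∈ range (⌊t⌋₊ + 1), Real.exp (-((j : ℝ) ^ 2 / 2)) * Real.exp (j * x) :=
    mul_nonneg (by positivity) (sum_nonneg fun j _ => by positivity)
  have h3 : √(2 * Real.pi) * (1 + t) * Real.exp (t ^ 2 / 2) ≤
      √(2 * Real.pi) * (1 + t) * (Real.exp (-(t ^ 2 / 2)) * Real.exp (t * x)) := by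
    rw [← Real.exp_add]
    refine mul_le_mul_of_nonneg_left (Real.exp_le_exp.2 ?_) (by positivity)
    nlinarith
  unfold weight
  linarith

theorem indicator_le_tail_mul_weight (ht : 0 ≤ t) (x : ℝ) :
    (if t < x then 1 else 0) ≤ tail t * weight t x := by
  split_ifs with h
  · exact one_le_tail_mul_weight ht h
  · exact mul_nonneg (tail_pos t).le (zero_le_one.trans (one_le_weight ht))

theorem mul_millsRight_le_one (hx : 0 ≤ x) : x * millsRight x ≤ 1 := by
  rw [millsRight, ← mul_div_assoc]
  exact (div_le_one (phi_pos x)).2 (mul_tail_le hx)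

theorem neg_one_le_mul_millsLeft (hx : x ≤ 0) : -1 ≤ x * millsLeft x := by
  have h := mul_tail_le (neg_nonneg.2 hx)
  rw [tail_neg, phi_neg] at h
  rw [millsLeft, ← mul_div_assoc, le_div_iff₀ (phi_pos x)]
  linarith

/-- For `x ≤ 0` Mills' bound gives a multiple of `tail t`; on `[0, t]` the growth is that of `x /
phi x`; beyond `t` both quantities are at most one, which is at most `tail t * weight t x`. -/
theorem abs_steinF_bounds (ht : 0 ≤ t) (x : ℝ) :
    |x * steinF t x| ≤ tail t * weight t x ∧ |steinF' t x| ≤ tail t * weight t x := by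
  have hp := tail_pos t
  rw [steinF']
  rcases le_or_gt x t with h | h
  · rw [if_pos h, steinF_of_le h, show x * (tail t * millsLeft x) + (1 - Phi t) =
      tail t * (x * millsLeft x + 1) by rw [tail]; ring,
      show x * (tail t * millsLeft x) = tail t * (x * millsLeft x) by ring, abs_mul (tail t),
      abs_mul (tail t), abs_of_pos hp]
    suffices hs : |x * millsLeft x| ≤ weight t x ∧ |x * millsLeft x + 1| ≤ weight t x from
      ⟨mul_le_mul_of_nonneg_left hs.1 hp.le, mul_le_mul_of_nonneg_left hs.2 hp.le⟩
    rcases le_total x 0 with h0 | h0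
    · have h1 := neg_one_le_mul_millsLeft h0
      have h2 := mul_nonpos_of_nonpos_of_nonneg h0 (millsLeft_pos x).le
      have h3 := one_le_weight (x := x) ht
      rw [abs_of_nonpos h2, abs_of_nonneg (by linarith)]
      constructor <;> linarith
    · have h1 : x * millsLeft x ≤ x / phi x := by
        rw [millsLeft, ← mul_div_assoc]
        exact div_le_div_of_nonneg_right (mul_le_of_le_one_right h0 (Phi_le_one x)) (phi_pos x).le
      have h2 := mul_nonneg h0 (millsLeft_pos x).le
      have h3 := one_add_div_phi_le_weight h0 h
      rw [abs_of_nonneg h2, abs_of_nonneg (by linarith)]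
      constructor <;> linarith
  · have h0 : 0 ≤ x := ht.trans h.le
    have h1 := mul_millsRight_le_one h0
    have h2 := mul_nonneg h0 (millsRight_pos x).le
    have h3 := one_le_tail_mul_weight ht h
    have h4 := Phi_le_one t
    have h5 := Phi_nonneg t
    rw [if_neg (not_le.2 h), steinF_of_ge h.le, show x * (Phi t * millsRight x) =
      Phi t * (x * millsRight x) by ring, show Phi t * (x * millsRight x) + (0 - Phi t) =
      -(Phi t * (1 - x * millsRight x)) by ring, abs_neg, abs_of_nonneg (mul_nonneg h5 h2),
      abs_of_nonneg (mul_nonneg h5 (sub_nonneg.2 h1))]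
    refine ⟨(mul_le_one₀ h4 h2 h1).trans h3, (mul_le_one₀ h4 (sub_nonneg.2 h1) ?_).trans h3⟩
    linarith

/-- The left-hand side arises from `weight` when each normalized exponential is replaced by at most
`1 + t` and the sum over `j` has at most `t + 1` terms. -/
theorem weight_polynomial_le (ht : 0 ≤ t) :
    1 + √(2 * Real.pi) * t * Real.exp (1 / 2) * ((t + 1) * (1 + t)) +
      √(2 * Real.pi) * (1 + t) * (1 + t) ≤ 15 * (1 + t ^ 3) := by
  have h1 : √(2 * Real.pi) ≤ 251 / 100 := by
    rw [Real.sqrt_le_left (by norm_num)]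
    have := Real.pi_lt_d2
    norm_num at *
    linarith
  have h2 : Real.exp (1 / 2) ≤ 165 / 100 := by
    have h3 : Real.exp (1 / 2) ^ 2 = Real.exp 1 := by rw [← Real.exp_nat_mul]; norm_num
    have := Real.exp_one_lt_d9
    refine le_of_sq_le_sq ?_ (by norm_num)
    rw [h3]
    norm_num at *
    linarith
  calc 1 + √(2 * Real.pi) * t * Real.exp (1 / 2) * ((t + 1) * (1 + t)) +
      √(2 * Real.pi) * (1 + t) * (1 + t)
      ≤ 1 + 251 / 100 * t * (165 / 100) * ((t + 1) * (1 + t)) + 251 / 100 * (1 + t) * (1 + t) := by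
        gcongr
    _ ≤ 15 * (1 + t ^ 3) := by
        nlinarith [mul_nonneg ht (sq_nonneg (t - 1)), sq_nonneg (t - 1),
          mul_nonneg (by linarith : 0 ≤ t + 2) (sq_nonneg (t - 1))]

end GaussianStein

namespace RandomSubset

open Finset GaussianStein

variable {ι C : Type*} [DecidableEq ι] [Fintype C] [Fintype ι]

/-- The factors `exp (-θ ^ 2 / 2)` in `weight` cancel the Gaussian growth in the hypothesis, leaving
a cubic polynomial in `t`. -/
theorem E_abs_mul_weight_le {p K t : ℝ} {F X : Finset ι → ℝ} (ht : 0 ≤ t) (hK : 0 ≤ K)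
    (hF : ∀ θ, 0 ≤ θ → θ ≤ t → E p (fun ω => |F ω| * Real.exp (θ * X ω)) ≤
      K * ((1 + θ) * Real.exp (θ ^ 2 / 2))) :
    E p (fun ω => |F ω| * weight t (X ω)) ≤ K * (15 * (1 + t ^ 3)) := by
  have e1 : (fun ω => |F ω| * weight t (X ω)) = fun ω => (|F ω| * Real.exp (0 * X ω) +
      √(2 * Real.pi) * t * Real.exp (1 / 2) * ∑ j ∈ range (⌊t⌋₊ + 1),
        Real.exp (-((j : ℝ) ^ 2 / 2)) * (|F ω| * Real.exp (j * X ω))) +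
      √(2 * Real.pi) * (1 + t) * (Real.exp (-(t ^ 2 / 2)) *
        (|F ω| * Real.exp (t * X ω))) := by
    funext ω
    simp only [weight, mul_left_comm _ |F ω|, ← mul_sum]
    rw [zero_mul, Real.exp_zero]
    ring
  have cancel : ∀ y : ℝ, Real.exp (-(y ^ 2 / 2)) * (K * ((1 + y) * Real.exp (y ^ 2 / 2))) =
      K * (1 + y) := fun y => by
    have : Real.exp (-(y ^ 2 / 2)) * Real.exp (y ^ 2 / 2) = 1 := by rw [← Real.exp_add]; simp
    linear_combination K * (1 + y) * this
  have hx0 : E p (fun ω => |F ω| * Real.exp (0 * X ω)) ≤ K :=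
    (hF 0 le_rfl ht).trans_eq (by norm_num)
  have hxt : Real.exp (-(t ^ 2 / 2)) * E p (fun ω => |F ω| * Real.exp (t * X ω)) ≤
      K * (1 + t) := by
    rw [← cancel t]
    exact mul_le_mul_of_nonneg_left (hF t ht le_rfl) (Real.exp_pos _).le
  have hxj : ∑ j ∈ range (⌊t⌋₊ + 1), Real.exp (-((j : ℝ) ^ 2 / 2)) *
      E p (fun ω => |F ω| * Real.exp (j * X ω)) ≤ K * ((t + 1) * (1 + t)) := by
    have hj : ∀ j ∈ range (⌊t⌋₊ + 1), Real.exp (-((j : ℝ) ^ 2 / 2)) *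
        E p (fun ω => |F ω| * Real.exp (j * X ω)) ≤ K * (1 + t) := fun j hj => by
      have hjt : (j : ℝ) ≤ t := (Nat.le_floor_iff ht).1 (Nat.lt_succ_iff.1 (mem_range.1 hj))
      refine (mul_le_mul_of_nonneg_left (hF j j.cast_nonneg hjt) (Real.exp_pos _).le).trans ?_
      rw [cancel]
      gcongr
    refine (sum_le_sum hj).trans ?_
    rw [sum_const, card_range, nsmul_eq_mul, mul_left_comm]
    push_cast
    have := Nat.floor_le ht
    gcongr
  rw [e1, E_add, E_add, E_const_mul, E_const_mul, E_const_mul, E_sum]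
  simp only [E_const_mul]
  have hpoly := mul_le_mul_of_nonneg_left (weight_polynomial_le ht) hK
  have a1 := mul_le_mul_of_nonneg_left hxj
    (by positivity : 0 ≤ √(2 * Real.pi) * t * Real.exp (1 / 2))
  have a2 := mul_le_mul_of_nonneg_left hxt (by positivity : 0 ≤ √(2 * Real.pi) * (1 + t))
  linarith

namespace IsRegular

variable {S : C → Finset ι} {p D R κ : ℝ} {e : ℕ} (h : IsRegular S p e D R κ) [Nonempty C]
include h

theorem abs_E_mul_le {t : ℝ} {F G X : Finset ι → ℝ}
    (hG : ∀ ω, |G ω| ≤ tail t * weight t (X ω)) :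
    |E p (fun ω => F ω * G ω)| ≤ tail t * E p (fun ω => |F ω| * weight t (X ω)) := by
  refine (abs_E_le h.p_pos.le h.p_lt_one.le _).trans ?_
  rw [← E_const_mul]
  refine E_mono h.p_pos.le h.p_lt_one.le fun ω => ?_
  rw [abs_mul, mul_left_comm]
  exact mul_le_mul_of_nonneg_left (hG ω) (abs_nonneg _)

/-- Stein's method: the relative error of the normal approximation of the tail. -/
theorem abs_E_indicator_sub_tail_le {t : ℝ} (ht : 0 ≤ t) :
    |E p (fun ω => if t < std S p e ω then 1 else 0) - tail t| ≤
      tail t * (E p (fun ω => |steinT S p e ω| * weight t (std S p e ω)) +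
        E p (fun ω => |steinQ S p e ω| * weight t (std S p e ω))) := by
  have hb := abs_steinF_bounds ht
  have h1 := h.E_std_mul_le (f := steinF t) (f' := steinF' t) (g := fun x => x * steinF t x)
    (monotone_mul_steinF t) (fun x d hd => steinF_sub_le t x hd)
  -- The reverse inequality comes from the negated solution, whose derivative jumps upward; the
  -- indicator serves as `g`.
  have h2 := h.E_std_mul_le (f := fun x => -steinF t x) (f' := fun x => -steinF' t x)
    (g := fun x => if t < x then 1 else 0)
    (fun x y hxy => by
      dsimp only
      split_ifs with a b
      · exact le_rfl
      · exact absurd (a.trans_le hxy) b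
      · exact zero_le_one
      · exact le_rfl)
    (fun x d hd => by linarith [le_steinF_sub t x hd])
  -- The Stein equation, averaged.
  have e1 : E p (fun ω => steinF' t (std S p e ω)) -
      E p (fun ω => std S p e ω * steinF t (std S p e ω)) =
      tail t - E p (fun ω => if t < std S p e ω then 1 else 0) := by
    rw [← E_sub, ← E_const (ι := ι) p (tail t), ← E_sub]
    congr 1
    funext ω
    rw [steinF', tail]
    rcases le_or_gt (std S p e ω) t with a | a
    · rw [if_pos a, if_neg (not_lt.2 a)]; ring
    · rw [if_neg (not_le.2 a), if_pos a]; ring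
  have hn : ∀ X : Finset ι → ℝ, E p (fun ω => -X ω) = -E p X := fun X => by
    have := E_const_mul p (-1) X
    simpa using this
  simp only [mul_neg, hn] at h2
  have bT := abs_le.1 (h.abs_E_mul_le (F := steinT S p e) (X := std S p e) fun ω => (hb _).2)
  have bQ := abs_le.1 (h.abs_E_mul_le (F := steinQ S p e) (X := std S p e) fun ω => (hb _).1)
  have bI := abs_le.1 (h.abs_E_mul_le (F := steinQ S p e) (X := std S p e)
    (G := fun ω => if t < std S p e ω then 1 else 0) fun ω => by
      rw [abs_of_nonneg (by split_ifs <;> norm_num)]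
      exact indicator_le_tail_mul_weight ht _)
  rw [abs_le, mul_add]
  constructor <;> linarith

/-- The relative error of the normal approximation of the tail of a regular family. -/
theorem abs_tail_div_sub_one_le (hδ : √(R / ((1 - p) * Fintype.card C)) ≤ 1) {t B : ℝ}
    (hB : B = 29 / 4 * (e * κ * √(R / ((1 - p) * Fintype.card C))) *
      Real.exp (3 * (D * t / √(var S p e)))) (ht : 0 ≤ t) :
    |E p (fun ω => if t < std S p e ω then 1 else 0) / tail t - 1| ≤
      30 * (B * Real.exp (B * t ^ 2 * (1 + t))) * (1 + t ^ 3) := by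
  have hp := tail_pos t
  have hB0 := h.bound_nonneg hδ hB
  have key : ∀ {Y : C × C → Finset ι → ℝ}, IsCentredPairFamily S p e Y →
      E p (fun ω => |p ^ e / var S p e * ∑ α ∈ pairs S, Y α ω| * weight t (std S p e ω)) ≤
      B * Real.exp (B * t ^ 2 * (1 + t)) * (15 * (1 + t ^ 3)) := fun hY =>
    E_abs_mul_weight_le ht (by positivity) fun θ hθ hθt =>
      h.E_abs_stein_mul_exp_le_exp hδ hB hY hθ hθt
  have kT := key h.isCentredPairFamily_pairT
  have kQ := key h.isCentredPairFamily_pairQ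
  rw [div_sub_one hp.ne', abs_div, abs_of_pos hp, div_le_iff₀ hp]
  refine (h.abs_E_indicator_sub_tail_le ht).trans ?_
  rw [mul_comm (tail t)]
  refine mul_le_mul_of_nonneg_right ?_ hp.le
  simp only [steinT, steinQ]
  linarith

end IsRegular

end RandomSubset

end

/-! ### Counting embeddings -/

noncomputable section

namespace SubgraphCount

open Finset RandomSubset

section Embeddings

variable {V N : Type*} [Fintype V] [DecidableEq V] [Fintype N] [DecidableEq N]

/-- The restriction of an embedding to a set. -/
def res (A : Finset V) (φ : V ↪ N) : {x // x ∈ A} ↪ N := (Function.Embedding.subtype _).trans φ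

/-- An embedding consists of its restriction to `A` and of an embedding of the complement of `A`. -/
def resEquiv (A : Finset V) :
    (V ↪ N) ≃ Σ f : {x // x ∈ A} ↪ N, {x // x ∉ A} ↪ ↥(Set.range f)ᶜ :=
  (Equiv.embeddingCongr (Equiv.sumCompl (· ∈ A)).symm (Equiv.refl N)).trans
    Equiv.sumEmbeddingEquivSigmaEmbeddingRestricted

theorem resEquiv_fst (A : Finset V) (φ : V ↪ N) : (resEquiv A φ).1 = res A φ := by
  ext x
  rfl

/-- Every injection of `A` extends in the same number of ways, so a condition on the restriction
factors out. -/
theorem card_filter_res (A : Finset V) (P : ({x // x ∈ A} ↪ N) → Prop) [DecidablePred P] :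
    #(univ.filter fun φ : V ↪ N => P (res A φ)) =
      #(univ.filter P) * (Fintype.card N - #A).descFactorial (Fintype.card V - #A) := by
  classical
  have h1 : ∀ f : {x // x ∈ A} ↪ N, Fintype.card ({x // x ∉ A} ↪ ↥(Set.range f)ᶜ) =
      (Fintype.card N - #A).descFactorial (Fintype.card V - #A) := fun f => by
    rw [Fintype.card_embedding_eq, Fintype.card_compl_set, Fintype.card_subtype_compl,
      Set.card_range_of_injective f.injective, Fintype.card_coe]
  have h2 : univ.filter (fun φ : V ↪ N => P (res A φ)) =
      ((univ.filter P).sigma fun _ => univ).map (resEquiv A).symm.toEmbedding := by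
    ext φ
    simp only [mem_filter_univ, mem_map_equiv, Equiv.symm_symm, mem_sigma, mem_univ, and_true,
      resEquiv_fst]
  rw [h2, card_map, card_sigma]
  simp only [card_univ, h1, sum_const, smul_eq_mul]

theorem card_embedding_eq_mul (A : Finset V) :
    Fintype.card (V ↪ N) = (Fintype.card N).descFactorial #A *
      (Fintype.card N - #A).descFactorial (Fintype.card V - #A) := by
  have := card_filter_res (N := N) A fun _ => True
  simpa [Fintype.card_embedding_eq] using this

theorem card_filter_res_mem (A : Finset V) (U : Finset N) :
    #(univ.filter fun φ : V ↪ N => ∀ x ∈ A, φ x ∈ U) = (#U).descFactorial #A *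
      (Fintype.card N - #A).descFactorial (Fintype.card V - #A) := by
  classical
  have h := card_filter_res (N := N) A fun f => ∀ x, f x ∈ (U : Set N)
  have h2 : #(univ.filter fun f : {x // x ∈ A} ↪ N => ∀ x, f x ∈ (U : Set N)) =
      (#U).descFactorial #A := by
    rw [← Fintype.card_subtype, Fintype.card_congr (Equiv.codRestrict _ (U : Set N)),
      Fintype.card_embedding_eq]
    simp
  rw [h2] at h
  rw [← h]
  congr 1
  ext φ
  simp [res]

theorem card_filter_res_eq (A : Finset V) (φ₀ : V ↪ N) :
    #(univ.filter fun φ : V ↪ N => ∀ x ∈ A, φ x = φ₀ x) =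
      (Fintype.card N - #A).descFactorial (Fintype.card V - #A) := by
  have h := card_filter_res (N := N) A fun f => f = res A φ₀
  rw [filter_eq' univ, if_pos (mem_univ _), card_singleton, one_mul] at h
  rw [← h]
  congr 1
  ext φ
  simp only [mem_filter_univ, DFunLike.ext_iff]
  exact ⟨fun hx x => hx x.1 x.2, fun hx x hxA => hx ⟨x, hxA⟩⟩

theorem card_filter_pair_eq_le {a b : V} (hab : a ≠ b) (c d : N) :
    #(univ.filter fun φ : V ↪ N => φ a = c ∧ φ b = d) ≤
      (Fintype.card N - 2).descFactorial (Fintype.card V - 2) := by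
  rcases (univ.filter fun φ : V ↪ N => φ a = c ∧ φ b = d).eq_empty_or_nonempty with h | ⟨φ₀, h⟩
  · rw [h]; simp
  · rw [mem_filter_univ] at h
    have h2 := card_filter_res_eq {a, b} φ₀
    rw [card_pair hab] at h2
    rw [← h2]
    refine card_le_card fun φ hφ => ?_
    simp only [mem_filter_univ, mem_insert, mem_singleton, forall_eq_or_imp, forall_eq] at hφ ⊢
    rwa [h.1, h.2]

end Embeddings

/-- Pair the factors of the two factorials in opposite order: `(i + 1) * (v - i) ≥ v`. -/
theorem pow_self_le_factorial_sq (v : ℕ) : v ^ v ≤ v.factorial ^ 2 := by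
  have h1 := prod_range_add_one_eq_factorial v
  have h2 := prod_range_reflect (fun i => i + 1) v
  rw [h1] at h2
  rw [sq]
  nth_rewrite 1 [← h1]
  rw [← h2, ← prod_mul_distrib]
  calc v ^ v = ∏ _i ∈ range v, v := by simp
    _ ≤ _ := prod_le_prod' fun i hi => by
      have hi := mem_range.1 hi
      obtain ⟨k, rfl⟩ : ∃ k, v = i + 1 + k := ⟨v - (i + 1), by omega⟩
      rw [show i + 1 + k - 1 - i + 1 = k + 1 by omega]
      nlinarith

/-- The falling factorial is at least `(n - j) ^ j ≥ n ^ j * (1 - j ^ 2 / n)` by Bernoulli, and `4 *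
j ^ 2 ≤ n`. -/
theorem pow_le_mul_descFactorial {n v j : ℕ} (hn : 4 * v ^ 2 ≤ n) (hj : j ≤ v) :
    (n : ℝ) ^ j ≤ 4 / 3 * (n.descFactorial j : ℝ) := by
  rcases j.eq_zero_or_pos with rfl | hj0
  · norm_num
  have hn' : 4 * (v : ℝ) ^ 2 ≤ n := by exact_mod_cast hn
  have hjv : (j : ℝ) ≤ v := by exact_mod_cast hj
  have hj1 : (1 : ℝ) ≤ j := by exact_mod_cast hj0
  have hjn : 4 * (j : ℝ) ^ 2 ≤ n := by nlinarith
  have hn0 : (0 : ℝ) < n := by nlinarith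
  have hjn' : j ≤ n := by
    have : (j : ℝ) ≤ n := by nlinarith
    exact_mod_cast this
  have h1 : ((n : ℝ) - j) ^ j ≤ n.descFactorial j := by
    have := Nat.pow_sub_le_descFactorial n j
    have h2 : (n - j) ^ j ≤ n.descFactorial j := (Nat.pow_le_pow_left (by omega) j).trans this
    have h3 : ((n - j : ℕ) : ℝ) ^ j ≤ n.descFactorial j := by exact_mod_cast h2
    rwa [Nat.cast_sub hjn'] at h3
  have h2 := one_add_mul_le_pow (a := -((j : ℝ) / n)) (by
    have : (j : ℝ) / n ≤ 1 := (div_le_one hn0).2 (by exact_mod_cast hjn')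
    linarith) j
  have h3 : (3 : ℝ) / 4 ≤ 1 + j * -((j : ℝ) / n) := by
    have : (j : ℝ) * (j / n) ≤ 1 / 4 := by
      rw [← mul_div_assoc, div_le_div_iff₀ hn0 (by norm_num)]
      nlinarith
    linarith
  have h4 : ((n : ℝ) - j) ^ j = n ^ j * (1 + -((j : ℝ) / n)) ^ j := by
    rw [← mul_pow]
    congr 1
    field_simp
    ring
  have h5 := mul_le_mul_of_nonneg_left (h3.trans h2) (pow_nonneg hn0.le j)
  rw [← h4] at h5
  linarith

end SubgraphCount

end

/-! ### Weights of embedded graphs in terms of `psiMin` -/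

noncomputable section

namespace SubgraphCount

open Finset RandomSubset

universe v

variable {V : Type v} [Fintype V] [DecidableEq V] (G₀ : SimpleGraph V) {n : ℕ} {p : ℝ}

/-- The edges of `G₀`. -/
def edges : Finset (Sym2 V) := (Set.toFinite G₀.edgeSet).toFinset

/-- The edges of the image of `G₀` under an embedding of its vertices. -/
def imgEdges {N : Type*} (φ : V ↪ N) : Finset (Sym2 N) := (edges G₀).map φ.sym2Map

/-- The vertices covered by a set of edges. -/
def supp (H : Finset (Sym2 V)) : Finset V := univ.filter fun a => ∃ x ∈ H, a ∈ x

theorem mem_edges {x : Sym2 V} : x ∈ edges G₀ ↔ x ∈ G₀.edgeSet := by simp [edges]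

theorem card_edges : #(edges G₀) = numEdges G₀ := (Set.ncard_eq_toFinset_card _).symm

theorem card_imgEdges {N : Type*} (φ : V ↪ N) : #(imgEdges G₀ φ) = numEdges G₀ := by
  rw [imgEdges, card_map, card_edges]

theorem mem_supp {H : Finset (Sym2 V)} {a : V} : a ∈ supp H ↔ ∃ x ∈ H, a ∈ x := by simp [supp]

theorem card_supp_le (H : Finset (Sym2 V)) : #(supp H) ≤ 2 * #H := by
  have : supp H = H.biUnion fun x => x.toFinset := by
    ext a; simp [mem_supp]
  rw [this, mul_comm]
  refine card_biUnion_le_card_mul _ _ _ fun x _ => ?_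
  rw [Sym2.card_toFinset]
  split_ifs <;> norm_num

/-- The edges in `H` with the vertices they cover form a subgraph that competes in the minimum. -/
theorem psiMin_le {H : Finset (Sym2 V)} (hH : H ⊆ edges G₀) (hne : H.Nonempty) :
    psiMin G₀ n p ≤ (n : ℝ) ^ #(supp H) * p ^ #H := by
  let K : G₀.Subgraph :=
    { verts := supp H
      Adj := fun a b => s(a, b) ∈ H
      adj_sub := fun h => (mem_edges G₀).1 (hH h)
      edge_vert := fun {a b} h => by
        rw [mem_coe, mem_supp]; exact ⟨_, h, Sym2.mem_mk_left a b⟩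
      symm := ⟨fun a b h => by rw [Sym2.eq_swap]; exact h⟩ }
  have hK : K.edgeSet = (H : Set (Sym2 V)) := by
    ext x
    induction x using Sym2.ind with
    | _ a b => exact Iff.rfl
  have hc : K.edgeSet.ncard = #H := by rw [hK, Set.ncard_coe_finset]
  have hv : K.verts.ncard = #(supp H) := Set.ncard_coe_finset _
  have := ciInf_le (f := fun H : {H : G₀.Subgraph // 1 ≤ H.edgeSet.ncard} =>
    (n : ℝ) ^ H.1.verts.ncard * p ^ H.1.edgeSet.ncard) (Set.finite_range _).bddBelow
    ⟨K, by rw [hc]; exact hne.card_pos⟩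
  refine le_trans this ?_
  simp only [hc, hv, le_refl]

theorem exists_psiMin_eq (hG₀ : G₀.edgeSet.Nonempty) (n : ℕ) (p : ℝ) :
    ∃ H : G₀.Subgraph, 1 ≤ H.edgeSet.ncard ∧
      psiMin G₀ n p = (n : ℝ) ^ H.verts.ncard * p ^ H.edgeSet.ncard := by
  have : Nonempty {H : G₀.Subgraph // 1 ≤ H.edgeSet.ncard} := ⟨⟨⊤, by
    rw [Nat.one_le_iff_ne_zero, ← Nat.pos_iff_ne_zero, Set.ncard_pos (Set.toFinite _),
      SimpleGraph.Subgraph.edgeSet_top]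
    exact hG₀⟩⟩
  obtain ⟨H, hH⟩ := exists_eq_ciInf_of_finite
    (f := fun H : {H : G₀.Subgraph // 1 ≤ H.edgeSet.ncard} =>
      (n : ℝ) ^ H.1.verts.ncard * p ^ H.1.edgeSet.ncard)
  exact ⟨H.1, H.2, hH.symm⟩

theorem psiMin_pos (hG₀ : G₀.edgeSet.Nonempty) (hn : 0 < n) (hp : 0 < p) :
    0 < psiMin G₀ n p := by
  obtain ⟨H, -, h⟩ := exists_psiMin_eq G₀ hG₀ n p
  rw [h]
  have : (0 : ℝ) < n := by exact_mod_cast hn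
  positivity

theorem imgEdges_inter (φ : V ↪ Fin n) (A : Finset (Sym2 (Fin n))) :
    imgEdges G₀ φ ∩ A = ((edges G₀).filter fun x => φ.sym2Map x ∈ A).map φ.sym2Map := by
  rw [imgEdges, ← filter_mem_eq_inter, filter_map]
  rfl

/-- The number of embeddings that map the vertices of `H` to `U`, weighted by `p ^ (-|H|)`. -/
theorem card_mul_inv_pow_le (hp : 0 < p)
    (hn : 4 * numVertices G₀ ^ 2 ≤ n) (hψ : 0 < psiMin G₀ n p) {H : Finset (Sym2 V)}
    (hH : H ⊆ edges G₀) (hne : H.Nonempty) {U : Finset (Fin n)} {X : ℝ}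
    (hX : ((#U).descFactorial #(supp H) : ℝ) ≤ X) :
    p⁻¹ ^ #H * #(univ.filter fun φ : V ↪ Fin n => ∀ a ∈ supp H, φ a ∈ U) ≤
      4 / 3 * X * (Fintype.card (V ↪ Fin n) / psiMin G₀ n p) := by
  have h1 := psiMin_le G₀ (n := n) (p := p) hH hne
  have h2 := pow_le_mul_descFactorial hn (card_le_univ (supp H) : #(supp H) ≤ numVertices G₀)
  rw [card_filter_res_mem, card_embedding_eq_mul (supp H), Fintype.card_fin]
  set j := #(supp H)
  set E := (n - j).descFactorial (Fintype.card V - j)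
  push_cast
  have hX0 : 0 ≤ X := (Nat.cast_nonneg _).trans hX
  have h3 : p⁻¹ ^ #H ≤ (n : ℝ) ^ j / psiMin G₀ n p := by
    rw [le_div_iff₀ hψ, inv_pow, inv_mul_le_iff₀ (pow_pos hp _), mul_comm]
    exact h1
  calc p⁻¹ ^ #H * (((#U).descFactorial j : ℝ) * (E : ℝ))
      ≤ (4 / 3 * (n.descFactorial j : ℝ) / psiMin G₀ n p) * (X * (E : ℝ)) := by
        gcongr
        exact h3.trans (div_le_div_of_nonneg_right h2 hψ.le)
    _ = _ := by ring

/-- The upper bound of `wt`. -/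
theorem wt_le_of_support (hp : 0 < p)
    (hn : 4 * numVertices G₀ ^ 2 ≤ n) (hψ : 0 < psiMin G₀ n p)
    {A : Finset (Sym2 (Fin n))} {U : Finset (Fin n)} (hAU : ∀ x ∈ A, ∀ a ∈ x, a ∈ U) {X : ℝ}
    (hX : ∀ j, j ≤ numVertices G₀ → j ≤ 2 * numEdges G₀ → ((#U).descFactorial j : ℝ) ≤ X) :
    wt (imgEdges G₀) p A ≤
      2 ^ numEdges G₀ * (4 / 3 * X * (Fintype.card (V ↪ Fin n) / psiMin G₀ n p)) := by
  -- Each embedding is charged to the nonempty set of edges that it maps into `A`. The vertices of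
  -- these edges go to `U`, and there are at most `2 ^ e` such sets.
  set pre : (V ↪ Fin n) → Finset (Sym2 V) :=
    fun φ => (edges G₀).filter fun x => φ.sym2Map x ∈ A with hpre
  have hterm : ∀ φ ∈ hits (imgEdges G₀) A, p⁻¹ ^ #(imgEdges G₀ φ ∩ A) ≤
      ∑ H ∈ (edges G₀).powerset.filter (·.Nonempty),
        if ∀ a ∈ supp H, φ a ∈ U then p⁻¹ ^ #H else 0 := fun φ hφ => by
    have hc : #(imgEdges G₀ φ ∩ A) = #(pre φ) := by rw [imgEdges_inter, card_map]
    have hmem : pre φ ∈ (edges G₀).powerset.filter (·.Nonempty) := by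
      rw [mem_filter, mem_powerset]
      refine ⟨filter_subset _ _, ?_⟩
      rw [← card_pos, ← hc, card_pos, ← not_disjoint_iff_nonempty_inter]
      exact mem_hits.1 hφ
    have hU : ∀ a ∈ supp (pre φ), φ a ∈ U := fun a ha => by
      obtain ⟨x, hx, hax⟩ := mem_supp.1 ha
      exact hAU _ (mem_filter.1 hx).2 _ (Sym2.mem_map.2 ⟨a, hax, rfl⟩)
    have := single_le_sum (f := fun H => if ∀ a ∈ supp H, φ a ∈ U then p⁻¹ ^ #H else 0)
      (fun H _ => by
        split_ifs
        · positivity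
        · exact le_rfl) hmem
    rw [if_pos hU] at this
    rwa [hc]
  have hX0 : 0 ≤ X := (Nat.cast_nonneg _).trans (hX 0 (Nat.zero_le _) (Nat.zero_le _))
  rw [wt]
  refine (sum_le_sum hterm).trans ((sum_le_sum_of_subset_of_nonneg (subset_univ _)
    fun φ _ _ => sum_nonneg fun H _ => ?_).trans ?_)
  · split_ifs
    · positivity
    · exact le_rfl
  rw [sum_comm]
  have hbound : ∀ H ∈ (edges G₀).powerset.filter (·.Nonempty),
      (∑ φ : V ↪ Fin n, if ∀ a ∈ supp H, φ a ∈ U then p⁻¹ ^ #H else 0) ≤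
      4 / 3 * X * (Fintype.card (V ↪ Fin n) / psiMin G₀ n p) := fun H hH => by
    rw [mem_filter, mem_powerset] at hH
    rw [← sum_filter, sum_const, nsmul_eq_mul, mul_comm]
    refine card_mul_inv_pow_le G₀ hp hn hψ hH.1 hH.2 (hX _ (card_le_univ _) ?_)
    refine (card_supp_le H).trans (Nat.mul_le_mul_left 2 ?_)
    rw [← card_edges]
    exact card_le_card hH.1
  refine (sum_le_sum hbound).trans ?_
  rw [sum_const, nsmul_eq_mul]
  have hcard : (#((edges G₀).powerset.filter (·.Nonempty)) : ℝ) ≤ 2 ^ numEdges G₀ := by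
    have := card_filter_le (edges G₀).powerset (·.Nonempty)
    rw [card_powerset, card_edges] at this
    exact_mod_cast this
  have : 0 ≤ psiMin G₀ n p := hψ.le
  gcongr

/-- The vertices of the image of an embedding. -/
def imgVerts (φ : V ↪ Fin n) : Finset (Fin n) := univ.map φ

theorem mem_imgVerts {φ : V ↪ Fin n} {x : Sym2 (Fin n)} (hx : x ∈ imgEdges G₀ φ) {a : Fin n}
    (ha : a ∈ x) : a ∈ imgVerts φ := by
  obtain ⟨y, -, rfl⟩ := mem_map.1 hx
  obtain ⟨b, -, rfl⟩ := Sym2.mem_map.1 ha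
  exact mem_map_of_mem _ (mem_univ b)

/-- `U` is the vertex set of one image, and the falling factorials of `v` are at most `v!`. -/
theorem wt_imgEdges_le (hp : 0 < p) (hn : 4 * numVertices G₀ ^ 2 ≤ n)
    (hψ : 0 < psiMin G₀ n p) (φ : V ↪ Fin n) :
    wt (imgEdges G₀) p (imgEdges G₀ φ) ≤ 4 / 3 * 2 ^ numEdges G₀ * (numVertices G₀).factorial *
      (Fintype.card (V ↪ Fin n) / psiMin G₀ n p) := by
  refine (wt_le_of_support G₀ hp hn hψ (U := imgVerts φ)
    (X := (numVertices G₀).factorial) (fun x hx a ha => mem_imgVerts G₀ hx ha)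
    fun j hj _ => ?_).trans_eq (by ring)
  rw [imgVerts, card_map, card_univ]
  have := Nat.factorial_mul_descFactorial hj
  rw [← this]
  push_cast
  exact le_mul_of_one_le_left (Nat.cast_nonneg _) (by exact_mod_cast Nat.factorial_pos _)

/-- Three images have at most `3 * v` vertices. Since `j` is at most `2 * e` and at most `v`, one
has `(3 * v) ^ j ≤ 9 ^ e * v ^ v`, and `v ^ v` is at most `v! ^ 2`. -/
theorem wt_union_imgEdges_le (hp : 0 < p) (hn : 4 * numVertices G₀ ^ 2 ≤ n)
    (hv : 0 < numVertices G₀) (hψ : 0 < psiMin G₀ n p) (φ₁ φ₂ φ₃ : V ↪ Fin n) :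
    wt (imgEdges G₀) p (imgEdges G₀ φ₁ ∪ imgEdges G₀ φ₂ ∪ imgEdges G₀ φ₃) ≤
      4 / 3 * 18 ^ numEdges G₀ * (numVertices G₀).factorial ^ 2 *
      (Fintype.card (V ↪ Fin n) / psiMin G₀ n p) := by
  refine (wt_le_of_support G₀ hp hn hψ (U := imgVerts φ₁ ∪ imgVerts φ₂ ∪ imgVerts φ₃)
    (X := 9 ^ numEdges G₀ * (numVertices G₀).factorial ^ 2) (fun x hx a ha => ?_)
    fun j hj hj2 => ?_).trans_eq ?_
  · simp only [mem_union] at hx ⊢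
    rcases hx with (hx | hx) | hx
    · exact Or.inl (Or.inl (mem_imgVerts G₀ hx ha))
    · exact Or.inl (Or.inr (mem_imgVerts G₀ hx ha))
    · exact Or.inr (mem_imgVerts G₀ hx ha)
  · have hU : #(imgVerts φ₁ ∪ imgVerts φ₂ ∪ imgVerts φ₃) ≤ 3 * numVertices G₀ := by
      have hc : ∀ φ : V ↪ Fin n, #(imgVerts φ) = numVertices G₀ := fun φ => by
        rw [imgVerts, card_map, card_univ, numVertices]
      have h1 := card_union_le (imgVerts φ₁ ∪ imgVerts φ₂) (imgVerts φ₃)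
      have h2 := card_union_le (imgVerts φ₁) (imgVerts φ₂)
      simp only [hc] at h1 h2
      omega
    have : (#(imgVerts φ₁ ∪ imgVerts φ₂ ∪ imgVerts φ₃)).descFactorial j ≤
        9 ^ numEdges G₀ * (numVertices G₀).factorial ^ 2 :=
      calc _ ≤ (#(imgVerts φ₁ ∪ imgVerts φ₂ ∪ imgVerts φ₃)) ^ j := Nat.descFactorial_le_pow _ _
        _ ≤ (3 * numVertices G₀) ^ j := Nat.pow_le_pow_left hU j
        _ = 3 ^ j * numVertices G₀ ^ j := mul_pow _ _ _
        _ ≤ 3 ^ (2 * numEdges G₀) * numVertices G₀ ^ numVertices G₀ :=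
          Nat.mul_le_mul (Nat.pow_le_pow_right (by norm_num) hj2) (Nat.pow_le_pow_right hv hj)
        _ ≤ 9 ^ numEdges G₀ * (numVertices G₀).factorial ^ 2 := by
          rw [pow_mul]
          exact Nat.mul_le_mul_left _ (pow_self_le_factorial_sq _)
    exact_mod_cast this
  · rw [show (18 : ℝ) = 2 * 9 by norm_num, mul_pow]
    ring

/-- The lower bound of `wt`. -/
theorem le_wt_imgEdges (hG₀ : G₀.edgeSet.Nonempty) (hn0 : 0 < n) (hp : 0 < p) (hp1 : p ≤ 1)
    (φ₀ : V ↪ Fin n) :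
    Fintype.card (V ↪ Fin n) / psiMin G₀ n p ≤ wt (imgEdges G₀) p (imgEdges G₀ φ₀) := by
  have hψ := psiMin_pos G₀ hG₀ hn0 hp
  -- It suffices to keep the embeddings that agree with `φ₀` on the vertices of a minimizing
  -- subgraph.
  obtain ⟨H, hH, hHψ⟩ := exists_psiMin_eq G₀ hG₀ n p
  set A : Finset V := (Set.toFinite H.verts).toFinset with hA
  set K : Finset (Sym2 V) := (Set.toFinite H.edgeSet).toFinset with hK
  have hAc : H.verts.ncard = #A := Set.ncard_eq_toFinset_card _
  have hKc : H.edgeSet.ncard = #K := Set.ncard_eq_toFinset_card _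
  rw [hAc, hKc] at hHψ
  rw [hKc] at hH
  have hsub : ∀ φ ∈ univ.filter (fun φ : V ↪ Fin n => ∀ x ∈ A, φ x = φ₀ x),
      K.map φ₀.sym2Map ⊆ imgEdges G₀ φ ∩ imgEdges G₀ φ₀ := fun φ hφ y hy => by
    obtain ⟨x, hx, rfl⟩ := mem_map.1 hy
    have hxE : x ∈ edges G₀ := by
      rw [mem_edges]
      exact H.edgeSet_subset ((Set.Finite.mem_toFinset _).1 hx)
    refine mem_inter.2 ⟨mem_map.2 ⟨x, hxE, ?_⟩, mem_map_of_mem _ hxE⟩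
    change Sym2.map φ x = Sym2.map φ₀ x
    refine Sym2.map_congr fun a ha => ?_
    refine (mem_filter.1 hφ).2 a ?_
    rw [hA, Set.Finite.mem_toFinset]
    exact H.mem_verts_of_mem_edge ((Set.Finite.mem_toFinset _).1 hx) ha
  have hinv : 1 ≤ p⁻¹ := (one_le_inv₀ hp).2 hp1
  have h1 : (#(univ.filter (fun φ : V ↪ Fin n => ∀ x ∈ A, φ x = φ₀ x)) : ℝ) * p⁻¹ ^ #K ≤
      wt (imgEdges G₀) p (imgEdges G₀ φ₀) := by
    rw [← nsmul_eq_mul, ← sum_const, wt]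
    refine (sum_le_sum fun φ hφ => pow_le_pow_right₀ hinv ?_).trans
      (sum_le_sum_of_subset_of_nonneg (fun φ hφ => ?_) fun φ _ _ => by positivity)
    · rw [← card_map φ₀.sym2Map]
      exact card_le_card (hsub φ hφ)
    · rw [mem_hits, not_disjoint_iff_nonempty_inter, ← card_pos]
      exact (by rw [card_map]; omega : 0 < #(K.map φ₀.sym2Map)).trans_le
        (card_le_card (hsub φ hφ))
  refine le_trans ?_ h1
  rw [card_filter_res_eq, card_embedding_eq_mul A, Fintype.card_fin, hHψ]
  push_cast
  have h2 : (n.descFactorial #A : ℝ) ≤ (n : ℝ) ^ #A := by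
    exact_mod_cast Nat.descFactorial_le_pow n #A
  have hnR : (0 : ℝ) < n := by exact_mod_cast hn0
  rw [div_le_iff₀ (by positivity), inv_pow]
  rw [show ∀ x : ℝ, x * (p ^ #K)⁻¹ * ((n : ℝ) ^ #A * p ^ #K) =
    (n : ℝ) ^ #A * x * (p ^ #K * (p ^ #K)⁻¹) from fun x => by ring,
    mul_inv_cancel₀ (pow_pos hp _).ne', mul_one]
  exact mul_le_mul_of_nonneg_right h2 (Nat.cast_nonneg _)

/-- By symmetry, all embeddings have the same `wt`. -/
theorem wt_imgEdges_eq (φ φ' : V ↪ Fin n) :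
    wt (imgEdges G₀) p (imgEdges G₀ φ) = wt (imgEdges G₀) p (imgEdges G₀ φ') := by
  -- A permutation of the vertices carrying `φ` to `φ'` permutes the index set of the sum and
  -- preserves intersections.
  let g : {x // x ∈ Set.range φ} ≃ {x // x ∈ Set.range φ'} :=
    (Equiv.ofInjective φ φ.injective).symm.trans (Equiv.ofInjective φ' φ'.injective)
  let π : Equiv.Perm (Fin n) := g.extendSubtype
  have hπ : ∀ a, π (φ a) = φ' a := fun a => by
    have : π (φ a) = g ⟨φ a, a, rfl⟩ := Equiv.extendSubtype_apply_of_mem _ _ _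
    rw [this]
    have e1 : (⟨φ a, a, rfl⟩ : {x // x ∈ Set.range φ}) = Equiv.ofInjective φ φ.injective a := rfl
    rw [e1]
    simp [g]
  let T : (V ↪ Fin n) ≃ (V ↪ Fin n) := Equiv.embeddingCongr (Equiv.refl V) π
  have hT : ∀ ψ a, T ψ a = π (ψ a) := fun ψ a => rfl
  have himg : ∀ ψ, imgEdges G₀ (T ψ) = (imgEdges G₀ ψ).map π.toEmbedding.sym2Map := fun ψ => by
    rw [imgEdges, imgEdges, map_map]
    congr 1
    exact Function.Embedding.ext fun x => (Sym2.map_map (g := π) (f := ψ) x).symm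
  have hTφ : T φ = φ' := by ext a; rw [hT, hπ]
  rw [← hTφ, wt, wt]
  refine sum_equiv T (fun ψ => ?_) fun ψ _ => ?_
  · rw [mem_hits, mem_hits, himg, himg, disjoint_map]
  · rw [himg, himg, ← map_inter, card_map]

end SubgraphCount

end

/-! ### Copies as embeddings modulo automorphisms -/

noncomputable section

namespace SubgraphCount

open Finset RandomSubset

universe v

variable {V : Type v} (G₀ : SimpleGraph V) {n : ℕ}

/-- The isomorphisms from `G₀` onto a subgraph are the copies of `G₀` with this image. -/
theorem card_copy_toSubgraph_eq {W : Type*} {G : SimpleGraph W} {Γ : G.Subgraph}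
    (h : Nonempty (G₀ ≃g Γ.coe)) :
    Nat.card {f : G₀.Copy G // f.toSubgraph = Γ} = numAut G₀ := by
  obtain ⟨e₀⟩ := h
  let T : (G₀ ≃g G₀) → {f : G₀.Copy G // f.toSubgraph = Γ} := fun e =>
    ⟨Γ.coeCopy.comp (SimpleGraph.Iso.toCopy (e.trans e₀)), by
      have := SimpleGraph.Subgraph.map_comp (⊤ : G₀.Subgraph) (SimpleGraph.Iso.toHom (e.trans e₀)) Γ.hom
      refine this.trans ?_
      simp⟩
  refine (Nat.card_eq_of_bijective T ⟨fun e e' hee => ?_, ?_⟩).symm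
  · refine RelIso.ext fun a => e₀.injective (Subtype.ext ?_)
    exact DFunLike.congr_fun (congrArg Subtype.val hee) a
  · rintro ⟨f, rfl⟩
    refine ⟨f.isoToSubgraph.trans e₀.symm, Subtype.ext (SimpleGraph.Copy.ext fun a => ?_)⟩
    change ((e₀ (e₀.symm (f.isoToSubgraph a)) : f.toSubgraph.verts) : W) = f a
    rw [RelIso.apply_symm_apply]
    rfl

variable [Fintype V] [DecidableEq V]

theorem not_isDiag_of_mem_imgEdges {φ : V ↪ Fin n} {x : Sym2 (Fin n)}
    (hx : x ∈ imgEdges G₀ φ) : ¬ x.IsDiag := by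
  obtain ⟨y, hy, rfl⟩ := mem_map.1 hx
  have := G₀.not_isDiag_of_mem_edgeSet ((mem_edges G₀).1 hy)
  change ¬ (Sym2.map φ y).IsDiag
  rwa [Sym2.isDiag_map φ.injective]

/-- The embeddings of the vertices of `G₀` that map the edges of `G₀` to edges of `G` are the
copies of `G₀` in `G`. -/
def copyOfEmbedding {G : SimpleGraph (Fin n)} (φ : V ↪ Fin n)
    (h : ∀ x ∈ imgEdges G₀ φ, x ∈ G.edgeSet) : G₀.Copy G where
  toHom := ⟨φ, fun {a b} hab => h s(φ a, φ b) (mem_map.2 ⟨s(a, b), (mem_edges G₀).2 hab, rfl⟩)⟩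
  injective' := φ.injective

theorem edgeSet_toSubgraph {G : SimpleGraph (Fin n)} (f : G₀.Copy G) :
    f.toSubgraph.edgeSet = (imgEdges G₀ f.toEmbedding : Set (Sym2 (Fin n))) := by
  rw [SimpleGraph.Subgraph.edgeSet_map, SimpleGraph.Subgraph.edgeSet_top, imgEdges, coe_map]
  congr 1
  ext x
  exact (mem_edges G₀).symm

/-- Every subgraph isomorphic to `G₀` is the image of `numAut G₀` embeddings. -/
theorem card_filter_embedding_eq (G : SimpleGraph (Fin n)) (P : Finset (Sym2 (Fin n)) → Prop)
    [DecidablePred P] [DecidablePred fun φ : V ↪ Fin n =>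
      (∀ x ∈ imgEdges G₀ φ, x ∈ G.edgeSet) ∧ P (imgEdges G₀ φ)] :
    #(univ.filter fun φ : V ↪ Fin n =>
      (∀ x ∈ imgEdges G₀ φ, x ∈ G.edgeSet) ∧ P (imgEdges G₀ φ)) =
    numAut G₀ * {Γ : G.Subgraph | Nonempty (G₀ ≃g Γ.coe) ∧
      ∃ A : Finset (Sym2 (Fin n)), (A : Set (Sym2 (Fin n))) = Γ.edgeSet ∧ P A}.ncard := by
  classical
  have hfin : Finite (G₀.Copy G) := DFunLike.finite _
  let _ : Fintype (G₀.Copy G) := Fintype.ofFinite _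
  set t := {Γ : G.Subgraph | Nonempty (G₀ ≃g Γ.coe) ∧
      ∃ A : Finset (Sym2 (Fin n)), (A : Set (Sym2 (Fin n))) = Γ.edgeSet ∧ P A} with ht
  have h1 : #(univ.filter fun φ : V ↪ Fin n =>
      (∀ x ∈ imgEdges G₀ φ, x ∈ G.edgeSet) ∧ P (imgEdges G₀ φ)) =
      #(univ.filter fun f : G₀.Copy G => P (imgEdges G₀ f.toEmbedding)) := by
    refine card_bij (fun φ hφ => copyOfEmbedding G₀ φ (mem_filter.1 hφ).2.1) (fun φ hφ => ?_)
      (fun φ hφ φ' hφ' h => ?_) fun f hf => ?_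
    · exact mem_filter.2 ⟨mem_univ _, (mem_filter.1 hφ).2.2⟩
    · exact Function.Embedding.ext fun a => DFunLike.congr_fun h a
    · refine ⟨f.toEmbedding, mem_filter.2 ⟨mem_univ _, fun x hx => ?_, (mem_filter.1 hf).2⟩, rfl⟩
      rw [← mem_coe, ← edgeSet_toSubgraph] at hx
      exact f.toSubgraph.edgeSet_subset hx
  rw [h1, Set.ncard_eq_toFinset_card t (Set.toFinite t),
    card_eq_sum_card_fiberwise (f := SimpleGraph.Copy.toSubgraph)
      (t := (Set.toFinite t).toFinset), sum_const_nat (m := numAut G₀), mul_comm]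
  · intro Γ hΓ
    obtain ⟨hΓ, A, hA, hPA⟩ := (Set.Finite.mem_toFinset _).1 hΓ
    rw [← card_copy_toSubgraph_eq G₀ hΓ, Nat.card_eq_fintype_card, Fintype.card_subtype,
      filter_filter]
    congr 1
    refine filter_congr fun f _ => and_iff_right_of_imp ?_
    rintro rfl
    rw [edgeSet_toSubgraph, coe_inj] at hA
    rwa [← hA]
  · intro f hf
    rw [mem_coe, Set.Finite.mem_toFinset]
    exact ⟨⟨f.isoToSubgraph⟩, _, (edgeSet_toSubgraph G₀ f).symm, (mem_filter.1 hf).2⟩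

/-- The random subset of edges, as a graph. -/
def graphOf (ω : Finset (Sym2 (Fin n))) : SimpleGraph (Fin n) :=
  SimpleGraph.fromEdgeSet (ω : Set (Sym2 (Fin n)))

/-- The random set may contain loops, but no image of an edge is a loop, so they affect neither
side. -/
theorem num_imgEdges (ω : Finset (Sym2 (Fin n))) :
    num (imgEdges G₀) ω = numAut G₀ * count G₀ n (graphOf ω) := by
  classical
  have h := card_filter_embedding_eq G₀ (graphOf ω) (fun _ => True)
  have h1 : {Γ : (graphOf ω).Subgraph | Nonempty (G₀ ≃g Γ.coe) ∧
      ∃ A : Finset (Sym2 (Fin n)), (A : Set (Sym2 (Fin n))) = Γ.edgeSet ∧ True}.ncard =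
      (graphOf ω).copyCount G₀ := by
    rw [SimpleGraph.copyCount, ← Set.ncard_coe_finset]
    congr 1
    ext Γ
    simp only [Set.mem_ofPred_eq, coe_filter, mem_univ, true_and, and_true]
    exact and_iff_left ⟨(Set.toFinite Γ.edgeSet).toFinset, by simp⟩
  rw [h1] at h
  rw [count, ← Nat.cast_mul, ← h, num, card_filter, Nat.cast_sum]
  refine sum_congr rfl fun φ _ => ?_
  rw [ind, Nat.cast_ite, Nat.cast_one, Nat.cast_zero]
  congr 1
  refine propext ⟨fun hs => ⟨fun x hx => ?_, trivial⟩, fun hs x hx => ?_⟩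
  · rw [graphOf, SimpleGraph.edgeSet_fromEdgeSet]
    exact ⟨hs hx, not_isDiag_of_mem_imgEdges G₀ hx⟩
  · have := hs.1 x hx
    rw [graphOf, SimpleGraph.edgeSet_fromEdgeSet] at this
    exact this.1

/-- The same correspondence, `numAut G₀` to one, inside the complete graph. -/
theorem card_hits_imgEdges (φ₀ : V ↪ Fin n) :
    #(hits (imgEdges G₀) (imgEdges G₀ φ₀)) = numAut G₀ * degree G₀ n := by
  classical
  let f₀ : G₀.Copy (⊤ : SimpleGraph (Fin n)) :=
    ⟨⟨φ₀, fun {a b} hab => fun h => hab.ne (φ₀.injective h)⟩, φ₀.injective⟩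
  have h := card_filter_embedding_eq G₀ (⊤ : SimpleGraph (Fin n))
    (fun A => ¬ Disjoint A (imgEdges G₀ φ₀))
  rw [← ncard_neighborhood_eq_degree G₀ (Γ := f₀.toSubgraph) ⟨f₀.isoToSubgraph⟩]
  convert h using 2
  · ext φ
    rw [mem_hits, mem_filter, and_iff_right (mem_univ φ), and_iff_right]
    intro x hx
    rw [SimpleGraph.edgeSet_top]
    exact not_isDiag_of_mem_imgEdges G₀ hx
  · congr 1
    ext Γ
    refine and_congr_right fun _ => ?_
    rw [edgeSet_toSubgraph]
    constructor
    · rintro ⟨x, hx, hx'⟩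
      exact ⟨(Set.toFinite Γ.edgeSet).toFinset, by simp, not_disjoint_iff.2 ⟨x, by simpa using hx', hx⟩⟩
    · rintro ⟨A, hA, hd⟩
      obtain ⟨x, hx, hx'⟩ := not_disjoint_iff.1 hd
      exact ⟨x, hx', by rw [← hA]; exact hx⟩

end SubgraphCount

end

/-! ### Transfer to the binomial random graph -/

noncomputable section

namespace SubgraphCount

open Finset RandomSubset

universe v

variable {V : Type v} {n : ℕ}

theorem measurableSingletonClass_simpleGraph (W : Type*) [Finite W] :
    MeasurableSingletonClass (SimpleGraph W) where
  measurableSet_singleton G := by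
    rw [← SimpleGraph.measurableEmbedding_edgeSet.measurableSet_image, Set.image_singleton]
    exact measurableSet_singleton _

/-- The probability of each graph, in terms of random sets of edges. -/
theorem binomialRandom_real_singleton (p : unitInterval) (G : SimpleGraph (Fin n))
    [DecidablePred fun ω : Finset (Sym2 (Fin n)) => graphOf ω = G] :
    (SimpleGraph.binomialRandom (Fin n) p).real {G} =
      E (p : ℝ) (fun ω => if graphOf ω = G then 1 else 0) := by
  classical
  set A : Finset (Sym2 (Fin n)) := (Set.toFinite G.edgeSet).toFinset with hA
  -- The graph determines only the non-loops: those in `A` are present, those in `N \ A` absent.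
  -- Loops stay free and sum out.
  set N : Finset (Sym2 (Fin n)) := univ.filter fun x => ¬ x.IsDiag with hN
  have hAN : A ⊆ N := fun x hx => by
    rw [hN, mem_filter]
    exact ⟨mem_univ x, G.not_isDiag_of_mem_edgeSet ((Set.Finite.mem_toFinset _).1 hx)⟩
  have hsplit : (fun ω => if graphOf ω = G then (1 : ℝ) else 0) =
      fun ω => ind A ω * if Disjoint (N \ A) ω then 1 else 0 := by
    funext ω
    rw [ind, ite_zero_mul_ite_zero, mul_one]
    refine if_congr ?_ rfl rfl
    rw [← SimpleGraph.edgeSet_inj, graphOf, SimpleGraph.edgeSet_fromEdgeSet]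
    have hmem : ∀ x, x ∈ A ↔ x ∈ G.edgeSet := fun x => Set.Finite.mem_toFinset _
    have hmemN : ∀ x, x ∈ N ↔ ¬ x.IsDiag := fun x => by simp [hN]
    rw [Set.ext_iff, disjoint_left]
    simp only [Set.mem_sdiff, ← hmem, mem_coe]
    constructor
    · intro h
      refine ⟨fun x hx => ((h x).2 hx).1, fun x hx hxω => ?_⟩
      rw [mem_sdiff, hmemN] at hx
      exact hx.2 ((h x).1 ⟨hxω, hx.1⟩)
    · rintro ⟨h1, h2⟩ x
      refine ⟨fun hx => ?_, fun hx => ⟨h1 hx, (hmemN x).1 (hAN hx)⟩⟩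
      by_contra hxA
      exact h2 (mem_sdiff.2 ⟨(hmemN x).2 hx.2, hxA⟩) hx.1
  have hNcard : #N = n.choose 2 := by
    have := Sym2.card_subtype_not_diag (α := Fin n)
    rw [Fintype.card_subtype, Fintype.card_fin] at this
    exact this
  rw [hsplit, E_mul_of_indep (p : ℝ) A (fun ω => ind_inter_of_subset (Subset.refl A) ω), E_ind,
    E_disjoint, card_sdiff_of_subset hAN, hNcard, measureReal_def,
    SimpleGraph.binomialRandom_singleton, Set.ncard_eq_toFinset_card G.edgeSet, Nat.card_fin]
  · simp [hA]
  · intro ω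
    refine if_congr ?_ rfl rfl
    rw [disjoint_left, disjoint_left]
    refine forall₂_congr fun x hx => ?_
    rw [mem_sdiff] at hx ⊢
    simp [hx.2]

/-- Expectations over the random graph are expectations over random sets of edges. -/
theorem integral_binomialRandom (p : unitInterval) (F : SimpleGraph (Fin n) → ℝ) :
    ∫ G, F G ∂(SimpleGraph.binomialRandom (Fin n) p) =
      E (p : ℝ) (fun ω => F (graphOf ω)) := by
  classical
  have := measurableSingletonClass_simpleGraph (Fin n)
  rw [integral_fintype .of_finite]
  simp only [binomialRandom_real_singleton, smul_eq_mul]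
  simp only [← E_mul_const, ← E_sum]
  congr 1
  funext ω
  rw [sum_eq_single_of_mem (graphOf ω) (mem_univ _), if_pos rfl, one_mul]
  intro G _ hG
  rw [if_neg hG.symm, zero_mul]

theorem binomialRandom_real (p : unitInterval) (P : SimpleGraph (Fin n) → Prop)
    [DecidablePred P] :
    (SimpleGraph.binomialRandom (Fin n) p).real {G | P G} =
      E (p : ℝ) (fun ω => if P (graphOf ω) then 1 else 0) := by
  have := measurableSingletonClass_simpleGraph (Fin n)
  rw [← integral_binomialRandom p (fun G => if P G then 1 else 0),
    ← integral_indicator_one (Set.toFinite _).measurableSet]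
  refine integral_congr_ae (.of_forall fun G => ?_)
  simp [Set.indicator_apply]

variable [Fintype V] [DecidableEq V] (G₀ : SimpleGraph V)

theorem numAut_pos : 0 < numAut G₀ := by
  have : Finite (G₀ ≃g G₀) := DFunLike.finite _
  exact Nat.card_pos

theorem numAut_le : numAut G₀ ≤ (numVertices G₀).factorial := by
  have h : Function.Injective (fun f : G₀ ≃g G₀ => f.toEquiv) := RelIso.toEquiv_injective
  have := Nat.card_le_card_of_injective _ h
  rwa [Nat.card_perm, Nat.card_eq_fintype_card (α := V)] at this

variable {p : unitInterval} {D R κ : ℝ}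

theorem count_graphOf (ω : Finset (Sym2 (Fin n))) :
    count G₀ n (graphOf ω) = num (imgEdges G₀) ω / numAut G₀ := by
  have : (numAut G₀ : ℝ) ≠ 0 := by exact_mod_cast (numAut_pos G₀).ne'
  rw [num_imgEdges, mul_div_cancel_left₀ _ this]

theorem integral_count
    (h : IsRegular (imgEdges (N := Fin n) G₀) (p : ℝ) (numEdges G₀) D R κ) :
    ∫ G, count G₀ n G ∂(SimpleGraph.binomialRandom (Fin n) p) =
      mean (V ↪ Fin n) p (numEdges G₀) / numAut G₀ := by
  rw [integral_binomialRandom]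
  simp only [count_graphOf, div_eq_mul_inv]
  rw [E_mul_const, ← h.E_num]

theorem sigma_eq
    (h : IsRegular (imgEdges (N := Fin n) G₀) (p : ℝ) (numEdges G₀) D R κ) :
    sigma G₀ n p = √(var (imgEdges (N := Fin n) G₀) p (numEdges G₀)) / numAut G₀ := by
  have := measurableSingletonClass_simpleGraph (Fin n)
  rw [sigma, variance_eq_integral (measurable_of_finite _).aemeasurable, integral_count G₀ h,
    integral_binomialRandom, ← h.E_num_sub_sq]
  simp only [count_graphOf, ← sub_div, div_pow]
  simp only [div_eq_mul_inv]
  rw [E_mul_const, ← div_eq_mul_inv, ← div_eq_mul_inv, Real.sqrt_div' _ (sq_nonneg _),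
    Real.sqrt_sq (Nat.cast_nonneg _)]

/-- The factor `numAut G₀` divides both the centred count and the standard deviation, and cancels.
-/
theorem W_graphOf
    (h : IsRegular (imgEdges (N := Fin n) G₀) (p : ℝ) (numEdges G₀) D R κ)
    (ω : Finset (Sym2 (Fin n))) :
    W G₀ n p (graphOf ω) = std (imgEdges G₀) p (numEdges G₀) ω := by
  have : (numAut G₀ : ℝ) ≠ 0 := by exact_mod_cast (numAut_pos G₀).ne'
  rw [W, integral_count G₀ h, sigma_eq G₀ h, count_graphOf, ← sub_div,
    div_div_div_cancel_right₀ this, std]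

theorem binomialRandom_real_lt_W
    (h : IsRegular (imgEdges (N := Fin n) G₀) (p : ℝ) (numEdges G₀) D R κ) (t : ℝ) :
    (SimpleGraph.binomialRandom (Fin n) p).real {G | t < W G₀ n p G} =
      E (p : ℝ) (fun ω => if t < std (imgEdges (N := Fin n) G₀) p (numEdges G₀) ω then 1 else 0) := by
  classical
  rw [binomialRandom_real]
  simp only [W_graphOf G₀ h]

/-- The number of embeddings that share an edge with a given one. -/
theorem card_hits_imgEdges_le (φ₀ : V ↪ Fin n) :
    #(hits (imgEdges G₀) (imgEdges G₀ φ₀)) ≤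
      2 * numEdges G₀ ^ 2 * (n - 2).descFactorial (Fintype.card V - 2) := by
  -- A shared edge is the image of `x` under `φ` and of `y` under `φ₀`. This fixes two values of `φ`
  -- up to orientation, hence the factor two.
  set F : Sym2 V → Sym2 V → Finset (V ↪ Fin n) := fun x y =>
    univ.filter fun φ => φ.sym2Map x = φ₀.sym2Map y with hF
  have hsub : hits (imgEdges G₀) (imgEdges G₀ φ₀) ⊆
      (edges G₀ ×ˢ edges G₀).biUnion fun xy => F xy.1 xy.2 := fun φ hφ => by
    obtain ⟨z, hz, hz'⟩ := not_disjoint_iff.1 (mem_hits.1 hφ)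
    obtain ⟨x, hx, rfl⟩ := mem_map.1 hz
    obtain ⟨y, hy, hxy⟩ := mem_map.1 hz'
    exact mem_biUnion.2 ⟨(x, y), mem_product.2 ⟨hx, hy⟩, mem_filter.2 ⟨mem_univ _, hxy.symm⟩⟩
  refine (card_le_card hsub).trans ((card_biUnion_le_card_mul _ _
    (2 * (n - 2).descFactorial (Fintype.card V - 2)) ?_).trans_eq ?_)
  · rintro ⟨x, y⟩ hxy
    have hx := (mem_edges G₀).1 (mem_product.1 hxy).1
    induction x using Sym2.ind with
    | _ a b =>
    induction y using Sym2.ind with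
    | _ c d =>
    have hab : a ≠ b := SimpleGraph.Adj.ne hx
    have : F s(a, b) s(c, d) ⊆
        (univ.filter fun φ : V ↪ Fin n => φ a = φ₀ c ∧ φ b = φ₀ d) ∪
        (univ.filter fun φ : V ↪ Fin n => φ a = φ₀ d ∧ φ b = φ₀ c) := fun φ hφ => by
      have h : s(φ a, φ b) = s(φ₀ c, φ₀ d) := (mem_filter.1 hφ).2
      rw [Sym2.eq_iff] at h
      simpa using h
    refine (card_le_card this).trans ((card_union_le _ _).trans ?_)
    have h1 := card_filter_pair_eq_le hab (φ₀ c) (φ₀ d)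
    have h2 := card_filter_pair_eq_le hab (φ₀ d) (φ₀ c)
    rw [Fintype.card_fin] at h1 h2
    omega
  · rw [card_product, card_edges]
    ring

end SubgraphCount

end

/-! ### Constants and conclusion -/

noncomputable section

namespace SubgraphCount

open Finset RandomSubset

universe v

variable {V : Type v} [Fintype V] [DecidableEq V] (G₀ : SimpleGraph V) {n : ℕ}

/-- The constant in the upper bound of `wt` for one copy of `G₀`. -/
def oneConst : ℝ := 4 / 3 * 2 ^ numEdges G₀ * (numVertices G₀).factorial

/-- The constant in the upper bound of `wt` for unions of three copies of `G₀`. -/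
def threeConst : ℝ := 4 / 3 * 18 ^ numEdges G₀ * (numVertices G₀).factorial ^ 2

theorem one_le_factorial : (1 : ℝ) ≤ (numVertices G₀).factorial := by
  exact_mod_cast Nat.one_le_iff_ne_zero.2 (Nat.factorial_ne_zero _)

theorem oneConst_pos : 0 < oneConst G₀ := by
  have := one_le_factorial G₀
  unfold oneConst
  positivity

theorem one_le_threeConst : 1 ≤ threeConst G₀ := by
  have h1 := one_le_factorial G₀
  have h2 : (1 : ℝ) ≤ 18 ^ numEdges G₀ := one_le_pow₀ (by norm_num)
  have h3 := one_le_mul_of_one_le_of_one_le h2 (one_le_pow₀ h1 (n := 2))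
  unfold threeConst
  linarith

theorem cConst_nonneg : 0 ≤ cConst G₀ := by
  unfold cConst
  positivity

theorem cHat_nonneg : 0 ≤ cHat G₀ := by
  unfold cHat
  positivity

theorem cConst_sq : cConst G₀ ^ 2 = 2 ^ (9 + 15 * numEdges G₀) *
    (numVertices G₀).factorial ^ 8 * numEdges G₀ ^ 2 / numAut G₀ ^ 3 := by
  have h1 : ((2 : ℝ) ^ ((9 / 2 : ℝ) + (15 / 2 : ℝ) * (numEdges G₀ : ℝ))) ^ 2 =
      2 ^ (9 + 15 * numEdges G₀) := by
    rw [← Real.rpow_natCast, ← Real.rpow_mul zero_le_two, ← Real.rpow_natCast]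
    congr 1
    push_cast
    ring
  have h2 : ((numAut G₀ : ℝ) ^ (3 / 2 : ℝ)) ^ 2 = (numAut G₀ : ℝ) ^ 3 := by
    rw [← Real.rpow_natCast, ← Real.rpow_mul (Nat.cast_nonneg _), ← Real.rpow_natCast]
    congr 1
    norm_num
  rw [cConst, div_pow, mul_pow, mul_pow, h1, h2]
  ring

/-- Squares are compared. The bound needs `(29 / 4) ^ 2 * (4 / 3) ^ 3 ≤ 2 ^ 9`, `18 ^ 2 * 2 ≤ 2 ^
15`, and that the number of automorphisms is at most `v!`. -/
theorem le_cConst : 29 / 4 * (numEdges G₀ * threeConst G₀) * √(oneConst G₀) ≤ cConst G₀ := by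
  refine le_of_sq_le_sq ?_ (cConst_nonneg G₀)
  have ha0 : (0 : ℝ) < numAut G₀ := by exact_mod_cast numAut_pos G₀
  have ha : (numAut G₀ : ℝ) ≤ (numVertices G₀).factorial := by exact_mod_cast numAut_le G₀
  have hw := one_le_factorial G₀
  rw [cConst_sq, mul_pow, Real.sq_sqrt (oneConst_pos G₀).le, le_div_iff₀ (by positivity),
    threeConst, oneConst]
  set w : ℝ := ((numVertices G₀).factorial : ℝ)
  set e := numEdges G₀
  have h1 : (324 : ℝ) ^ e * 2 ^ e ≤ 32768 ^ e := by
    rw [← mul_pow]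
    exact pow_le_pow_left₀ (by norm_num) (by norm_num) e
  have h2 : (numAut G₀ : ℝ) ^ 3 ≤ w ^ 3 := by gcongr
  have h3 : (2 : ℝ) ^ (9 + 15 * e) = 512 * 32768 ^ e := by
    rw [pow_add, pow_mul]
    norm_num
  have h4 : ((18 : ℝ) ^ e) ^ 2 = 324 ^ e := by
    rw [← pow_mul, mul_comm e 2, pow_mul]
    norm_num
  calc (29 / 4 * ((e : ℝ) * (4 / 3 * 18 ^ e * w ^ 2))) ^ 2 * (4 / 3 * 2 ^ e * w) *
        (numAut G₀ : ℝ) ^ 3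
      = (29 / 4) ^ 2 * (4 / 3) ^ 3 * (((18 : ℝ) ^ e) ^ 2 * 2 ^ e) * (e ^ 2 * w ^ 5 *
        (numAut G₀ : ℝ) ^ 3) := by ring
    _ ≤ 512 * 32768 ^ e * (e ^ 2 * w ^ 5 * w ^ 3) := by
        rw [h4]
        gcongr
        norm_num
    _ = _ := by rw [h3]; ring

theorem sqrt_oneConst_le_cConst (he : 1 ≤ numEdges G₀) : √(oneConst G₀) ≤ cConst G₀ := by
  refine le_trans ?_ (le_cConst G₀)
  have h1 : (1 : ℝ) ≤ numEdges G₀ := by exact_mod_cast he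
  have h2 := one_le_mul_of_one_le_of_one_le h1 (one_le_threeConst G₀)
  exact le_mul_of_one_le_left (Real.sqrt_nonneg _) (by linarith)

theorem one_le_numEdges (hG₀ : G₀.edgeSet.Nonempty) : 1 ≤ numEdges G₀ :=
  (Set.ncard_pos (Set.toFinite _)).2 hG₀

theorem two_le_numVertices (hG₀ : G₀.edgeSet.Nonempty) : 2 ≤ numVertices G₀ := by
  obtain ⟨x, hx⟩ := hG₀
  induction x using Sym2.ind with
  | _ a b =>
  have hab : a ≠ b := SimpleGraph.Adj.ne hx
  rw [numVertices, ← card_pair hab]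
  exact card_le_univ _

theorem two_mul_numEdges_le : 2 * numEdges G₀ ≤ numVertices G₀ ^ 2 := by
  classical
  have h1 := G₀.card_edgeFinset_le_card_choose_two
  rw [← Set.ncard_coe_finset, SimpleGraph.coe_edgeFinset, Nat.choose_two_right] at h1
  have h2 := Nat.mul_div_le (Fintype.card V * (Fintype.card V - 1)) 2
  have h3 : Fintype.card V * (Fintype.card V - 1) ≤ Fintype.card V * Fintype.card V :=
    Nat.mul_le_mul_left _ (Nat.sub_le _ _)
  rw [numEdges, numVertices, sq]
  omega

/-- Three separate estimates: `v! / a ≥ 1`, `2 * e ≤ v ^ 2`, and `n / (n - 1) ≤ √2`. -/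
theorem le_cHat (hn : 16 ≤ n) :
    2 * (numEdges G₀ : ℝ) ^ 2 * (n / (n - 1)) ≤ cHat G₀ := by
  have ha0 : (0 : ℝ) < numAut G₀ := by exact_mod_cast numAut_pos G₀
  have ha : (numAut G₀ : ℝ) ≤ (numVertices G₀).factorial := by exact_mod_cast numAut_le G₀
  have h1 : 1 ≤ √((numVertices G₀).factorial : ℝ) / √(numAut G₀ : ℝ) := by
    rw [one_le_div (Real.sqrt_pos.2 ha0)]
    exact Real.sqrt_le_sqrt ha
  have hnR : (16 : ℝ) ≤ n := by exact_mod_cast hn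
  have h2 : (n : ℝ) / (n - 1) ≤ √2 := by
    refine Real.le_sqrt_of_sq_le ?_
    rw [div_pow, div_le_iff₀ (by nlinarith)]
    nlinarith
  have h3 : 2 * (numEdges G₀ : ℝ) ≤ numVertices G₀ ^ 2 := by
    exact_mod_cast two_mul_numEdges_le G₀
  have h4 : (0 : ℝ) ≤ n / (n - 1) := div_nonneg (by linarith) (by linarith)
  calc 2 * (numEdges G₀ : ℝ) ^ 2 * (n / (n - 1))
      = (n / (n - 1)) * (1 * (2 * (numEdges G₀ : ℝ)) * numEdges G₀) := by ring
    _ ≤ √2 * (√((numVertices G₀).factorial : ℝ) / √(numAut G₀ : ℝ) * numVertices G₀ ^ 2 *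
        numEdges G₀) := by gcongr
    _ = cHat G₀ := by rw [cHat]; ring

section

variable {p : ℝ}

/-- In the quotient of the upper bound for three images by the lower bound for one, `psiMin` and the
number of embeddings cancel, leaving `threeConst G₀`. -/
theorem isRegular_imgEdges (hG₀ : G₀.edgeSet.Nonempty) (hn : 4 * numVertices G₀ ^ 2 ≤ n)
    (hp0 : 0 < p) (hp1 : p < 1) (φ₀ : V ↪ Fin n) :
    IsRegular (imgEdges (N := Fin n) G₀) p (numEdges G₀) (numAut G₀ * degree G₀ n)
      (wt (imgEdges G₀) p (imgEdges G₀ φ₀)) (threeConst G₀) := by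
  have hv := two_le_numVertices G₀ hG₀
  have hn0 : 0 < n := by nlinarith
  exact
    { p_pos := hp0
      p_lt_one := hp1
      card_eq := card_imgEdges G₀
      e_pos := one_le_numEdges G₀ hG₀
      wt_eq := fun φ => wt_imgEdges_eq G₀ φ φ₀
      wt_le := fun φ₁ φ₂ φ₃ => (wt_union_imgEdges_le G₀ hp0 hn (by omega)
        (psiMin_pos G₀ hG₀ hn0 hp0) φ₁ φ₂ φ₃).trans
        (mul_le_mul_of_nonneg_left (le_wt_imgEdges G₀ hG₀ hn0 hp0 hp1.le φ₀)
          (zero_le_one.trans (one_le_threeConst G₀)))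
      hits_le := fun φ => by
        rw [card_hits_imgEdges]
        push_cast
        exact le_rfl }

theorem le_sqrt_var (hG₀ : G₀.edgeSet.Nonempty) (hn : 4 * numVertices G₀ ^ 2 ≤ n)
    (hp0 : 0 < p) (hp1 : p < 1) (φ₀ : V ↪ Fin n) :
    √(1 - p) * p ^ numEdges G₀ * Fintype.card (V ↪ Fin n) / √(psiMin G₀ n p) ≤
      √(var (imgEdges (N := Fin n) G₀) p (numEdges G₀)) := by
  have hv := two_le_numVertices G₀ hG₀
  have hn0 : 0 < n := by nlinarith
  have hψ := psiMin_pos G₀ hG₀ hn0 hp0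
  have hq : 0 < 1 - p := sub_pos.2 hp1
  refine Real.le_sqrt_of_sq_le ((le_of_eq ?_).trans
    ((mul_le_mul_of_nonneg_left (le_wt_imgEdges G₀ hG₀ hn0 hp0 hp1.le φ₀) ?_).trans
    (isRegular_imgEdges G₀ hG₀ hn hp0 hp1 φ₀).le_var))
  · rw [div_pow, mul_pow, mul_pow, Real.sq_sqrt hq.le, Real.sq_sqrt hψ.le]
    ring
  · positivity

/-- Sharing an edge fixes two vertices, so `D` is smaller than the number of embeddings by a factor
of order `n ^ 2`. With the lower bound of `σ` this is exactly compensated by the assumed size of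
`t`. -/
theorem degree_mul_div_le (hG₀ : G₀.edgeSet.Nonempty) (hn : 4 * numVertices G₀ ^ 2 ≤ n)
    (hp0 : 0 < p) (hp1 : p < 1) (φ₀ : V ↪ Fin n) {c t : ℝ} (hc : 0 ≤ c) (ht0 : 0 ≤ t)
    (ht : t ≤ c * ((n : ℝ) ^ 2 * p ^ numEdges G₀ * √(1 - p) / √(psiMin G₀ n p))) :
    numAut G₀ * degree G₀ n * t / √(var (imgEdges (N := Fin n) G₀) p (numEdges G₀)) ≤
      c * cHat G₀ := by
  have hv := two_le_numVertices G₀ hG₀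
  have hn16 : 16 ≤ n := by nlinarith
  have hψ := psiMin_pos G₀ hG₀ (by omega : 0 < n) hp0
  have hq : 0 < 1 - p := sub_pos.2 hp1
  have hσ := le_sqrt_var G₀ hG₀ hn hp0 hp1 φ₀
  have hD : ((numAut G₀ : ℝ) * degree G₀ n) ≤
      2 * numEdges G₀ ^ 2 * (n - 2).descFactorial (Fintype.card V - 2) := by
    have := card_hits_imgEdges_le G₀ φ₀
    rw [card_hits_imgEdges] at this
    exact_mod_cast this
  have hM : (Fintype.card (V ↪ Fin n) : ℝ) =
      n * (n - 1) * (n - 2).descFactorial (Fintype.card V - 2) := by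
    rw [Fintype.card_embedding_eq, Fintype.card_fin]
    obtain ⟨m, rfl⟩ : ∃ m, n = m + 2 := ⟨n - 2, by omega⟩
    obtain ⟨k, hk⟩ : ∃ k, Fintype.card V = k + 2 :=
      ⟨Fintype.card V - 2, by rw [numVertices] at hv; omega⟩
    rw [hk, Nat.succ_descFactorial_succ, Nat.succ_descFactorial_succ]
    simp only [Nat.add_sub_cancel]
    push_cast
    ring
  set X : ℝ := ((n - 2).descFactorial (Fintype.card V - 2) : ℝ) with hX
  have hM0 : (0 : ℝ) < Fintype.card (V ↪ Fin n) := by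
    exact_mod_cast Fintype.card_pos_iff.2 ⟨φ₀⟩
  have hnR : (16 : ℝ) ≤ n := by exact_mod_cast hn16
  have hX0 : 0 < X := by
    have h1 : 0 < (n : ℝ) * (n - 1) := by nlinarith
    rw [hM] at hM0
    exact (pos_iff_pos_of_mul_pos hM0).1 h1
  have hq' : 0 < √(1 - p) := Real.sqrt_pos.2 hq
  have hψ' : 0 < √(psiMin G₀ n p) := Real.sqrt_pos.2 hψ
  have hpe : 0 < p ^ numEdges G₀ := pow_pos hp0 _
  set y := √(1 - p) * p ^ numEdges G₀ / √(psiMin G₀ n p) with hy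
  have hy0 : 0 < y := by positivity
  have hσ' : y * (n * (n - 1) * X) ≤ √(var (imgEdges (N := Fin n) G₀) p (numEdges G₀)) := by
    rw [← hM]
    refine le_trans (le_of_eq ?_) hσ
    rw [hy]; ring
  have ht' : t ≤ c * n ^ 2 * y := ht.trans_eq (by rw [hy]; ring)
  have hn1 : (0 : ℝ) < n - 1 := by linarith
  have hn0 : (0 : ℝ) < n := by linarith
  calc numAut G₀ * degree G₀ n * t / √(var (imgEdges (N := Fin n) G₀) p (numEdges G₀))
      ≤ 2 * numEdges G₀ ^ 2 * X * (c * n ^ 2 * y) / (y * (n * (n - 1) * X)) := by gcongr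
    _ = c * (2 * (numEdges G₀ : ℝ) ^ 2 * (n / (n - 1))) := by
        field_simp
    _ ≤ c * cHat G₀ := mul_le_mul_of_nonneg_left (le_cHat G₀ hn16) hc

end

/-- The trivial regime: `P ≤ 1` and the bound of the inverse tail suffice, since `c / x` is at least
one. -/
theorem abs_div_tail_sub_one_le {P t x c d : ℝ} (hP0 : 0 ≤ P) (hP1 : P ≤ 1) (ht0 : 0 ≤ t)
    (hx0 : 0 < x) (hxc : x ≤ c) (htd : t ^ 2 / 2 ≤ d) :
    |P / GaussianStein.tail t - 1| ≤ 6 * (c / x * Real.exp d) * (1 + t ^ 3) := by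
  have htail := GaussianStein.tail_pos t
  have hle : P / GaussianStein.tail t ≤ 3 * (1 + t) * Real.exp d :=
    calc P / GaussianStein.tail t ≤ 1 / GaussianStein.tail t := by gcongr
      _ = (GaussianStein.tail t)⁻¹ := one_div _
      _ ≤ √(2 * Real.pi) * (1 + t) * Real.exp (t ^ 2 / 2) := GaussianStein.inv_tail_le ht0
      _ ≤ _ := by
        gcongr
        rw [Real.sqrt_le_left (by norm_num)]
        linarith [Real.pi_lt_d2]
  have hd : 0 ≤ d := le_trans (by positivity) htd
  have h1 : 1 ≤ 3 * (1 + t) * Real.exp d :=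
    one_le_mul_of_one_le_of_one_le (by linarith) (Real.one_le_exp hd)
  have h2 : 1 ≤ c / x := (one_le_div hx0).2 hxc
  have h3 : 1 + t ≤ 2 * (1 + t ^ 3) := by nlinarith [sq_nonneg (t - 1)]
  have h4 : 0 ≤ P / GaussianStein.tail t := div_nonneg hP0 htail.le
  calc |P / GaussianStein.tail t - 1| ≤ 3 * (1 + t) * Real.exp d := by
        rw [abs_le]
        constructor <;> linarith
    _ ≤ 3 * (2 * (1 + t ^ 3)) * Real.exp d := by gcongr
    _ = 6 * (1 * Real.exp d) * (1 + t ^ 3) := by ring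
    _ ≤ _ := by gcongr

theorem abs_prob_div_sub_one_le (hG₀ : G₀.edgeSet.Nonempty)
    (hn : 4 * numVertices G₀ ^ 2 ≤ n)
    (p : unitInterval) (hp0 : 0 < (p : ℝ)) (hp1 : (p : ℝ) < 1)
    (c₁ c₂ : ℝ) (hc₁ : 0 < c₁) (hc₂ : 0 < c₂)
    (t : ℝ) (ht0 : 0 ≤ t)
    (ht1 : t ≤ c₁ * ((n : ℝ) ^ 2 * (p : ℝ) ^ numEdges G₀ * √(1 - (p : ℝ)) /
      √(psiMin G₀ n p)))
    (ht2 : t ^ 2 * s G₀ n p t ≤ c₂) :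
    |(SimpleGraph.binomialRandom (Fin n) p).real {G | t < W G₀ n p G} /
        (1 - Phi t) - 1| ≤
      bigC G₀ c₁ c₂ *
        ((1 + t ^ 3) / √((1 - (p : ℝ)) * psiMin G₀ n p)) := by
  have hv := two_le_numVertices G₀ hG₀
  have hn0 : 0 < n := by nlinarith
  have hψ := psiMin_pos G₀ hG₀ hn0 hp0
  have hq : 0 < 1 - (p : ℝ) := sub_pos.2 hp1
  obtain ⟨φ₀⟩ : Nonempty (V ↪ Fin n) := by
    refine Function.Embedding.nonempty_of_card_le ?_
    rw [Fintype.card_fin]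
    refine le_trans ?_ hn
    rw [numVertices]
    nlinarith
  have : Nonempty (V ↪ Fin n) := ⟨φ₀⟩
  have h := isRegular_imgEdges G₀ hG₀ hn hp0 hp1 φ₀
  have hR := wt_imgEdges_le G₀ hp0 hn hψ φ₀
  have hb := degree_mul_div_le G₀ hG₀ hn hp0 hp1 φ₀ hc₁.le ht0 ht1
  have hσ : (degree G₀ n : ℝ) * t / sigma G₀ n p =
      numAut G₀ * degree G₀ n * t / √(var (imgEdges (N := Fin n) G₀) p (numEdges G₀)) := by
    rw [sigma_eq G₀ h, div_div_eq_mul_div]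
    ring
  rw [binomialRandom_real_lt_W G₀ h]
  change |_ / GaussianStein.tail t - 1| ≤ _
  set R := wt (imgEdges G₀) p (imgEdges G₀ φ₀) with hRdef
  set b := numAut G₀ * degree G₀ n * t / √(var (imgEdges (N := Fin n) G₀) p (numEdges G₀)) with hbdef
  have hb0 : 0 ≤ b := by positivity
  set x := √((1 - (p : ℝ)) * psiMin G₀ n p) with hx
  have hx0 : 0 < x := Real.sqrt_pos.2 (mul_pos hq hψ)
  -- Only the exponent `3` is needed here, and the minimum in `s` is at most one.
  have hs : (1 + t) * (1 / x) * Real.exp (3 * b) ≤ s G₀ n p t := by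
    rw [s, mul_assoc 5, mul_div_assoc 5, hσ]
    have h1 : t ≤ t / min (√(psiMin G₀ n p)) 1 :=
      le_div_self ht0 (lt_min (Real.sqrt_pos.2 hψ) zero_lt_one) (min_le_right _ _)
    gcongr
    norm_num
  have hM0 : (0 : ℝ) < Fintype.card (V ↪ Fin n) := by
    exact_mod_cast Fintype.card_pos
  have hδ : √(R / ((1 - p) * Fintype.card (V ↪ Fin n))) ≤ √(oneConst G₀) / x := by
    rw [hx, ← Real.sqrt_div' _ (mul_pos hq hψ).le]
    refine Real.sqrt_le_sqrt ?_
    rw [div_le_iff₀ (mul_pos hq hM0)]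
    refine hR.trans_eq ?_
    rw [oneConst]
    field_simp
  have hcG := cConst_nonneg G₀
  have hĉ := cHat_nonneg G₀
  -- The moment estimates need `δ ≤ 1`. Otherwise `x` is bounded by a constant and the claim is
  -- trivial.
  by_cases hδ1 : √(R / ((1 - p) * Fintype.card (V ↪ Fin n))) ≤ 1
  · set B := 29 / 4 * (numEdges G₀ * threeConst G₀ * √(R / ((1 - p) * Fintype.card (V ↪ Fin n)))) *
      Real.exp (3 * (numAut G₀ * degree G₀ n * t /
        √(var (imgEdges (N := Fin n) G₀) p (numEdges G₀)))) with hB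
    have hκ := one_le_threeConst G₀
    have hBle : B ≤ cConst G₀ * (1 / x) * Real.exp (3 * b) := by
      calc B ≤ 29 / 4 * (numEdges G₀ * threeConst G₀ * (√(oneConst G₀) / x)) *
            Real.exp (3 * b) := by
            rw [hB]
            gcongr
        _ = 29 / 4 * (numEdges G₀ * threeConst G₀) * √(oneConst G₀) * (1 / x) *
            Real.exp (3 * b) := by ring
        _ ≤ _ := by
            gcongr
            exact le_cConst G₀
    have hexp : B * t ^ 2 * (1 + t) ≤ c₂ * cConst G₀ :=
      calc B * t ^ 2 * (1 + t) ≤ cConst G₀ * (1 / x) * Real.exp (3 * b) * t ^ 2 * (1 + t) := by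
            gcongr
        _ = cConst G₀ * (t ^ 2 * ((1 + t) * (1 / x) * Real.exp (3 * b))) := by ring
        _ ≤ cConst G₀ * c₂ := by
            gcongr
            exact (mul_le_mul_of_nonneg_left hs (sq_nonneg t)).trans ht2
        _ = _ := mul_comm _ _
    refine (h.abs_tail_div_sub_one_le hδ1 hB ht0).trans ?_
    calc 30 * (B * Real.exp (B * t ^ 2 * (1 + t))) * (1 + t ^ 3)
        ≤ 30 * (cConst G₀ * (1 / x) * Real.exp (3 * b) * Real.exp (c₂ * cConst G₀)) *
          (1 + t ^ 3) := by gcongr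
      _ ≤ 100 * (1 + c₁) * (cConst G₀ * (1 / x) * Real.exp (5 * c₁ * cHat G₀) *
          Real.exp (c₂ * cConst G₀)) * (1 + t ^ 3) := by
          have h3 : 3 * b ≤ 5 * c₁ * cHat G₀ := by linarith
          gcongr
          linarith
      _ = _ := by
          rw [bigC, Real.exp_add]
          ring
  · have hxk : x ≤ √(oneConst G₀) := by
      have := (lt_of_not_ge hδ1).le.trans hδ
      rwa [one_le_div hx0] at this
    have hk := sqrt_oneConst_le_cConst G₀ (one_le_numEdges G₀ hG₀)
    have hxc := hxk.trans hk
    -- Since `1 / x ≤ s(t)`, the assumption gives `t ^ 2 ≤ c₂ * x`, and `x ≤ cConst G₀` in this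
    -- case.
    have htc : t ^ 2 / 2 ≤ c₂ * cConst G₀ := by
      have h1 : 1 / x ≤ s G₀ n p t := by
        refine le_trans ?_ hs
        have h2 : 1 ≤ Real.exp (3 * b) := Real.one_le_exp (by positivity)
        have h3 : 1 ≤ 1 + t := by linarith
        have h4 : 0 ≤ 1 / x := by positivity
        nlinarith [mul_le_mul h3 h2 zero_le_one (by linarith)]
      have h2 := (mul_le_mul_of_nonneg_left h1 (sq_nonneg t)).trans ht2
      rw [mul_one_div, div_le_iff₀ hx0] at h2
      nlinarith [mul_le_mul_of_nonneg_left hxc hc₂.le, sq_nonneg t]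
    have hP0 : 0 ≤ E (p : ℝ) (fun ω => if t < std (imgEdges (N := Fin n) G₀) p (numEdges G₀) ω
        then 1 else 0) := E_nonneg hp0.le hp1.le fun ω => by split_ifs <;> norm_num
    have hP1 : E (p : ℝ) (fun ω => if t < std (imgEdges (N := Fin n) G₀) p (numEdges G₀) ω
        then 1 else 0) ≤ 1 := by
      rw [← E_const (ι := Sym2 (Fin n)) (p : ℝ) 1]
      exact E_mono hp0.le hp1.le fun ω => by split_ifs <;> norm_num
    refine (abs_div_tail_sub_one_le hP0 hP1 ht0 hx0 hxc htc).trans ?_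
    have h2 : 1 ≤ Real.exp (5 * c₁ * cHat G₀) := Real.one_le_exp (by positivity)
    have h3 : 6 * 1 ≤ 100 * (1 + c₁) * Real.exp (5 * c₁ * cHat G₀) := by
      gcongr
      linarith
    have h4 : 0 ≤ cConst G₀ / x * Real.exp (c₂ * cConst G₀) * (1 + t ^ 3) := by positivity
    refine (le_of_eq (by ring)).trans ((mul_le_mul_of_nonneg_right h3 h4).trans_eq ?_)
    rw [bigC, Real.exp_add]
    ring

end SubgraphCount

theorem corollary1p3 {V : Type*} [Fintype V] (G₀ : SimpleGraph V)
    (hG₀ : G₀.edgeSet.Nonempty)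
    (n : ℕ) (hn : 4 * SubgraphCount.numVertices G₀ ^ 2 ≤ n)
    (p : unitInterval) (hp0 : 0 < (p : ℝ)) (hp1 : (p : ℝ) < 1)
    (c₁ c₂ : ℝ) (hc₁ : 0 < c₁) (hc₂ : 0 < c₂)
    (t : ℝ) (ht0 : 0 ≤ t)
    (ht1 : t ≤ c₁ * ((n : ℝ) ^ 2 * (p : ℝ) ^ SubgraphCount.numEdges G₀ * √(1 - (p : ℝ)) /
      √(SubgraphCount.psiMin G₀ n p)))
    (ht2 : t ^ 2 * SubgraphCount.s G₀ n p t ≤ c₂) :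
    |(SimpleGraph.binomialRandom (Fin n) p).real {G | t < SubgraphCount.W G₀ n p G} /
        (1 - SubgraphCount.Phi t) - 1| ≤
      SubgraphCount.bigC G₀ c₁ c₂ *
        ((1 + t ^ 3) / √((1 - (p : ℝ)) * SubgraphCount.psiMin G₀ n p)) := by
  classical
  exact SubgraphCount.abs_prob_div_sub_one_le G₀ hG₀ hn p hp0 hp1 c₁ c₂ hc₁ hc₂ t ht0 ht1 ht2

end
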